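/- Let $N\in\mathbb N$, $\alpha\in(0,N)$ and $p,q\in[1,\infty)$. Let $I_{\alpha/2}(x)=A_{\alpha/2}|x|^{-(N-\alpha/2)}$ be the Riesz potential on $\mathbb R^N$ of order $\alpha/2$, where $A_s=\Gamma(\frac{N-s}{2})/(\Gamma(\frac s2)\pi^{N/2}2^s)$. Let $E^{\alpha,p}(\mathbb R^N)$ be the space of weakly differentiable functions $u:\mathbb R^N\to\mathbb R$ with $$\|u\|_{E^{\alpha,p}}=\Bigl(\int_{\mathbb R^N}|Du|^2+\Bigl(\int_{\mathbb R^N}\bigl|I_{\alpha/2}*|u|^p\bigr|^2\Bigr)^{1/p}\Bigr)^{1/2}<\infty,$$ and let $E^{\alpha,p}_{\mathrm{rad}}(\mathbb R^N)$ be its subspace of radially symmetric functions. "Embedded" means continuously embedded. (i) If $\alpha\le 1$, then $E^{\alpha,p}_{\mathrm{rad}}(\mathbb R^N)$ is embedded in $L^q(\mathbb R^N)$ if and only if $E^{\alpha,p}(\mathbb R^N)$ is embedded in $L^q(\mathbb R^N)$. (ii) If $\alpha>1$, then $E^{\alpha,p}_{\mathrm{rad}}(\mathbb R^N)$ is embedded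 in $L^q(\mathbb R^N)$ if and only if either the condition $$(\mathcal Q_{\mathrm{rad}})\quad\begin{aligned}&\text{either}\quad \frac1p\ge\frac{(N-2)_+}{N+\alpha}\ \text{ and }\ \frac12-\frac1N\le\frac1q<\frac{3N+\alpha-4}{2(2p(N-1)+N-\alpha)},\\ &\text{or}\quad \frac1p\le\frac{(N-2)_+}{N+\alpha}\ \text{ and }\ \frac12-\frac1N\ge\frac1q>\frac{3N+\alpha-4}{2(2p(N-1)+N-\alpha)}\end{aligned}$$ holds, or $p(N-2)=N+\alpha$ and $\frac1q=\frac12-\frac1N$. (iii) If $\alpha>1$ and $(\mathcal Q_{\mathrm{rad}})$ holds, then there exists $S=S(N,\alpha,p,q)>0$ such that for every $u\in E^{\alpha,p}_{\mathrm{rad}}(\mathbb R^N)$ $$S\Bigl(\int_{\mathbb R^N}|u|^q\Bigr)^{\frac1q}\le\Bigl(\int_{\mathbb R^N}|Du|^2\Bigr)^{\frac\theta2}\Bigl(\int_{\mathbb R^N}\bigl|I_{\alpha/2}*|u|^p\bigr|^2\Bigr)^{\frac{1-\theta}{2p}},\qquad \theta=\frac{N+\alpha-\frac{2pN}{q}}{(N+\alpha)-p(N-2)}.$$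 -/

import Mathlib

open MeasureTheory
open scoped ENNReal NNReal ContDiff

noncomputable section

namespace CoulombSobolev

/-- The Riesz kernel `I_s(x) = A_s / |x|^(N-s)` on `ℝ^N`, where
`A_s = Γ((N-s)/2) / (Γ(s/2) π^(N/2) 2^s)`. -/
def rieszKernel {N : ℕ} (s : ℝ) (x : EuclideanSpace ℝ (Fin N)) : ℝ :=
  Real.Gamma (((N : ℝ) - s) / 2) /
      (Real.Gamma (s / 2) * Real.pi ^ ((N : ℝ) / 2) * (2 : ℝ) ^ s) /
    ‖x‖ ^ ((N : ℝ) - s)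

/-- The function `I_{α/2} * |u|^p`, with values in `[0, ∞]`. -/
def rieszPotential {N : ℕ} (α p : ℝ) (u : EuclideanSpace ℝ (Fin N) → ℝ)
    (x : EuclideanSpace ℝ (Fin N)) : ℝ≥0∞ :=
  ∫⁻ y, ENNReal.ofReal (rieszKernel (α / 2) (x - y)) * ENNReal.ofReal (|u y| ^ p)

/-- The Coulomb energy `∫ |I_{α/2} * |u|^p|^2 ∈ [0, ∞]`. -/
def coulombEnergy {N : ℕ} (α p : ℝ) (u : EuclideanSpace ℝ (Fin N) → ℝ) : ℝ≥0∞ :=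
  ∫⁻ x, rieszPotential α p u x ^ (2 : ℕ)

/-- `g` is a weak gradient of the locally integrable function `u`:
`∫ u ∂_v φ = - ∫ φ (g · v)` for all test functions `φ` and all directions `v`. -/
structure HasWeakGradient {N : ℕ} (u : EuclideanSpace ℝ (Fin N) → ℝ)
    (g : EuclideanSpace ℝ (Fin N) → EuclideanSpace ℝ (Fin N)) : Prop where
  locallyIntegrable : LocallyIntegrable u
  locallyIntegrable_grad : LocallyIntegrable g
  integral_eq : ∀ φ : EuclideanSpace ℝ (Fin N) → ℝ, ContDiff ℝ ∞ φ → HasCompactSupport φ →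
    ∀ v : EuclideanSpace ℝ (Fin N),
      ∫ x, u x * fderiv ℝ φ x v = -∫ x, φ x * inner ℝ (g x) v

/-- `u` is weakly differentiable. -/
def WeaklyDifferentiable {N : ℕ} (u : EuclideanSpace ℝ (Fin N) → ℝ) : Prop :=
  ∃ g, HasWeakGradient u g

open Classical in
/-- The weak gradient `Du` of a weakly differentiable function, which is unique up to
equality almost everywhere (and `0` by convention if `u` is not weakly differentiable). -/
def weakGradient {N : ℕ} (u : EuclideanSpace ℝ (Fin N) → ℝ) :
    EuclideanSpace ℝ (Fin N) → EuclideanSpace ℝ (Fin N) :=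
  if h : WeaklyDifferentiable u then h.choose else 0

theorem hasWeakGradient_weakGradient {N : ℕ} {u : EuclideanSpace ℝ (Fin N) → ℝ}
    (h : WeaklyDifferentiable u) : HasWeakGradient u (weakGradient u) := by
  unfold weakGradient
  rw [dif_pos h]
  exact h.choose_spec

theorem HasWeakGradient.ae_eq {N : ℕ} {u : EuclideanSpace ℝ (Fin N) → ℝ}
    {g g' : EuclideanSpace ℝ (Fin N) → EuclideanSpace ℝ (Fin N)}
    (h : HasWeakGradient u g) (h' : HasWeakGradient u g') : g =ᵐ[volume] g' := by
  have key : ∀ i : Fin N, ∀ᵐ x, g x i = g' x i := by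
    intro i
    have li : ∀ f : EuclideanSpace ℝ (Fin N) → EuclideanSpace ℝ (Fin N),
        LocallyIntegrable f → LocallyIntegrable (fun x => f x i) := by
      intro f hf x
      obtain ⟨s, hs, hi⟩ := hf x
      exact ⟨s, hs, (EuclideanSpace.proj (𝕜 := ℝ) i).integrable_comp hi⟩
    refine ae_eq_of_integral_contDiff_smul_eq (li g h.locallyIntegrable_grad)
      (li g' h'.locallyIntegrable_grad) ?_
    intro φ hφ hc
    have h1 := h.integral_eq φ hφ hc (EuclideanSpace.single i 1)
    have h2 := h'.integral_eq φ hφ hc (EuclideanSpace.single i 1)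
    have h3 := neg_injective (h1.symm.trans h2)
    simpa [EuclideanSpace.inner_single_right] using h3
  filter_upwards [ae_all_iff.2 key] with x hx
  ext i
  exact hx i

/-- The Dirichlet energy `∫ |Du|^2 ∈ [0, ∞]`. -/
def dirichletEnergy {N : ℕ} (u : EuclideanSpace ℝ (Fin N) → ℝ) : ℝ≥0∞ :=
  ∫⁻ x, ‖weakGradient u x‖ₑ ^ (2 : ℕ)

/-- The norm `(∫ |Du|^2 + (∫ |I_{α/2} * |u|^p|^2)^(1/p))^(1/2)`, with values in `[0, ∞]`. -/
def coulombSobolevNorm {N : ℕ} (α p : ℝ) (u : EuclideanSpace ℝ (Fin N) → ℝ) : ℝ≥0∞ :=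
  (dirichletEnergy u + coulombEnergy α p u ^ (1 / p)) ^ (1 / 2 : ℝ)

/-- The Coulomb–Sobolev space `E^{α,p}(ℝ^N)`: the measurable, weakly differentiable
functions of finite norm. -/
def space (N : ℕ) (α p : ℝ) : Set (EuclideanSpace ℝ (Fin N) → ℝ) :=
  {u | AEStronglyMeasurable u volume ∧ WeaklyDifferentiable u ∧ coulombSobolevNorm α p u < ⊤}

/-- `u` coincides almost everywhere with a radially symmetric function. -/
def IsRadial {N : ℕ} (u : EuclideanSpace ℝ (Fin N) → ℝ) : Prop :=
  ∃ f : ℝ → ℝ, ∀ᵐ x, u x = f ‖x‖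

/-- The subspace `E^{α,p}_rad(ℝ^N)` of radially symmetric functions. -/
def radialSpace (N : ℕ) (α p : ℝ) : Set (EuclideanSpace ℝ (Fin N) → ℝ) :=
  {u | u ∈ space N α p ∧ IsRadial u}

/-- The set `X` of functions, with the norm of `E^{α,p}(ℝ^N)`, is continuously embedded in
`L^q(ℝ^N)`. -/
def EmbedsInLq {N : ℕ} (α p q : ℝ) (X : Set (EuclideanSpace ℝ (Fin N) → ℝ)) : Prop :=
  ∃ C : ℝ≥0, ∀ u ∈ X, MemLp u (ENNReal.ofReal q) ∧
    eLpNorm u (ENNReal.ofReal q) ≤ C * coulombSobolevNorm α p u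

/-- The condition `(Q_rad)`. -/
def QRad (N : ℕ) (α p q : ℝ) : Prop :=
  (1 / p ≥ max ((N : ℝ) - 2) 0 / (N + α) ∧
    1 / 2 - 1 / (N : ℝ) ≤ 1 / q ∧
    1 / q < (3 * N + α - 4) / (2 * (2 * p * (N - 1) + N - α))) ∨
  (1 / p ≤ max ((N : ℝ) - 2) 0 / (N + α) ∧
    1 / 2 - 1 / (N : ℝ) ≥ 1 / q ∧
    1 / q > (3 * N + α - 4) / (2 * (2 * p * (N - 1) + N - α)))

/-- The interpolation exponent `θ`. -/
def interpolationExponent (N : ℕ) (α p q : ℝ) : ℝ :=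
  ((N : ℝ) + α - 2 * p * N / q) / ((N + α) - p * (N - 2))

end CoulombSobolev

end

/-! Write Δ = N+α-p(N-2), q₀ = 2(2p+α)/(2+α), D = ∫|Du|² and V for the Coulomb energy.

Reduction. Convolution with a radial mollifier increases neither D nor V (Jensen) and keeps radial
symmetry. By Fatou it therefore suffices to bound ∫|u|^q for smooth u with D ≤ 1 and V ≤ 1
(`NormalizedBound`). The family a u(b·) has two parameters. If Δ ≠ 0, they can be chosen to realise
any prescribed pair of energies, which turns a normalized bound into the product inequality with
exponent θ (`exists_scaling`, `NormalizedBound.exists_mul_le`).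

Bounds without symmetry. Comparing u(x) with its mean over a ball of radius r costs r times the
maximal function of |Du|, while the mean is at most C r^(-α/(2p)) (I_{α/2}*|u|^p)(x)^(1/p).
Optimising in r gives |u|^q₀ ≤ C((M|Du|)² + (I_{α/2}*|u|^p)²), hence the exponent q₀
(`normalizedBound_endpoint`). Letting r tend to infinity gives the Sobolev exponent when N > 2
(`normalizedBound_sobolev`). Exponents in between follow, and for N ≤ 2 all q ≥ q₀ are reached.

Bounds with symmetry. A radial u is a function f of one variable, with a weighted bound on f' and
with ∫_{B_R}|u|^p ≤ C R^((N-α)/2). Averaging f over an interval of length R^ω that balances the two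
bounds gives |f(R)| ≤ C R^(-κ), for large R or for small R according to the sign of Δ
(`RadialBounds.exists_enorm_le_rpow`). Then ∫|f|^q ≤ ∫ C r^(-κ(q-p))|f|^p, and the growth of the
p-mass makes this converge exactly under the strict inequality of `QRad`. The other end of the half
line is handled by the Sobolev-type decay of f (`normalizedBound_radial`).

Necessity. Dilating one function places 1/q weakly on the correct side of 1/2-1/N
(`EmbedsInLq.between`). Next come sums of radial bumps on n well separated annuli. The interaction
kernel is at most C|y-z|^(α-N), and integrating it over an annulus of radius R and width w costs w
R^(α-1) when α > 1. With width R^ω and amplitude R^(-κ) every annulus carries bounded energies, and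
L^q mass at least a constant if the strict inequality of `QRad` fails. The embedding then reads n ≤
C n^(q(θ/2+(1-θ)/(2p))), which places q on the nonradial side of q₀. For α > 1 this is incompatible
with the failure of `QRad` (`EmbedsInLq.qRad_or`). For α ≤ 1, annuli of unit width give the same
condition on q, so a radial embedding forces the nonradial range, where the bounds without symmetry
apply. -/

noncomputable section

namespace CoulombSobolev

/-! ### Polar coordinates and integrals of powers. -/

section Polar

variable {E : Type*} [NormedAddCommGroup E] [NormedSpace ℝ E] [FiniteDimensional ℝ E]
  [MeasurableSpace E] [BorelSpace E] (μ : Measure E) [μ.IsAddHaarMeasure]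

theorem lintegral_comp_smul_haar (f : E → ℝ≥0∞) {r : ℝ} (hr : 0 < r) :
    ∫⁻ x, f (r • x) ∂μ = ENNReal.ofReal ((r ^ Module.finrank ℝ E)⁻¹) * ∫⁻ x, f x ∂μ := by
  have h := Measure.map_addHaar_smul μ hr.ne'
  have e : ∫⁻ x, f (r • x) ∂μ = ∫⁻ x, f x ∂(Measure.map (r • ·) μ) :=
    ((Homeomorph.smulOfNeZero r hr.ne').measurableEmbedding.lintegral_map f).symm
  rw [e, h, lintegral_smul_measure, abs_of_nonneg (by positivity), smul_eq_mul]

theorem lintegral_polar [Nontrivial E] {f : E → ℝ≥0∞} (hf : Measurable f) :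
    ∫⁻ x, f x ∂μ = ∫⁻ σ : Metric.sphere (0 : E) 1, (∫⁻ r in Set.Ioi (0 : ℝ),
      ENNReal.ofReal (r ^ (Module.finrank ℝ E - 1)) * f (r • (σ : E))) ∂μ.toSphere := by
  calc
    ∫⁻ x, f x ∂μ = ∫⁻ x : ({(0)}ᶜ : Set E), f x.1 ∂(μ.comap (↑)) := by
      rw [lintegral_subtype_comap (measurableSet_singleton _).compl, restrict_compl_singleton]
    _ = ∫⁻ x, f (x.2.1 • x.1.1) ∂(μ.toSphere.prod (.volumeIoiPow (Module.finrank ℝ E - 1))) := by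
      rw [← (μ.measurePreserving_homeomorphUnitSphereProd).lintegral_comp_emb
        (Homeomorph.measurableEmbedding _)]
      refine lintegral_congr fun x => ?_
      congr 1
      exact congrArg Subtype.val ((homeomorphUnitSphereProd E).symm_apply_apply x).symm
    _ = _ := by
      rw [lintegral_prod _ (by fun_prop)]
      refine lintegral_congr fun σ => ?_
      rw [Measure.volumeIoiPow, lintegral_withDensity_eq_lintegral_mul _ (by fun_prop) (by fun_prop)]
      exact lintegral_subtype_comap measurableSet_Ioi
        (fun r : ℝ => ENNReal.ofReal (r ^ (Module.finrank ℝ E - 1)) * f (r • (σ : E)))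

theorem lintegral_radial [Nontrivial E] {f : ℝ → ℝ≥0∞} (hf : Measurable f) :
    ∫⁻ x, f ‖x‖ ∂μ = μ.toSphere Set.univ * ∫⁻ r in Set.Ioi (0 : ℝ),
      ENNReal.ofReal (r ^ (Module.finrank ℝ E - 1)) * f r := by
  rw [lintegral_polar μ (f := fun x => f ‖x‖) (hf.comp measurable_norm)]
  have : ∀ σ : Metric.sphere (0 : E) 1, ∫⁻ r in Set.Ioi (0 : ℝ),
      ENNReal.ofReal (r ^ (Module.finrank ℝ E - 1)) * f ‖r • (σ : E)‖ =
      ∫⁻ r in Set.Ioi (0 : ℝ), ENNReal.ofReal (r ^ (Module.finrank ℝ E - 1)) * f r := by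
    intro σ
    refine setLIntegral_congr_fun measurableSet_Ioi fun r hr => ?_
    have : ‖r • (σ : E)‖ = r := by
      rw [norm_smul, norm_eq_of_mem_sphere, mul_one, Real.norm_of_nonneg (le_of_lt hr)]
    simp only [this]
  rw [lintegral_congr this, lintegral_const, mul_comm]

theorem lintegral_ball_rpow_lt_top [Nontrivial E] {γ R : ℝ} (hγ : γ < Module.finrank ℝ E) :
    ∫⁻ x in Metric.ball (0 : E) R, ENNReal.ofReal (‖x‖ ^ (-γ)) ∂μ < ⊤ := by
  have h := integrableOn_ball_of_norm_le_rpow (μ := μ) (f := fun x : E => ‖x‖ ^ (-γ)) (C := 1)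
    (r := R) (Nat.one_le_iff_ne_zero.2 Module.finrank_pos.ne') hγ
    (Filter.Eventually.of_forall fun x => by
      rw [Real.norm_of_nonneg (Real.rpow_nonneg (norm_nonneg _) _), one_mul])
    (measurable_norm.pow_const _).aestronglyMeasurable
  exact h.lintegral_lt_top

end Polar

theorem lintegral_Ioo_rpow {a R : ℝ} (ha : -1 < a) (hR : 0 ≤ R) :
    ∫⁻ r in Set.Ioo 0 R, ENNReal.ofReal (r ^ a) = ENNReal.ofReal (R ^ (a + 1) / (a + 1)) := by
  rw [← setLIntegral_congr Ioo_ae_eq_Ioc.symm, ← ofReal_integral_eq_lintegral_ofReal,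
    ← intervalIntegral.integral_of_le hR, integral_rpow (Or.inl ha),
    Real.zero_rpow (by linarith), sub_zero]
  · exact (intervalIntegral.intervalIntegrable_rpow' ha).1
  · filter_upwards [ae_restrict_mem measurableSet_Ioc] with y hy
    exact Real.rpow_nonneg hy.1.le _

theorem lintegral_Ioi_rpow {a R : ℝ} (ha : a < -1) (hR : 0 < R) :
    ∫⁻ r in Set.Ioi R, ENNReal.ofReal (r ^ a) = ENNReal.ofReal (R ^ (a + 1) / (-(a + 1))) := by
  rw [← ofReal_integral_eq_lintegral_ofReal (integrableOn_Ioi_rpow_of_lt ha hR),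
    integral_Ioi_rpow_of_lt ha hR]
  · congr 1; rw [div_neg, neg_div]
  · filter_upwards [ae_restrict_mem measurableSet_Ioi] with y hy
    exact Real.rpow_nonneg (hR.trans hy).le _

theorem pow_pred_eq_rpow (a : ℝ) {n : ℕ} (hn : n ≠ 0) :
    a ^ (n - 1) = a ^ ((n : ℝ) - 1) := by
  rw [← Real.rpow_natCast, Nat.cast_sub (Nat.one_le_iff_ne_zero.2 hn), Nat.cast_one]

/-! ### The Hardy–Littlewood maximal function on L². -/

section Maximal

variable {E : Type*} [NormedAddCommGroup E] [NormedSpace ℝ E] [FiniteDimensional ℝ E]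
  [MeasurableSpace E] [BorelSpace E] (μ : Measure E) [μ.IsAddHaarMeasure]

/-- The integral `∫_{|z| < 1} g (x + r z) dz`, that is, the average of `g` over the ball of
radius `r` centred at `x`, up to a dimensional constant. -/
def ballMean (g : E → ℝ≥0∞) (x : E) (r : ℝ) : ℝ≥0∞ :=
  ∫⁻ z in Metric.ball (0 : E) 1, g (x + r • z) ∂μ

/-- The (dyadic-radius) Hardy–Littlewood maximal function, up to a dimensional constant. -/
def maximalFun (g : E → ℝ≥0∞) (x : E) : ℝ≥0∞ :=
  ⨆ k : ℤ, ballMean μ g x ((2 : ℝ) ^ k)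

theorem ballMean_eq (g : E → ℝ≥0∞) (x : E) {r : ℝ} (hr : 0 < r) :
    ballMean μ g x r =
      ENNReal.ofReal ((r ^ Module.finrank ℝ E)⁻¹) * ∫⁻ y in Metric.ball x r, g y ∂μ := by
  rw [ballMean, ← lintegral_indicator Metric.isOpen_ball.measurableSet,
    ← lintegral_indicator Metric.isOpen_ball.measurableSet,
    ← lintegral_add_left_eq_self ((Metric.ball x r).indicator g) x, ← lintegral_comp_smul_haar μ _ hr]
  refine lintegral_congr fun z => ?_
  have : z ∈ Metric.ball (0 : E) 1 ↔ x + r • z ∈ Metric.ball x r := by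
    simp [norm_smul, abs_of_pos hr, hr]
  by_cases hz : z ∈ Metric.ball (0 : E) 1
  · rw [Set.indicator_of_mem hz, Set.indicator_of_mem (this.1 hz)]
  · rw [Set.indicator_of_notMem hz, Set.indicator_of_notMem (fun h => hz (this.2 h))]

/-- The supremum runs over dyadic radii only. Rounding r up to the next power of 2 at most doubles
it, which costs 2^d because means are normalised by r^d. -/
theorem ballMean_le_maximalFun (g : E → ℝ≥0∞) (x : E) {r : ℝ} (hr : 0 < r) :
    ballMean μ g x r ≤ ENNReal.ofReal (2 ^ Module.finrank ℝ E) * maximalFun μ g x := by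
  obtain ⟨k, hk1, hk2⟩ := exists_mem_Ioc_zpow hr (one_lt_two (α := ℝ))
  have h2 : (0 : ℝ) < 2 ^ (k + 1) := by positivity
  refine le_trans ?_ (mul_le_mul_right (le_iSup _ (k + 1)) _)
  rw [ballMean_eq μ g x hr, ballMean_eq μ g x h2, ← mul_assoc, ← ENNReal.ofReal_mul (by positivity)]
  gcongr ENNReal.ofReal ?_ * ?_
  · rw [← div_eq_mul_inv, ← div_pow, ← inv_pow]
    gcongr
    rw [zpow_add_one₀ two_ne_zero, inv_eq_one_div,
      div_le_div_iff₀ hr (by positivity)]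
    nlinarith
  · exact lintegral_mono_set (Metric.ball_subset_ball hk2)

theorem measurable_ballMean {g : E → ℝ≥0∞} (hg : Measurable g) (r : ℝ) :
    Measurable fun x => ballMean μ g x r := by
  unfold ballMean
  exact Measurable.lintegral_prod_right' (f := fun q : E × E => g (q.1 + r • q.2)) (by fun_prop)

theorem measurable_maximalFun {g : E → ℝ≥0∞} (hg : Measurable g) :
    Measurable (maximalFun μ g) :=
  Measurable.iSup fun _ => measurable_ballMean μ hg _

/-- The weak (1,1) estimate, by Vitali covering: on a disjoint subfamily of balls the integrals of
`h` add up, and the balls enlarged by 4 cover the level set. -/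
theorem measure_lt_maximalFun_le (h : E → ℝ≥0∞) {t : ℝ≥0∞} (ht : t ≠ 0)
    (ht' : t ≠ ⊤) [Nontrivial E] :
    μ {x | t < maximalFun μ h x} ≤
      ENNReal.ofReal (4 ^ Module.finrank ℝ E) * μ (Metric.ball 0 1) * (∫⁻ x, h x ∂μ) / t := by
  set d := Module.finrank ℝ E with hd
  have hd0 : d ≠ 0 := Module.finrank_pos.ne'
  by_cases hK : ∫⁻ x, h x ∂μ = ⊤
  · rw [hK, ENNReal.mul_top, ENNReal.top_div_of_ne_top ht']
    · exact le_top
    · exact mul_ne_zero (by simp) (Metric.measure_ball_pos μ _ one_pos).ne'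
  set S := {x | t < maximalFun μ h x}
  have hS : ∀ x ∈ S, ∃ r : ℝ, 0 < r ∧
      t * ENNReal.ofReal (r ^ d) ≤ ∫⁻ y in Metric.ball x r, h y ∂μ := by
    intro x hx
    obtain ⟨k, hk⟩ := lt_iSup_iff.1 (show t < ⨆ k : ℤ, ballMean μ h x ((2 : ℝ) ^ k) from hx)
    have h2 : (0 : ℝ) < 2 ^ k := by positivity
    refine ⟨2 ^ k, h2, ?_⟩
    rw [ballMean_eq μ h x h2] at hk
    calc t * ENNReal.ofReal (((2 : ℝ) ^ k) ^ d) ≤ (ENNReal.ofReal ((((2 : ℝ) ^ k) ^ d)⁻¹) *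
          ∫⁻ y in Metric.ball x (2 ^ k), h y ∂μ) * ENNReal.ofReal (((2 : ℝ) ^ k) ^ d) := by
          gcongr
      _ = ENNReal.ofReal ((((2 : ℝ) ^ k) ^ d)⁻¹ * ((2 : ℝ) ^ k) ^ d) *
          ∫⁻ y in Metric.ball x (2 ^ k), h y ∂μ := by
          rw [ENNReal.ofReal_mul (by positivity)]; ring
      _ = _ := by rw [inv_mul_cancel₀ (by positivity), ENNReal.ofReal_one, one_mul]
  choose! r hr0 hr using hS
  -- The covering lemma needs bounded radii; here t r^d ≤ ∫ h < ∞ bounds every radius larger than 1.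
  have hbound : ∃ R : ℝ, ∀ x ∈ S, r x ≤ R := by
    have hfin : (∫⁻ x, h x ∂μ) / t ≠ ⊤ := ENNReal.div_ne_top hK ht
    refine ⟨max 1 ((∫⁻ x, h x ∂μ) / t).toReal, fun x hx => ?_⟩
    by_cases h1 : r x ≤ 1
    · exact h1.trans (le_max_left _ _)
    · refine le_trans ?_ (le_max_right _ _)
      have h3 : ENNReal.ofReal (r x ^ d) ≤ (∫⁻ x, h x ∂μ) / t := by
        rw [ENNReal.le_div_iff_mul_le (Or.inl ht) (Or.inl ht'), mul_comm]
        exact (hr x hx).trans (setLIntegral_le_lintegral _ _)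
      have h4 := (ENNReal.ofReal_le_iff_le_toReal hfin).1 h3
      exact (le_self_pow₀ (not_le.1 h1).le hd0).trans h4
  obtain ⟨R, hR⟩ := hbound
  obtain ⟨u, huS, hdisj, hcov⟩ :=
    Vitali.exists_disjoint_subfamily_covering_enlargement_ball S id r R hR 4 (by norm_num)
  have hcount : u.Countable := hdisj.countable_of_isOpen (fun _ _ => Metric.isOpen_ball)
    (fun x hx => ⟨x, Metric.mem_ball_self (hr0 x (huS hx))⟩)
  have hsub : S ⊆ ⋃ b ∈ u, Metric.ball b (4 * r b) := by
    intro x hx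
    obtain ⟨b, hb, hsub⟩ := hcov x hx
    exact Set.mem_biUnion hb (hsub (Metric.mem_ball_self (hr0 x hx)))
  have : Countable u := hcount.to_subtype
  calc μ S ≤ ∑' b : u, μ (Metric.ball b.1 (4 * r b)) :=
        (measure_mono hsub).trans (measure_biUnion_le μ hcount _)
    _ ≤ ∑' b : u, ENNReal.ofReal (4 ^ d) * μ (Metric.ball 0 1) *
          (∫⁻ y in Metric.ball b.1 (r b), h y ∂μ) / t := by
        refine ENNReal.tsum_le_tsum fun b => ?_
        have hb := hr b.1 (huS b.2)
        rw [μ.addHaar_ball _ (mul_pos four_pos (hr0 b.1 (huS b.2))).le, ← hd, mul_pow,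
          ENNReal.ofReal_mul (by positivity)]
        have h3 : ENNReal.ofReal (r b ^ d) ≤ (∫⁻ y in Metric.ball b.1 (r b), h y ∂μ) / t := by
          rw [ENNReal.le_div_iff_mul_le (Or.inl ht) (Or.inl ht'), mul_comm]
          exact hb
        calc _ ≤ ENNReal.ofReal (4 ^ d) * ((∫⁻ y in Metric.ball b.1 (r b), h y ∂μ) / t) *
              μ (Metric.ball 0 1) := by gcongr
          _ = _ := by simp only [div_eq_mul_inv]; ring
    _ = ENNReal.ofReal (4 ^ d) * μ (Metric.ball 0 1) *
          (∑' b : u, ∫⁻ y in Metric.ball b.1 (r b), h y ∂μ) / t := by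
        simp only [div_eq_mul_inv]
        rw [ENNReal.tsum_mul_right, ENNReal.tsum_mul_left]
    _ ≤ _ := by
        gcongr
        have hu := lintegral_biUnion (μ := μ) hcount (fun b _ => Metric.isOpen_ball.measurableSet)
          hdisj h
        simp only [id] at hu
        rw [← hu]
        exact setLIntegral_le_lintegral _ _

/-- The layer-cake formula for a². Only this inequality is needed, and proving it first for finite b
≤ a covers a = ∞. -/
theorem sq_le_lintegral_Ioi (a : ℝ≥0∞) :
    a ^ 2 ≤ ∫⁻ t in Set.Ioi (0 : ℝ),
      ENNReal.ofReal (2 * t) * Set.indicator {t : ℝ | ENNReal.ofReal t < a} 1 t := by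
  have key : ∀ b : ℝ≥0, (b : ℝ≥0∞) ≤ a → (b : ℝ≥0∞) ^ 2 ≤ ∫⁻ t in Set.Ioi (0 : ℝ),
      ENNReal.ofReal (2 * t) * Set.indicator {t : ℝ | ENNReal.ofReal t < a} 1 t := by
    intro b hb
    calc (b : ℝ≥0∞) ^ 2 = ENNReal.ofReal 2 * ∫⁻ t in Set.Ioo (0 : ℝ) b, ENNReal.ofReal (t ^ (1 : ℝ)) := by
          rw [lintegral_Ioo_rpow (a := 1) (by norm_num) b.coe_nonneg, ← ENNReal.ofReal_mul (by norm_num)]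
          have h2 : (2 : ℝ) * ((b : ℝ) ^ ((1 : ℝ) + 1) / (1 + 1)) = (b : ℝ) ^ 2 := by
            rw [one_add_one_eq_two, Real.rpow_two]; ring
          rw [h2, ENNReal.ofReal_pow b.coe_nonneg, ENNReal.ofReal_coe_nnreal]
      _ = ∫⁻ t in Set.Ioo (0 : ℝ) b, ENNReal.ofReal (2 * t) *
          Set.indicator {t : ℝ | ENNReal.ofReal t < a} 1 t := by
          rw [← lintegral_const_mul _ (by fun_prop)]
          refine setLIntegral_congr_fun measurableSet_Ioo fun t ht => ?_
          have : ENNReal.ofReal t < a := by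
            refine lt_of_lt_of_le ?_ hb
            rw [← ENNReal.ofReal_coe_nnreal]
            exact (ENNReal.ofReal_lt_ofReal_iff (ht.1.trans ht.2)).2 ht.2
          simp [this, ENNReal.ofReal_mul]
      _ ≤ _ := lintegral_mono_set Set.Ioo_subset_Ioi_self
  cases a with
  | coe b => exact key b le_rfl
  | top =>
    refine le_of_eq ?_
    symm
    rw [ENNReal.top_pow two_ne_zero]
    refine ENNReal.eq_top_of_forall_nnreal_le fun r => ?_
    refine le_trans ?_ (key (r + 1) le_top)
    norm_cast
    nlinarith [r.2, sq_nonneg r]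

/-- Marcinkiewicz interpolation: the weak (1,1) estimate is applied, at each height t, to the part
of `g` above a multiple of t, and then integrated against 2t dt. -/
theorem exists_lintegral_maximalFun_sq_le [Nontrivial E] :
    ∃ C : ℝ≥0, ∀ g : E → ℝ≥0∞, Measurable g →
      ∫⁻ x, maximalFun μ g x ^ 2 ∂μ ≤ C * ∫⁻ x, g x ^ 2 ∂μ := by
  set d := Module.finrank ℝ E with hd
  have hv : μ (Metric.ball (0 : E) 1) ≠ ⊤ := measure_ball_lt_top.ne
  have hv0 : μ (Metric.ball (0 : E) 1) ≠ 0 := (Metric.measure_ball_pos μ _ one_pos).ne'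
  set v : ℝ := (μ (Metric.ball (0 : E) 1)).toReal with hvdef
  have hvpos : 0 < v := ENNReal.toReal_pos hv0 hv
  have hvv : μ (Metric.ball (0 : E) 1) = ENNReal.ofReal v := (ENNReal.ofReal_toReal hv).symm
  set A : ℝ≥0∞ := ENNReal.ofReal (4 ^ d) * μ (Metric.ball 0 1) with hA
  have hAtop : A ≠ ⊤ := ENNReal.mul_ne_top ENNReal.ofReal_ne_top hv
  refine ⟨(4 * A * ENNReal.ofReal (2 * v)).toNNReal, fun g hg => ?_⟩
  rw [ENNReal.coe_toNNReal (ENNReal.mul_ne_top (ENNReal.mul_ne_top (by norm_num) hAtop)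
    ENNReal.ofReal_ne_top)]
  have hmeas : Measurable fun q : E × ℝ =>
      Set.indicator {q : E × ℝ | ENNReal.ofReal q.2 < maximalFun μ g q.1} (1 : E × ℝ → ℝ≥0∞) q :=
    measurable_one.indicator (measurableSet_lt (by fun_prop)
      ((measurable_maximalFun μ hg).comp measurable_fst))
  have hmeas2 : Measurable fun q : ℝ × E =>
      Set.indicator {q : ℝ × E | ENNReal.ofReal (q.1 / (2 * v)) < g q.2} (1 : ℝ × E → ℝ≥0∞) q :=
    measurable_one.indicator (measurableSet_lt (by fun_prop) (hg.comp measurable_snd))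
  calc ∫⁻ x, maximalFun μ g x ^ 2 ∂μ ≤ ∫⁻ x, (∫⁻ t in Set.Ioi (0 : ℝ), ENNReal.ofReal (2 * t) *
        Set.indicator {t : ℝ | ENNReal.ofReal t < maximalFun μ g x} 1 t) ∂μ :=
        lintegral_mono fun x => sq_le_lintegral_Ioi _
    _ = ∫⁻ t in Set.Ioi (0 : ℝ), (∫⁻ x, ENNReal.ofReal (2 * t) *
        Set.indicator {x | ENNReal.ofReal t < maximalFun μ g x} 1 x ∂μ) := by
        rw [lintegral_lintegral_swap]
        · rfl
        · exact (Measurable.mul (by fun_prop) hmeas).aemeasurable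
    _ ≤ ∫⁻ t in Set.Ioi (0 : ℝ), (4 * A) * ∫⁻ x, g x *
        Set.indicator {x | ENNReal.ofReal (t / (2 * v)) < g x} 1 x ∂μ := by
        refine setLIntegral_mono' measurableSet_Ioi fun t ht => ?_
        have ht0 : (0 : ℝ) < t := ht
        -- Truncation of g at height t/(2v). Since `ballMean` is not divided by the volume v of the
        -- unit ball, the discarded part contributes at most t/2 to each mean.
        set h : E → ℝ≥0∞ := fun x => g x *
          Set.indicator {x | ENNReal.ofReal (t / (2 * v)) < g x} 1 x with hh
        have hsub : {x | ENNReal.ofReal t < maximalFun μ g x} ⊆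
            {x | ENNReal.ofReal (t / 2) < maximalFun μ h x} := by
          intro x hx
          by_contra hcon
          have hcon' : maximalFun μ h x ≤ ENNReal.ofReal (t / 2) := not_lt.1 hcon
          refine absurd (show ENNReal.ofReal t < maximalFun μ g x from hx) (not_lt.2 (iSup_le fun k => ?_))
          calc ballMean μ g x (2 ^ k)
              ≤ ∫⁻ z in Metric.ball (0 : E) 1,
                (h (x + (2 : ℝ) ^ k • z) + ENNReal.ofReal (t / (2 * v))) ∂μ := by
                refine lintegral_mono fun z => ?_
                by_cases hz : ENNReal.ofReal (t / (2 * v)) < g (x + (2 : ℝ) ^ k • z)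
                · simp [hh, hz]
                · exact (not_lt.1 hz).trans le_add_self
            _ = ballMean μ h x (2 ^ k) + ENNReal.ofReal (t / 2) := by
                rw [lintegral_add_right _ measurable_const, setLIntegral_const, hvv,
                  ← ENNReal.ofReal_mul (by positivity)]
                congr 2
                field_simp
            _ ≤ ENNReal.ofReal (t / 2) + ENNReal.ofReal (t / 2) := by
                gcongr
                exact (le_iSup (fun k : ℤ => ballMean μ h x ((2 : ℝ) ^ k)) k).trans hcon'
            _ = ENNReal.ofReal t := by
                rw [← ENNReal.ofReal_add (by positivity) (by positivity), add_halves]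
        have hweak := measure_lt_maximalFun_le μ h
          (t := ENNReal.ofReal (t / 2)) (by simp [ht0]) ENNReal.ofReal_ne_top
        have hms : MeasurableSet {x | ENNReal.ofReal t < maximalFun μ g x} :=
          measurableSet_lt measurable_const (measurable_maximalFun μ hg)
        rw [lintegral_const_mul _ (measurable_one.indicator hms), lintegral_indicator_one hms]
        calc ENNReal.ofReal (2 * t) * μ {x | ENNReal.ofReal t < maximalFun μ g x}
            ≤ ENNReal.ofReal (2 * t) * (A * (∫⁻ x, h x ∂μ) / ENNReal.ofReal (t / 2)) := by
              gcongr; exact (measure_mono hsub).trans hweak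
          _ = (ENNReal.ofReal (2 * t) / ENNReal.ofReal (t / 2)) * A * ∫⁻ x, h x ∂μ := by
              simp only [div_eq_mul_inv]; ring
          _ = _ := by
              rw [← ENNReal.ofReal_div_of_pos (by positivity)]
              congr 2
              rw [show 2 * t / (t / 2) = 4 by field_simp; norm_num]
              norm_num
    _ = (4 * A) * ∫⁻ x, (∫⁻ t in Set.Ioi (0 : ℝ), g x *
        Set.indicator {t : ℝ | ENNReal.ofReal (t / (2 * v)) < g x} 1 t) ∂μ := by
        rw [lintegral_const_mul]
        · congr 1
          rw [lintegral_lintegral_swap]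
          · rfl
          · exact ((hg.comp measurable_snd).mul hmeas2).aemeasurable
        · exact Measurable.lintegral_prod_right' (f := fun q : ℝ × E => g q.2 *
            Set.indicator {q : ℝ × E | ENNReal.ofReal (q.1 / (2 * v)) < g q.2} 1 q)
            ((hg.comp measurable_snd).mul hmeas2)
    _ ≤ (4 * A) * ∫⁻ x, ENNReal.ofReal (2 * v) * g x ^ 2 ∂μ := by
        gcongr with x
        have hms : MeasurableSet {t : ℝ | ENNReal.ofReal (t / (2 * v)) < g x} :=
          measurableSet_lt (by fun_prop) measurable_const
        rw [lintegral_const_mul _ (measurable_one.indicator hms), lintegral_indicator_one hms,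
          Measure.restrict_apply hms]
        by_cases hgx : g x = ⊤
        · rw [hgx, ENNReal.top_pow two_ne_zero, ENNReal.mul_top (by simp [hvpos])]
          exact le_top
        have : {t : ℝ | ENNReal.ofReal (t / (2 * v)) < g x} ∩ Set.Ioi 0 ⊆
            Set.Ioo 0 (2 * v * (g x).toReal) := by
          rintro t ⟨h1, h2⟩
          refine ⟨h2, ?_⟩
          have := (ENNReal.ofReal_lt_iff_lt_toReal (div_nonneg (le_of_lt h2) (by positivity)) hgx).1 h1
          rwa [div_lt_iff₀' (by positivity)] at this
        calc g x * volume ({t : ℝ | ENNReal.ofReal (t / (2 * v)) < g x} ∩ Set.Ioi 0)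
            ≤ g x * (ENNReal.ofReal (2 * v) * g x) := by
              gcongr
              refine (measure_mono this).trans ?_
              rw [Real.volume_Ioo, sub_zero, ENNReal.ofReal_mul (by positivity),
                ENNReal.ofReal_toReal hgx]
          _ = _ := by ring
    _ = _ := by rw [lintegral_const_mul _ (by fun_prop)]; ring

end Maximal

/-! ### Jensen's inequality and radial mollification. -/

/-- Hölder applied to w h = (w h^p)^(1/p) w^(1-1/p). For a weight of total mass 1 this is Jensen's
inequality. -/
theorem lintegral_weighted_rpow_le {X : Type*} [MeasurableSpace X] {μ : Measure X}
    {w h : X → ℝ≥0∞} (hw : AEMeasurable w μ) (hh : AEMeasurable h μ) {p : ℝ} (hp : 1 ≤ p) :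
    (∫⁻ x, w x * h x ∂μ) ^ p ≤ (∫⁻ x, w x ∂μ) ^ (p - 1) * ∫⁻ x, w x * h x ^ p ∂μ := by
  have hp0 : 0 < p := by linarith
  have h1p : 0 ≤ 1 - 1 / p := by rw [sub_nonneg, div_le_one hp0]; exact hp
  have hol := ENNReal.lintegral_mul_norm_pow_le (μ := μ) (hw.mul (hh.pow_const p)) hw
    (p := 1 / p) (q := 1 - 1 / p) (by positivity) h1p (by ring)
  have e : ∀ x, (w x * h x ^ p) ^ (1 / p) * w x ^ (1 - 1 / p) = w x * h x := by
    intro x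
    rw [ENNReal.mul_rpow_of_nonneg _ _ (by positivity), ← ENNReal.rpow_mul,
      mul_one_div_cancel hp0.ne', ENNReal.rpow_one, mul_right_comm,
      ← ENNReal.rpow_add_of_nonneg _ _ (by positivity) h1p]
    simp
  simp only [Pi.mul_apply, e] at hol
  calc (∫⁻ x, w x * h x ∂μ) ^ p
      ≤ ((∫⁻ x, w x * h x ^ p ∂μ) ^ (1 / p) * (∫⁻ x, w x ∂μ) ^ (1 - 1 / p)) ^ p := by
        gcongr
    _ = _ := by
        rw [ENNReal.mul_rpow_of_nonneg _ _ hp0.le, ← ENNReal.rpow_mul, ← ENNReal.rpow_mul,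
          one_div_mul_cancel hp0.ne', ENNReal.rpow_one, mul_comm]
        congr 2
        field_simp

theorem lintegral_weighted_sq_le {X : Type*} [MeasurableSpace X] {μ : Measure X}
    {w h : X → ℝ≥0∞} (hw : AEMeasurable w μ) (hh : AEMeasurable h μ) (h1 : ∫⁻ x, w x ∂μ = 1) :
    (∫⁻ x, w x * h x ∂μ) ^ 2 ≤ ∫⁻ x, w x * h x ^ 2 ∂μ := by
  have := lintegral_weighted_rpow_le hw hh (p := 2) (by norm_num)
  simpa [h1] using this

theorem ofReal_abs_rpow {p : ℝ} (hp : 0 ≤ p) (a : ℝ) :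
    ENNReal.ofReal (|a| ^ p) = ‖a‖ₑ ^ p := by
  rw [← ENNReal.ofReal_rpow_of_nonneg (abs_nonneg a) hp, Real.enorm_eq_ofReal_abs]

variable {N : ℕ}

theorem lintegral_convolution_sq_le {w h : EuclideanSpace ℝ (Fin N) → ℝ≥0∞} (hw : Measurable w)
    (hh : AEMeasurable h) (h1 : ∫⁻ x, w x = 1) :
    ∫⁻ x, (∫⁻ y, w y * h (x - y)) ^ 2 ≤ ∫⁻ x, h x ^ 2 := by
  have e : ∀ x, ∫⁻ y, w y * h (x - y) = ∫⁻ y, w y * hh.mk h (x - y) := by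
    intro x
    refine lintegral_congr_ae ?_
    filter_upwards [(quasiMeasurePreserving_sub_left volume x).ae hh.ae_eq_mk] with y hy
    rw [hy]
  have hm := hh.measurable_mk
  calc ∫⁻ x, (∫⁻ y, w y * h (x - y)) ^ 2
      ≤ ∫⁻ x, ∫⁻ y, w y * hh.mk h (x - y) ^ 2 := by
        refine lintegral_mono fun x => ?_
        simp only [e]
        exact lintegral_weighted_sq_le hw.aemeasurable (by fun_prop) h1
    _ = ∫⁻ y, ∫⁻ x, w y * hh.mk h (x - y) ^ 2 := by
        rw [lintegral_lintegral_swap]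
        exact Measurable.aemeasurable (by fun_prop)
    _ = ∫⁻ y, w y * ∫⁻ x, hh.mk h x ^ 2 := by
        refine lintegral_congr fun y => ?_
        rw [lintegral_const_mul _ (by fun_prop),
          lintegral_sub_right_eq_self (fun x => hh.mk h x ^ 2) y]
    _ = ∫⁻ x, hh.mk h x ^ 2 := by
        rw [lintegral_mul_const _ hw, h1, one_mul]
    _ = ∫⁻ x, h x ^ 2 := by
        refine lintegral_congr_ae ?_
        filter_upwards [hh.ae_eq_mk] with x hx
        rw [hx]

/-- A radial bump function supported in the unit ball. -/
def bumpBase (x : EuclideanSpace ℝ (Fin N)) : ℝ := Real.smoothTransition (1 - ‖x‖ ^ 2)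

/-- The radial mollifier at scale `ε`. -/
def mollifier (ε : ℝ) (x : EuclideanSpace ℝ (Fin N)) : ℝ :=
  (∫ y : EuclideanSpace ℝ (Fin N), bumpBase (ε⁻¹ • y))⁻¹ * bumpBase (ε⁻¹ • x)

theorem contDiff_bumpBase : ContDiff ℝ ∞ (bumpBase (N := N)) :=
  Real.smoothTransition.contDiff.comp (contDiff_const.sub (contDiff_norm_sq ℝ))

theorem bumpBase_nonneg (x : EuclideanSpace ℝ (Fin N)) : 0 ≤ bumpBase x :=
  Real.smoothTransition.nonneg _

theorem support_bumpBase : Function.support (bumpBase (N := N)) = Metric.ball 0 1 := by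
  ext x
  rw [Function.mem_support, mem_ball_zero_iff]
  constructor
  · intro h
    by_contra hx
    exact h (Real.smoothTransition.zero_of_nonpos (by nlinarith [norm_nonneg x]))
  · intro h
    exact (Real.smoothTransition.pos_of_pos (by nlinarith [norm_nonneg x])).ne'

theorem hasCompactSupport_bumpBase : HasCompactSupport (bumpBase (N := N)) :=
  HasCompactSupport.intro' (isCompact_closedBall 0 1) Metric.isClosed_closedBall fun x hx => by
    by_contra h
    exact hx (Metric.ball_subset_closedBall (support_bumpBase ▸ h))

theorem integral_bumpBase_pos : 0 < ∫ y : EuclideanSpace ℝ (Fin N), bumpBase y := by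
  rw [integral_pos_iff_support_of_nonneg bumpBase_nonneg
    (contDiff_bumpBase.continuous.integrable_of_hasCompactSupport hasCompactSupport_bumpBase),
    support_bumpBase]
  exact Metric.measure_ball_pos _ _ one_pos

theorem integral_bumpBase_smul {ε : ℝ} (hε : 0 < ε) :
    ∫ y : EuclideanSpace ℝ (Fin N), bumpBase (ε⁻¹ • y) =
      ε ^ N * ∫ y : EuclideanSpace ℝ (Fin N), bumpBase y := by
  rw [Measure.integral_comp_smul, smul_eq_mul, finrank_euclideanSpace_fin, inv_pow, inv_inv,
    abs_of_pos (by positivity)]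

theorem integral_bumpBase_smul_pos {ε : ℝ} (hε : 0 < ε) :
    0 < ∫ y : EuclideanSpace ℝ (Fin N), bumpBase (ε⁻¹ • y) := by
  rw [integral_bumpBase_smul hε]
  exact mul_pos (by positivity) integral_bumpBase_pos

theorem contDiff_mollifier (ε : ℝ) : ContDiff ℝ ∞ (mollifier (N := N) ε) :=
  contDiff_const.mul (contDiff_bumpBase.comp (contDiff_const_smul _))

theorem mollifier_nonneg {ε : ℝ} (hε : 0 < ε) (x : EuclideanSpace ℝ (Fin N)) :
    0 ≤ mollifier ε x :=
  mul_nonneg (inv_nonneg.2 (integral_bumpBase_smul_pos hε).le) (bumpBase_nonneg _)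

theorem mollifier_congr_norm (ε : ℝ) {x y : EuclideanSpace ℝ (Fin N)} (h : ‖x‖ = ‖y‖) :
    mollifier ε x = mollifier ε y := by
  simp [mollifier, bumpBase, norm_smul, h]

theorem support_mollifier_subset {ε : ℝ} (hε : 0 < ε) :
    Function.support (mollifier (N := N) ε) ⊆ Metric.ball 0 ε := by
  intro x hx
  have h : ε⁻¹ • x ∈ Function.support (bumpBase (N := N)) := fun h => hx (by simp [mollifier, h])
  rw [support_bumpBase, mem_ball_zero_iff, norm_smul, norm_inv, Real.norm_of_nonneg hε.le,
    inv_mul_lt_iff₀ hε, mul_one] at h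
  simpa using h

theorem hasCompactSupport_mollifier {ε : ℝ} (hε : 0 < ε) :
    HasCompactSupport (mollifier (N := N) ε) :=
  HasCompactSupport.intro' (isCompact_closedBall 0 ε) Metric.isClosed_closedBall fun x hx => by
    by_contra h
    exact hx (Metric.ball_subset_closedBall (support_mollifier_subset hε h))

theorem integral_mollifier {ε : ℝ} (hε : 0 < ε) :
    ∫ x : EuclideanSpace ℝ (Fin N), mollifier ε x = 1 := by
  unfold mollifier
  rw [integral_const_mul, inv_mul_cancel₀ (integral_bumpBase_smul_pos hε).ne']

theorem lintegral_mollifier {ε : ℝ} (hε : 0 < ε) :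
    ∫⁻ x : EuclideanSpace ℝ (Fin N), ENNReal.ofReal (mollifier ε x) = 1 := by
  rw [← ofReal_integral_eq_lintegral_ofReal, integral_mollifier hε, ENNReal.ofReal_one]
  · exact (contDiff_mollifier ε).continuous.integrable_of_hasCompactSupport
      (hasCompactSupport_mollifier hε)
  · exact Filter.Eventually.of_forall (mollifier_nonneg hε)

theorem measurable_mollifier (ε : ℝ) :
    Measurable fun x : EuclideanSpace ℝ (Fin N) => ENNReal.ofReal (mollifier ε x) :=
  (contDiff_mollifier ε).continuous.measurable.ennreal_ofReal

/-- The height of the mollifier is comparable to the inverse volume of its ball, uniformly in ε.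
This makes the mollifications converge at Lebesgue points. -/
theorem exists_mollifier_le (N : ℕ) : ∃ K : ℝ, ∀ ε > 0, ∀ x z : EuclideanSpace ℝ (Fin N),
    mollifier ε x ≤ K / volume.real (Metric.closedBall z ε) := by
  set I : ℝ := ∫ y : EuclideanSpace ℝ (Fin N), bumpBase y
  set v : ℝ := volume.real (Metric.ball (0 : EuclideanSpace ℝ (Fin N)) 1)
  have hI : 0 < I := integral_bumpBase_pos
  have hv : 0 < v :=
    ENNReal.toReal_pos (Metric.measure_ball_pos _ _ one_pos).ne' measure_ball_lt_top.ne
  refine ⟨v / I, fun ε hε x z => ?_⟩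
  have h1 : volume.real (Metric.closedBall z ε) = ε ^ N * v := by
    rw [Measure.real, Measure.addHaar_closedBall _ _ hε.le, finrank_euclideanSpace_fin,
      ENNReal.toReal_mul, ENNReal.toReal_ofReal (by positivity)]
    rfl
  rw [h1, mollifier, integral_bumpBase_smul hε]
  have : bumpBase (ε⁻¹ • x) ≤ 1 := Real.smoothTransition.le_one _
  calc (ε ^ N * I)⁻¹ * bumpBase (ε⁻¹ • x) ≤ (ε ^ N * I)⁻¹ * 1 := by gcongr
    _ = _ := by field_simp

/-- The mollification of `u` at scale `ε`. -/
def mollify (u : EuclideanSpace ℝ (Fin N) → ℝ) (ε : ℝ) : EuclideanSpace ℝ (Fin N) → ℝ :=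
  convolution (mollifier ε) u (ContinuousLinearMap.lsmul ℝ ℝ) volume

theorem contDiff_mollify {u : EuclideanSpace ℝ (Fin N) → ℝ} (hu : LocallyIntegrable u)
    {ε : ℝ} (hε : 0 < ε) : ContDiff ℝ ∞ (mollify u ε) :=
  (hasCompactSupport_mollifier hε).contDiff_convolution_left _ (contDiff_mollifier ε) hu

theorem ae_tendsto_mollify {u : EuclideanSpace ℝ (Fin N) → ℝ} (hu : LocallyIntegrable u)
    {ε : ℕ → ℝ} (hε : ∀ n, 0 < ε n) (hlim : Filter.Tendsto ε Filter.atTop (nhds 0)) :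
    ∀ᵐ x, Filter.Tendsto (fun n => mollify u (ε n) x) Filter.atTop (nhds (u x)) := by
  obtain ⟨K, hK⟩ := exists_mollifier_le N
  filter_upwards [(Besicovitch.vitaliFamily volume).ae_tendsto_average_norm_sub hu] with x₀ h₀
  simp only [mollify, convolution_eq_swap, ContinuousLinearMap.lsmul_apply]
  have hφ' : Filter.Tendsto ε Filter.atTop (nhdsWithin 0 (Set.Ioi 0)) :=
    tendsto_nhdsWithin_iff.2 ⟨hlim, Filter.Eventually.of_forall hε⟩
  have := (h₀.comp (Besicovitch.tendsto_filterAt volume x₀)).comp hφ'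
  apply tendsto_integral_smul_of_tendsto_average_norm_sub K this
  · filter_upwards with i using hu.integrableOn_isCompact (isCompact_closedBall _ _)
  · apply tendsto_const_nhds.congr (fun i ↦ ?_)
    rw [integral_sub_left_eq_self (mollifier (ε i)) volume x₀, integral_mollifier (hε i)]
  · filter_upwards with i
    intro x hx
    have := support_mollifier_subset (hε i) (show x₀ - x ∈ _ from hx)
    rw [mem_ball_zero_iff] at this
    simpa [dist_eq_norm_sub'] using this.le
  · filter_upwards with i x
    rw [abs_of_nonneg (mollifier_nonneg (hε i) _)]
    exact hK _ (hε i) _ _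

theorem enorm_mollify_le (u : EuclideanSpace ℝ (Fin N) → ℝ) {ε : ℝ} (hε : 0 < ε)
    (x : EuclideanSpace ℝ (Fin N)) :
    ‖mollify u ε x‖ₑ ≤ ∫⁻ y, ENNReal.ofReal (mollifier ε y) * ‖u (x - y)‖ₑ := by
  unfold mollify
  rw [convolution_def]
  refine (enorm_integral_le_lintegral_enorm _).trans (le_of_eq ?_)
  refine lintegral_congr fun y => ?_
  rw [ContinuousLinearMap.lsmul_apply, smul_eq_mul, enorm_mul,
    Real.enorm_of_nonneg (mollifier_nonneg hε y)]

/-- The gradient of the mollification is the mollification of the weak gradient; only the resulting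
pointwise inequality is recorded. -/
theorem enorm_fderiv_mollify_le {u : EuclideanSpace ℝ (Fin N) → ℝ}
    {g : EuclideanSpace ℝ (Fin N) → EuclideanSpace ℝ (Fin N)} (hg : HasWeakGradient u g)
    {ε : ℝ} (hε : 0 < ε) (x : EuclideanSpace ℝ (Fin N)) :
    ‖fderiv ℝ (mollify u ε) x‖ₑ ≤ ∫⁻ y, ENNReal.ofReal (mollifier ε y) * ‖g (x - y)‖ₑ := by
  have hd := (hasCompactSupport_mollifier (N := N) hε).hasFDerivAt_convolution_left
    (ContinuousLinearMap.lsmul ℝ ℝ) ((contDiff_mollifier ε).of_le (by simp)) hg.locallyIntegrable x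
  have hφd : Continuous (fderiv ℝ (mollifier (N := N) ε)) :=
    (contDiff_mollifier ε).continuous_fderiv (by simp)
  -- The translated and reflected mollifier is the test function in the definition of the weak
  -- gradient; its derivative changes sign.
  set ψ : EuclideanSpace ℝ (Fin N) → ℝ := fun y => mollifier ε (x - y) with hψ
  have hψs : ContDiff ℝ ∞ ψ := (contDiff_mollifier ε).comp (contDiff_const.sub contDiff_id)
  have hψc : HasCompactSupport ψ :=
    (hasCompactSupport_mollifier hε).comp_homeomorph (Homeomorph.subLeft x)
  have hψd : ∀ y, fderiv ℝ ψ y = -fderiv ℝ (mollifier ε) (x - y) := by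
    intro y
    have h1 : HasFDerivAt (fun y : EuclideanSpace ℝ (Fin N) => x - y)
        (-ContinuousLinearMap.id ℝ _) y := by
      simpa using (hasFDerivAt_id y).const_sub x
    have h2 := ((contDiff_mollifier (N := N) ε).differentiable (by simp) (x - y)).hasFDerivAt.comp y h1
    rw [show fderiv ℝ ψ y = _ from h2.fderiv]
    ext v
    simp
  have hint : Integrable fun y => ψ y * ‖g y‖ := by
    have h1 := (hg.locallyIntegrable_grad.integrable_smul_left_of_hasCompactSupport
      hψs.continuous hψc).norm
    refine h1.congr (Filter.Eventually.of_forall fun y => ?_)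
    simp only [norm_smul]
    rw [Real.norm_of_nonneg (mollifier_nonneg hε _)]
  have hconv : ConvolutionExistsAt (fderiv ℝ (mollifier ε)) u x
      (ContinuousLinearMap.precompL (EuclideanSpace ℝ (Fin N)) (ContinuousLinearMap.lsmul ℝ ℝ))
      volume :=
    ((hasCompactSupport_mollifier hε).fderiv ℝ).convolutionExists_left _ hφd
      hg.locallyIntegrable x
  have key : ∀ v, fderiv ℝ (mollify u ε) x v = ∫ y, ψ y * inner ℝ (g y) v := by
    intro v
    have h1 := hg.integral_eq ψ hψs hψc v
    have h2 := ContinuousLinearMap.integral_comp_comm (ContinuousLinearMap.apply ℝ ℝ v) hconv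
    rw [show fderiv ℝ (mollify u ε) x = _ from hd.fderiv, convolution_def]
    refine (h2.symm.trans ?_)
    have h3 : ∀ y, (ContinuousLinearMap.apply ℝ ℝ v) ((ContinuousLinearMap.precompL
        (EuclideanSpace ℝ (Fin N)) (ContinuousLinearMap.lsmul ℝ ℝ))
        (fderiv ℝ (mollifier ε) y) (u (x - y))) = -(u (x - y) * fderiv ℝ ψ (x - y) v) := by
      intro y
      rw [hψd, sub_sub_cancel]
      simp [mul_comm]
    simp only [h3]
    rw [integral_neg, integral_sub_left_eq_self (fun y => u y * fderiv ℝ ψ y v) volume x, h1,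
      neg_neg]
  have hnorm : ‖fderiv ℝ (mollify u ε) x‖ ≤ ∫ y, ψ y * ‖g y‖ := by
    have hψ0 : ∀ y, 0 ≤ ψ y := fun y => mollifier_nonneg hε _
    refine ContinuousLinearMap.opNorm_le_bound _
      (integral_nonneg fun y => mul_nonneg (hψ0 y) (norm_nonneg _)) fun v => ?_
    rw [key v, ← integral_mul_const]
    refine norm_integral_le_of_norm_le (hint.mul_const _) (Filter.Eventually.of_forall fun y => ?_)
    rw [norm_mul, Real.norm_of_nonneg (hψ0 y), mul_assoc]
    exact mul_le_mul_of_nonneg_left (norm_inner_le_norm _ _) (hψ0 y)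
  calc ‖fderiv ℝ (mollify u ε) x‖ₑ ≤ ENNReal.ofReal (∫ y, ψ y * ‖g y‖) := by
        rw [← ofReal_norm]; exact ENNReal.ofReal_le_ofReal hnorm
    _ ≤ ∫⁻ y, ‖ψ y * ‖g y‖‖ₑ := by
        rw [← Real.enorm_of_nonneg (integral_nonneg fun y =>
          mul_nonneg (mollifier_nonneg hε _) (norm_nonneg _))]
        exact enorm_integral_le_lintegral_enorm _
    _ = ∫⁻ y, ENNReal.ofReal (mollifier ε (x - y)) * ‖g (x - (x - y))‖ₑ := by
        refine lintegral_congr fun y => ?_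
        rw [enorm_mul, enorm_norm, Real.enorm_of_nonneg (mollifier_nonneg hε _), sub_sub_cancel]
    _ = _ := lintegral_sub_left_eq_self
        (fun y => ENNReal.ofReal (mollifier ε y) * ‖g (x - y)‖ₑ) x

theorem lintegral_fderiv_mollify_le {u : EuclideanSpace ℝ (Fin N) → ℝ}
    {g : EuclideanSpace ℝ (Fin N) → EuclideanSpace ℝ (Fin N)} (hg : HasWeakGradient u g)
    {ε : ℝ} (hε : 0 < ε) :
    ∫⁻ x, ‖fderiv ℝ (mollify u ε) x‖ₑ ^ 2 ≤ ∫⁻ x, ‖g x‖ₑ ^ 2 := by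
  refine le_trans ?_ (lintegral_convolution_sq_le (measurable_mollifier ε)
    hg.locallyIntegrable_grad.aestronglyMeasurable.enorm (lintegral_mollifier hε))
  exact lintegral_mono fun x => by gcongr; exact enorm_fderiv_mollify_le hg hε x

/-! ### The Coulomb energy under mollification. -/

theorem measurable_rieszKernel (s : ℝ) :
    Measurable (rieszKernel (N := N) s) := by
  unfold rieszKernel
  fun_prop

theorem rieszPotential_eq {α p : ℝ} (hp : 0 ≤ p) (u : EuclideanSpace ℝ (Fin N) → ℝ)
    (x : EuclideanSpace ℝ (Fin N)) : rieszPotential α p u x =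
      ∫⁻ y, ENNReal.ofReal (rieszKernel (α / 2) y) * ‖u (x - y)‖ₑ ^ p := by
  unfold rieszPotential
  rw [← lintegral_sub_left_eq_self _ x]
  simp only [ofReal_abs_rpow hp, sub_sub_cancel]

theorem rieszPotential_congr {α p : ℝ} {u v : EuclideanSpace ℝ (Fin N) → ℝ} (h : u =ᵐ[volume] v)
    (x : EuclideanSpace ℝ (Fin N)) : rieszPotential α p u x = rieszPotential α p v x := by
  refine lintegral_congr_ae ?_
  filter_upwards [h] with y hy
  rw [hy]

theorem measurable_rieszPotential {α p : ℝ} {u : EuclideanSpace ℝ (Fin N) → ℝ}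
    (hu : AEStronglyMeasurable u) : Measurable (rieszPotential α p u) := by
  have h : rieszPotential α p u = rieszPotential α p (hu.mk u) :=
    funext fun x => rieszPotential_congr hu.ae_eq_mk x
  have hm := hu.stronglyMeasurable_mk.measurable
  rw [h]
  unfold rieszPotential
  have hK := measurable_rieszKernel (N := N) (α / 2)
  exact Measurable.lintegral_prod_right' (f := fun q : EuclideanSpace ℝ (Fin N) ×
    EuclideanSpace ℝ (Fin N) => ENNReal.ofReal (rieszKernel (α / 2) (q.1 - q.2)) *
      ENNReal.ofReal (|hu.mk u q.2| ^ p)) (by fun_prop)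

/-- Jensen gives |φ_ε * u|^p ≤ φ_ε * |u|^p, and by Tonelli the Riesz potential commutes with
convolution. The hypothesis p ≥ 1 is used here. -/
theorem rieszPotential_mollify_le {α p : ℝ} (hp : 1 ≤ p) {u : EuclideanSpace ℝ (Fin N) → ℝ}
    (hu : AEStronglyMeasurable u) {ε : ℝ} (hε : 0 < ε) (x : EuclideanSpace ℝ (Fin N)) :
    rieszPotential α p (mollify u ε) x ≤
      ∫⁻ z, ENNReal.ofReal (mollifier ε z) * rieszPotential α p u (x - z) := by
  have hp0 : 0 ≤ p := by linarith
  have hm := hu.stronglyMeasurable_mk.measurable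
  have hK := measurable_rieszKernel (N := N) (α / 2)
  have hφ := measurable_mollifier (N := N) ε
  have hφ' : Measurable (mollifier (N := N) ε) := (contDiff_mollifier ε).continuous.measurable
  have e1 : mollify u ε = mollify (hu.mk u) ε := by
    exact convolution_congr (μ := volume) (ContinuousLinearMap.lsmul ℝ ℝ)
      (Filter.EventuallyEq.refl _ (mollifier ε)) hu.ae_eq_mk
  have e2 : ∀ x, rieszPotential α p u x = rieszPotential α p (hu.mk u) x :=
    fun x => rieszPotential_congr hu.ae_eq_mk x
  simp only [e1, e2]
  set v := hu.mk u
  calc rieszPotential α p (mollify v ε) x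
      ≤ ∫⁻ y, ENNReal.ofReal (rieszKernel (α / 2) y) *
          ∫⁻ z, ENNReal.ofReal (mollifier ε z) * ‖v (x - y - z)‖ₑ ^ p := by
        rw [rieszPotential_eq hp0]
        gcongr with y
        calc ‖mollify v ε (x - y)‖ₑ ^ p
            ≤ (∫⁻ z, ENNReal.ofReal (mollifier ε z) * ‖v (x - y - z)‖ₑ) ^ p := by
              gcongr; exact enorm_mollify_le v hε _
          _ ≤ _ := by
              have := lintegral_weighted_rpow_le (μ := volume) hφ.aemeasurable
                (h := fun z => ‖v (x - y - z)‖ₑ) (by fun_prop) hp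
              rwa [lintegral_mollifier hε, ENNReal.one_rpow, one_mul] at this
    _ = ∫⁻ y, ∫⁻ z, ENNReal.ofReal (rieszKernel (α / 2) y) *
          (ENNReal.ofReal (mollifier ε z) * ‖v (x - y - z)‖ₑ ^ p) := by
        refine lintegral_congr fun y => ?_
        rw [lintegral_const_mul _ (by fun_prop)]
    _ = ∫⁻ z, ∫⁻ y, ENNReal.ofReal (mollifier ε z) *
          (ENNReal.ofReal (rieszKernel (α / 2) y) * ‖v (x - z - y)‖ₑ ^ p) := by
        rw [lintegral_lintegral_swap (Measurable.aemeasurable (by fun_prop))]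
        refine lintegral_congr fun z => lintegral_congr fun y => ?_
        rw [sub_right_comm]; ring
    _ = _ := by
        refine lintegral_congr fun z => ?_
        rw [lintegral_const_mul _ (by fun_prop), rieszPotential_eq hp0]

theorem coulombEnergy_mollify_le {α p : ℝ} (hp : 1 ≤ p) {u : EuclideanSpace ℝ (Fin N) → ℝ}
    (hu : AEStronglyMeasurable u) {ε : ℝ} (hε : 0 < ε) :
    coulombEnergy α p (mollify u ε) ≤ coulombEnergy α p u := by
  refine le_trans ?_ (lintegral_convolution_sq_le (measurable_mollifier ε)
    (measurable_rieszPotential (α := α) (p := p) hu).aemeasurable (lintegral_mollifier hε))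
  exact lintegral_mono fun x => by gcongr; exact rieszPotential_mollify_le hp hu hε x

/-- `u` is invariant under isometries fixing the origin. -/
def RadiallySymmetric (u : EuclideanSpace ℝ (Fin N) → ℝ) : Prop :=
  ∀ x y, ‖x‖ = ‖y‖ → u x = u y

theorem IsRadial.radiallySymmetric_mollify {u : EuclideanSpace ℝ (Fin N) → ℝ} (hu : IsRadial u)
    (ε : ℝ) : RadiallySymmetric (mollify u ε) := by
  obtain ⟨f, hf⟩ := hu
  intro x y hxy
  -- The reflection in the hyperplane orthogonal to x - y sends x to y when ‖x‖ = ‖y‖. It preserves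
  -- volume and norms, so it can be used as a change of variables.
  set A := (ℝ ∙ (x - y))ᗮ.reflection
  have hA : A x = y := Submodule.reflection_sub hxy
  have e : ∀ x, mollify u ε x = ∫ t, mollifier ε (x - t) * f ‖t‖ := by
    intro x
    simp only [mollify, convolution_eq_swap, ContinuousLinearMap.lsmul_apply, smul_eq_mul]
    refine integral_congr_ae ?_
    filter_upwards [hf] with t ht
    rw [ht]
  rw [e, e, ← A.measurePreserving.integral_comp A.toHomeomorph.measurableEmbedding
    (fun t => mollifier ε (y - t) * f ‖t‖)]
  refine integral_congr_ae (Filter.Eventually.of_forall fun t => ?_)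
  simp only
  rw [← hA, ← map_sub, A.norm_map, mollifier_congr_norm ε (A.norm_map (x - t))]


/-! ### Dilations and normalized bounds. -/

theorem rieszKernel_smul (s : ℝ) {r : ℝ} (hr : 0 < r) (x : EuclideanSpace ℝ (Fin N)) :
    rieszKernel s (r • x) = r ^ (s - N) * rieszKernel s x := by
  unfold rieszKernel
  rw [norm_smul, Real.norm_of_nonneg hr.le, Real.mul_rpow hr.le (norm_nonneg _),
    ← neg_sub (N : ℝ) s, Real.rpow_neg hr.le]
  field_simp

theorem lintegral_comp_smul_euclidean (f : EuclideanSpace ℝ (Fin N) → ℝ≥0∞) {r : ℝ} (hr : 0 < r) :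
    ∫⁻ x, f (r • x) = ENNReal.ofReal (r ^ (-(N : ℝ))) * ∫⁻ x, f x := by
  rw [lintegral_comp_smul_haar volume f hr, finrank_euclideanSpace_fin, Real.rpow_neg hr.le,
    Real.rpow_natCast]

theorem lintegral_fderiv_dilate {u : EuclideanSpace ℝ (Fin N) → ℝ} (hu : ContDiff ℝ ∞ u)
    {a b : ℝ} (ha : 0 < a) (hb : 0 < b) :
    ∫⁻ x, ‖fderiv ℝ (fun x => a * u (b • x)) x‖ₑ ^ 2 =
      ENNReal.ofReal (a ^ (2 : ℝ) * b ^ (2 - (N : ℝ))) * ∫⁻ x, ‖fderiv ℝ u x‖ₑ ^ 2 := by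
  have h : ∀ x, fderiv ℝ (fun x => a * u (b • x)) x = (a * b) • fderiv ℝ u (b • x) := by
    intro x
    have hd : DifferentiableAt ℝ (fun x => u (b • x)) x :=
      (hu.differentiable (by simp)).comp (differentiable_id.const_smul b) x
    rw [fderiv_const_mul hd, fderiv_comp_smul, smul_smul]
  simp only [h, enorm_smul, mul_pow]
  rw [lintegral_const_mul' _ _ (by finiteness),
    lintegral_comp_smul_euclidean (fun x => ‖fderiv ℝ u x‖ₑ ^ 2) hb, ← mul_assoc]
  congr 1
  rw [Real.enorm_of_nonneg (by positivity), ← ENNReal.ofReal_pow (by positivity),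
    ← ENNReal.ofReal_mul (by positivity), mul_pow, mul_assoc, sub_eq_add_neg, Real.rpow_add hb,
    Real.rpow_two, Real.rpow_two]

theorem rieszPotential_dilate {α p : ℝ} (u : EuclideanSpace ℝ (Fin N) → ℝ)
    {a b : ℝ} (ha : 0 < a) (hb : 0 < b) (x : EuclideanSpace ℝ (Fin N)) :
    rieszPotential α p (fun x => a * u (b • x)) x =
      ENNReal.ofReal (a ^ p * b ^ (-(α / 2))) * rieszPotential α p u (b • x) := by
  have h : ∀ y, ENNReal.ofReal (rieszKernel (α / 2) (x - y)) * ENNReal.ofReal (|a * u (b • y)| ^ p)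
      = ENNReal.ofReal (a ^ p * b ^ ((N : ℝ) - α / 2)) *
        (ENNReal.ofReal (rieszKernel (α / 2) (b • x - b • y)) * ENNReal.ofReal (|u (b • y)| ^ p)) := by
    intro y
    rw [← smul_sub, rieszKernel_smul _ hb, abs_mul, Real.mul_rpow (abs_nonneg _) (abs_nonneg _),
      abs_of_pos ha, ENNReal.ofReal_mul (by positivity), ENNReal.ofReal_mul (by positivity),
      ENNReal.ofReal_mul (p := b ^ (α / 2 - N)) (by positivity)]
    have : ENNReal.ofReal (b ^ ((N : ℝ) - α / 2)) * ENNReal.ofReal (b ^ (α / 2 - N)) = 1 := by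
      rw [← ENNReal.ofReal_mul (by positivity), ← Real.rpow_add hb]
      simp
    calc _ = ENNReal.ofReal (rieszKernel (α / 2) (x - y)) * (ENNReal.ofReal (a ^ p) *
          ENNReal.ofReal (|u (b • y)| ^ p)) * 1 := by rw [mul_one]
      _ = _ := by rw [← this]; ring
  unfold rieszPotential
  simp only [h]
  rw [lintegral_const_mul' _ _ ENNReal.ofReal_ne_top,
    lintegral_comp_smul_euclidean (fun y => ENNReal.ofReal (rieszKernel (α / 2) (b • x - y)) *
      ENNReal.ofReal (|u y| ^ p)) hb, ← mul_assoc, ← ENNReal.ofReal_mul (by positivity), mul_assoc,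
    ← Real.rpow_add hb]
  congr 4
  ring

theorem coulombEnergy_dilate {α p : ℝ} (u : EuclideanSpace ℝ (Fin N) → ℝ)
    {a b : ℝ} (ha : 0 < a) (hb : 0 < b) :
    coulombEnergy α p (fun x => a * u (b • x)) =
      ENNReal.ofReal (a ^ (2 * p) * b ^ (-(N + α))) * coulombEnergy α p u := by
  unfold coulombEnergy
  simp only [rieszPotential_dilate u ha hb, mul_pow]
  rw [lintegral_const_mul' _ _ (by finiteness),
    lintegral_comp_smul_euclidean (fun x => rieszPotential α p u x ^ 2) hb, ← mul_assoc,
    ← ENNReal.ofReal_pow (by positivity), ← ENNReal.ofReal_mul (by positivity)]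
  congr 2
  rw [mul_pow, mul_assoc, ← Real.rpow_two, ← Real.rpow_two, ← Real.rpow_mul ha.le,
    ← Real.rpow_mul hb.le, ← Real.rpow_add hb]
  congr 2 <;> ring

theorem lintegral_rpow_dilate {q : ℝ} (hq : 0 ≤ q) (u : EuclideanSpace ℝ (Fin N) → ℝ)
    {a b : ℝ} (ha : 0 < a) (hb : 0 < b) :
    ∫⁻ x, ‖a * u (b • x)‖ₑ ^ q =
      ENNReal.ofReal (a ^ q * b ^ (-(N : ℝ))) * ∫⁻ x, ‖u x‖ₑ ^ q := by
  simp only [enorm_mul, ENNReal.mul_rpow_of_nonneg _ _ hq]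
  rw [lintegral_const_mul' _ _ (by finiteness),
    lintegral_comp_smul_euclidean (fun x => ‖u x‖ₑ ^ q) hb, ← mul_assoc,
    Real.enorm_of_nonneg ha.le, ENNReal.ofReal_rpow_of_nonneg ha.le hq,
    ← ENNReal.ofReal_mul (by positivity)]

/-- Among smooth functions with the property `P`, the `L^q` norm is bounded on the set where both
energies are at most `1`. -/
def NormalizedBound (α p q : ℝ) (P : (EuclideanSpace ℝ (Fin N) → ℝ) → Prop) : Prop :=
  ∃ C : ℝ≥0, ∀ u, ContDiff ℝ ∞ u → P u → ∫⁻ x, ‖fderiv ℝ u x‖ₑ ^ 2 ≤ 1 →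
    coulombEnergy α p u ≤ 1 → ∫⁻ x, ‖u x‖ₑ ^ q ≤ C

/-- `P` is invariant under multiplication by constants and dilations. -/
def DilationInvariant (P : (EuclideanSpace ℝ (Fin N) → ℝ) → Prop) : Prop :=
  ∀ u, P u → ∀ a b : ℝ, P fun x => a * u (b • x)

theorem dilationInvariant_radiallySymmetric :
    DilationInvariant (RadiallySymmetric (N := N)) := by
  intro u hu a b x y hxy
  simp only
  rw [hu (b • x) (b • y) (by rw [norm_smul, norm_smul, hxy])]

theorem ofReal_mul_le_one {c d : ℝ} (hcd : c * d = 1) (hc : 0 ≤ c) {x : ℝ≥0∞}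
    (hx : x ≤ ENNReal.ofReal d) : ENNReal.ofReal c * x ≤ 1 := by
  calc ENNReal.ofReal c * x ≤ ENNReal.ofReal c * ENNReal.ofReal d := by gcongr
    _ = 1 := by rw [← ENNReal.ofReal_mul hc, hcd, ENNReal.ofReal_one]

/-- If the energies of `u` are bounded by `l^2 m^(N-2)` and `l^(2p) m^(N+α)`, then
`v = l⁻¹ u(m ·)` has energies at most `1`. -/
theorem dilate_energies_le_one {α p : ℝ} {u : EuclideanSpace ℝ (Fin N) → ℝ}
    (hu : ContDiff ℝ ∞ u) {l m : ℝ} (hl : 0 < l) (hm : 0 < m)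
    (hD : ∫⁻ x, ‖fderiv ℝ u x‖ₑ ^ 2 ≤ ENNReal.ofReal (l ^ (2 : ℝ) * m ^ ((N : ℝ) - 2)))
    (hV : coulombEnergy α p u ≤ ENNReal.ofReal (l ^ (2 * p) * m ^ (N + α))) :
    ∫⁻ x, ‖fderiv ℝ (fun x => l⁻¹ * u (m • x)) x‖ₑ ^ 2 ≤ 1 ∧
      coulombEnergy α p (fun x => l⁻¹ * u (m • x)) ≤ 1 := by
  constructor
  · rw [lintegral_fderiv_dilate hu (by positivity) hm]
    refine ofReal_mul_le_one ?_ (by positivity) hD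
    rw [Real.inv_rpow hl.le, ← neg_sub (N : ℝ) 2, Real.rpow_neg hm.le]
    field_simp
  · rw [coulombEnergy_dilate u (by positivity) hm]
    refine ofReal_mul_le_one ?_ (by positivity) hV
    rw [Real.inv_rpow hl.le, Real.rpow_neg hm.le]
    field_simp

theorem lintegral_le_of_dilate_le {q : ℝ} (hq : 0 ≤ q) {u : EuclideanSpace ℝ (Fin N) → ℝ}
    {l m : ℝ} (hl : 0 < l) (hm : 0 < m) {C : ℝ≥0∞}
    (h : ∫⁻ x, ‖l⁻¹ * u (m • x)‖ₑ ^ q ≤ C) :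
    ∫⁻ x, ‖u x‖ₑ ^ q ≤ C * ENNReal.ofReal (l ^ q * m ^ (N : ℝ)) := by
  rw [lintegral_rpow_dilate hq u (by positivity) hm] at h
  calc ∫⁻ x, ‖u x‖ₑ ^ q = (ENNReal.ofReal (l⁻¹ ^ q * m ^ (-(N : ℝ))) * ∫⁻ x, ‖u x‖ₑ ^ q) *
        ENNReal.ofReal (l ^ q * m ^ (N : ℝ)) := by
        rw [mul_right_comm, ← ENNReal.ofReal_mul (by positivity), Real.inv_rpow hl.le,
          Real.rpow_neg hm.le]
        have : (l ^ q)⁻¹ * (m ^ (N : ℝ))⁻¹ * (l ^ q * m ^ (N : ℝ)) = 1 := by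
          have := Real.rpow_pos_of_pos hl q
          have := Real.rpow_pos_of_pos hm (N : ℝ)
          field_simp
        rw [this, ENNReal.ofReal_one, one_mul]
    _ ≤ _ := by gcongr

theorem dirichletEnergy_eq_of_hasWeakGradient {u : EuclideanSpace ℝ (Fin N) → ℝ}
    {g : EuclideanSpace ℝ (Fin N) → EuclideanSpace ℝ (Fin N)} (hg : HasWeakGradient u g) :
    dirichletEnergy u = ∫⁻ x, ‖g x‖ₑ ^ 2 := by
  refine lintegral_congr_ae ?_
  filter_upwards [(hasWeakGradient_weakGradient ⟨g, hg⟩).ae_eq hg] with x hx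
  rw [hx]

/-- A bound for normalized smooth functions extends, with the right homogeneity, to weakly
differentiable functions. -/
theorem NormalizedBound.exists_lintegral_le {α p q : ℝ} (hp : 1 ≤ p) (hq : 0 ≤ q)
    {P : (EuclideanSpace ℝ (Fin N) → ℝ) → Prop} (h : NormalizedBound α p q P)
    (hP : DilationInvariant P) :
    ∃ C : ℝ≥0, ∀ u, AEStronglyMeasurable u volume → WeaklyDifferentiable u →
      (∀ ε > 0, P (mollify u ε)) → ∀ l m : ℝ, 0 < l → 0 < m →
      dirichletEnergy u ≤ ENNReal.ofReal (l ^ (2 : ℝ) * m ^ ((N : ℝ) - 2)) →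
      coulombEnergy α p u ≤ ENNReal.ofReal (l ^ (2 * p) * m ^ (N + α)) →
      ∫⁻ x, ‖u x‖ₑ ^ q ≤ C * ENNReal.ofReal (l ^ q * m ^ (N : ℝ)) := by
  obtain ⟨C, hC⟩ := h
  refine ⟨C, fun u hu hw hPu l m hl hm hD hV => ?_⟩
  set g := weakGradient u
  have hg : HasWeakGradient u g := hasWeakGradient_weakGradient hw
  have hε : ∀ n : ℕ, 0 < (1 : ℝ) / (n + 1) := fun n => Nat.one_div_pos_of_nat
  have hbound : ∀ n : ℕ, ∫⁻ x, ‖mollify u (1 / ((n : ℝ) + 1)) x‖ₑ ^ q ≤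
      C * ENNReal.ofReal (l ^ q * m ^ (N : ℝ)) := by
    intro n
    have hsm := contDiff_mollify hg.locallyIntegrable (hε n)
    obtain ⟨h1, h2⟩ := dilate_energies_le_one hsm hl hm
      ((lintegral_fderiv_mollify_le hg (hε n)).trans hD)
      ((coulombEnergy_mollify_le hp hu (hε n)).trans hV)
    refine lintegral_le_of_dilate_le hq hl hm (hC _ ?_ (hP _ (hPu _ (hε n)) _ _) h1 h2)
    exact contDiff_const.mul (hsm.comp (contDiff_const_smul m))
  -- The uniform bound on the mollifications passes to u by almost everywhere convergence and
  -- Fatou's lemma.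
  have hlim := ae_tendsto_mollify hg.locallyIntegrable hε tendsto_one_div_add_atTop_nhds_zero_nat
  calc ∫⁻ x, ‖u x‖ₑ ^ q
      = ∫⁻ x, Filter.liminf (fun n : ℕ => ‖mollify u (1 / ((n : ℝ) + 1)) x‖ₑ ^ q)
          Filter.atTop := by
        refine lintegral_congr_ae ?_
        filter_upwards [hlim] with x hx
        exact (((ENNReal.continuous_rpow_const (y := q)).tendsto _).comp
          ((continuous_enorm.tendsto _).comp hx)).liminf_eq.symm
    _ ≤ Filter.liminf (fun n : ℕ => ∫⁻ x, ‖mollify u (1 / ((n : ℝ) + 1)) x‖ₑ ^ q)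
          Filter.atTop := by
        refine lintegral_liminf_le fun n => ?_
        have := (contDiff_mollify hg.locallyIntegrable (hε n)).continuous.measurable
        fun_prop
    _ ≤ _ := Filter.liminf_le_of_frequently_le' (Filter.Frequently.of_forall hbound)


/-! ### Bounds without symmetry, by maximal functions. -/

theorem enorm_le_add_lintegral_fderiv {u : EuclideanSpace ℝ (Fin N) → ℝ} (hu : ContDiff ℝ ∞ u)
    (x z : EuclideanSpace ℝ (Fin N)) (hz : ‖z‖ ≤ 1) {r : ℝ} (hr : 0 < r) :
    ‖u x‖ₑ ≤ ‖u (x + r • z)‖ₑ + ∫⁻ s in Set.Ioo 0 r, ‖fderiv ℝ u (x + s • z)‖ₑ := by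
  have hc : Continuous (fderiv ℝ u) := hu.continuous_fderiv (by simp)
  have hderiv : ∀ s : ℝ, HasDerivAt (fun s : ℝ => u (x + s • z)) (fderiv ℝ u (x + s • z) z) s := by
    intro s
    have h1 : HasDerivAt (fun s : ℝ => x + s • z) z s := by
      simpa using ((hasDerivAt_id s).smul_const z).const_add x
    exact ((hu.differentiable (by simp)) (x + s • z)).hasFDerivAt.comp_hasDerivAt s h1
  have hint : IntervalIntegrable (fun s : ℝ => fderiv ℝ u (x + s • z) z) volume 0 r := by
    apply Continuous.intervalIntegrable
    fun_prop
  have hft := intervalIntegral.integral_eq_sub_of_hasDerivAt (fun s _ => hderiv s) hint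
  have e : u x = u (x + r • z) - ∫ s in (0 : ℝ)..r, fderiv ℝ u (x + s • z) z := by
    rw [hft]; simp
  calc ‖u x‖ₑ ≤ ‖u (x + r • z)‖ₑ + ‖∫ s in (0 : ℝ)..r, fderiv ℝ u (x + s • z) z‖ₑ := by
        rw [e]; exact enorm_sub_le
    _ ≤ _ := by
        gcongr
        rw [intervalIntegral.integral_of_le hr.le, setLIntegral_congr Ioo_ae_eq_Ioc]
        refine (enorm_integral_le_lintegral_enorm _).trans (lintegral_mono fun s => ?_)
        have := (fderiv ℝ u (x + s • z)).le_opNorm z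
        rw [← ofReal_norm, ← ofReal_norm]
        refine ENNReal.ofReal_le_ofReal (this.trans ?_)
        exact mul_le_of_le_one_right (norm_nonneg _) hz

/-- The fundamental theorem of calculus along the segments from x to x + r z, averaged over z in the
unit ball. By Tonelli the gradient enters through its means over the balls of radius s < r, so no
integrability of a Riesz kernel against |Du| is needed. -/
theorem measure_ball_mul_enorm_le {u : EuclideanSpace ℝ (Fin N) → ℝ} (hu : ContDiff ℝ ∞ u)
    (x : EuclideanSpace ℝ (Fin N)) {r : ℝ} (hr : 0 < r) :
    volume (Metric.ball (0 : EuclideanSpace ℝ (Fin N)) 1) * ‖u x‖ₑ ≤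
      ballMean volume (fun y => ‖u y‖ₑ) x r +
        ∫⁻ s in Set.Ioo 0 r, ballMean volume (fun y => ‖fderiv ℝ u y‖ₑ) x s := by
  have hc : Continuous (fderiv ℝ u) := hu.continuous_fderiv (by simp)
  have hc0 := hu.continuous.measurable
  have hc1 := hc.measurable
  calc _ = ∫⁻ z in Metric.ball (0 : EuclideanSpace ℝ (Fin N)) 1, ‖u x‖ₑ := by
        rw [setLIntegral_const, mul_comm]
    _ ≤ ∫⁻ z in Metric.ball (0 : EuclideanSpace ℝ (Fin N)) 1,
          (‖u (x + r • z)‖ₑ + ∫⁻ s in Set.Ioo 0 r, ‖fderiv ℝ u (x + s • z)‖ₑ) := by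
        refine setLIntegral_mono' Metric.isOpen_ball.measurableSet fun z hz => ?_
        exact enorm_le_add_lintegral_fderiv hu x z (mem_ball_zero_iff.1 hz).le hr
    _ = _ := by
        rw [lintegral_add_left (by fun_prop)]
        congr 1
        rw [lintegral_lintegral_swap]
        · rfl
        · apply Measurable.aemeasurable
          fun_prop

theorem ballMean_rpow_le {g : EuclideanSpace ℝ (Fin N) → ℝ≥0∞} (hg : Measurable g) {p : ℝ}
    (hp : 1 ≤ p) (x : EuclideanSpace ℝ (Fin N)) (r : ℝ) :
    ballMean volume g x r ^ p ≤
      volume (Metric.ball (0 : EuclideanSpace ℝ (Fin N)) 1) ^ (p - 1) *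
        ballMean volume (fun y => g y ^ p) x r := by
  have := lintegral_weighted_rpow_le
    (μ := volume.restrict (Metric.ball (0 : EuclideanSpace ℝ (Fin N)) 1))
    (w := fun _ => 1) (h := fun z => g (x + r • z)) (by fun_prop) (by fun_prop) hp
  simpa [ballMean] using this

theorem exists_rieszKernel_ge {s : ℝ} (hs : 0 < s) (hsN : s < N) :
    ∃ A : ℝ, 0 < A ∧ ∀ (x : EuclideanSpace ℝ (Fin N)) (r : ℝ), 0 < ‖x‖ → ‖x‖ ≤ r →
      A * r ^ (s - N) ≤ rieszKernel s x := by
  refine ⟨Real.Gamma (((N : ℝ) - s) / 2) /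
      (Real.Gamma (s / 2) * Real.pi ^ ((N : ℝ) / 2) * (2 : ℝ) ^ s), ?_, fun x r hx hr => ?_⟩
  · have h1 := Real.Gamma_pos_of_pos (show 0 < ((N : ℝ) - s) / 2 by linarith)
    have h2 := Real.Gamma_pos_of_pos (show 0 < s / 2 by linarith)
    have := Real.pi_pos
    positivity
  · have h1 := Real.Gamma_pos_of_pos (show 0 < ((N : ℝ) - s) / 2 by linarith)
    have h2 := Real.Gamma_pos_of_pos (show 0 < s / 2 by linarith)
    have := Real.pi_pos
    unfold rieszKernel
    rw [div_eq_mul_inv _ (‖x‖ ^ _), ← neg_sub (N : ℝ) s, Real.rpow_neg (hx.le.trans hr)]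
    have h3 := Real.rpow_le_rpow hx.le hr (show 0 ≤ (N : ℝ) - s by linarith)
    have h4 := Real.rpow_pos_of_pos hx ((N : ℝ) - s)
    gcongr

/-- On the ball of radius r around x the kernel is at least A r^(α/2-N). The constant does not
depend on p. -/
theorem exists_lintegral_ball_le_rieszPotential {α : ℝ} (hα0 : 0 < α) (hαN : α < N) :
    ∃ C : ℝ≥0, ∀ p : ℝ, 0 ≤ p → ∀ (u : EuclideanSpace ℝ (Fin N) → ℝ)
      (x : EuclideanSpace ℝ (Fin N)) (r : ℝ), 0 < r →
      ∫⁻ y in Metric.ball x r, ‖u y‖ₑ ^ p ≤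
        C * ENNReal.ofReal (r ^ (N - α / 2)) * rieszPotential α p u x := by
  have hN0 : (0 : ℝ) < N := hα0.trans hαN
  have : Nonempty (Fin N) := ⟨⟨0, by exact_mod_cast hN0⟩⟩
  obtain ⟨A, hA, hK⟩ := exists_rieszKernel_ge (N := N) (s := α / 2) (by linarith) (by linarith)
  refine ⟨(A⁻¹).toNNReal, fun p hp u x r hr => ?_⟩
  have h1 : ENNReal.ofReal (A * r ^ (α / 2 - N)) * ∫⁻ y in Metric.ball x r, ‖u y‖ₑ ^ p ≤
      rieszPotential α p u x := by
    rw [← lintegral_const_mul' _ _ ENNReal.ofReal_ne_top]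
    unfold rieszPotential
    refine le_trans (lintegral_mono_ae ?_) (setLIntegral_le_lintegral (Metric.ball x r) _)
    -- At the origin the kernel takes the default value 0 (a division by zero), so the lower bound
    -- fails at y = x, a null set.
    have hx : ∀ᵐ y ∂(volume.restrict (Metric.ball x r)), y ≠ x :=
      ae_restrict_of_ae (by simp [ae_iff])
    filter_upwards [hx, ae_restrict_mem Metric.isOpen_ball.measurableSet] with y hyx hy
    rw [ofReal_abs_rpow hp]
    gcongr
    refine hK _ _ (norm_pos_iff.2 (sub_ne_zero.2 hyx.symm)) ?_
    rw [← dist_eq_norm, dist_comm]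
    exact (Metric.mem_ball.1 hy).le
  calc ∫⁻ y in Metric.ball x r, ‖u y‖ₑ ^ p
      = ENNReal.ofReal (A⁻¹ * r ^ (N - α / 2)) *
        (ENNReal.ofReal (A * r ^ (α / 2 - N)) * ∫⁻ y in Metric.ball x r, ‖u y‖ₑ ^ p) := by
        rw [← mul_assoc, ← ENNReal.ofReal_mul (by positivity)]
        have : A⁻¹ * r ^ (N - α / 2) * (A * r ^ (α / 2 - N)) = 1 := by
          rw [mul_mul_mul_comm, inv_mul_cancel₀ hA.ne', one_mul, ← Real.rpow_add hr]
          simp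
        rw [this, ENNReal.ofReal_one, one_mul]
    _ ≤ _ := by
        rw [ENNReal.ofReal_mul (by positivity)]
        gcongr
        exact le_rfl

theorem ballMean_rpow_eq {g : EuclideanSpace ℝ (Fin N) → ℝ≥0∞}
    (x : EuclideanSpace ℝ (Fin N)) {r : ℝ} (hr : 0 < r) :
    ballMean volume g x r = ENNReal.ofReal (r ^ (-(N : ℝ))) * ∫⁻ y in Metric.ball x r, g y := by
  rw [ballMean_eq volume g x hr, finrank_euclideanSpace_fin, Real.rpow_neg hr.le, Real.rpow_natCast]

theorem exists_ballMean_le_rieszPotential {α p : ℝ} (hα0 : 0 < α) (hαN : α < N) (hp : 1 ≤ p) :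
    ∃ C : ℝ≥0, ∀ (u : EuclideanSpace ℝ (Fin N) → ℝ), Continuous u →
      ∀ (x : EuclideanSpace ℝ (Fin N)) (r : ℝ), 0 < r →
      ballMean volume (fun y => ‖u y‖ₑ) x r ≤
        C * ENNReal.ofReal (r ^ (-(α / (2 * p)))) * rieszPotential α p u x ^ (1 / p) := by
  have hp0 : 0 < p := by linarith
  obtain ⟨C, hC⟩ := exists_lintegral_ball_le_rieszPotential hα0 hαN
  set v := volume (Metric.ball (0 : EuclideanSpace ℝ (Fin N)) 1) with hv
  have hvtop : v ≠ ⊤ := measure_ball_lt_top.ne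
  set K : ℝ≥0∞ := (v ^ (p - 1) * C) ^ (1 / p) with hK
  have hKtop : K ≠ ⊤ := by
    refine ENNReal.rpow_ne_top_of_nonneg (by positivity) (ENNReal.mul_ne_top ?_ ENNReal.coe_ne_top)
    exact ENNReal.rpow_ne_top_of_nonneg (by linarith) hvtop
  refine ⟨K.toNNReal, fun u hu x r hr => ?_⟩
  rw [ENNReal.coe_toNNReal hKtop]
  have h1 := ballMean_rpow_le (g := fun y => ‖u y‖ₑ) (by fun_prop) hp x r
  rw [ballMean_rpow_eq (g := fun y => ‖u y‖ₑ ^ p) x hr] at h1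
  have h2 : ballMean volume (fun y => ‖u y‖ₑ) x r ^ p ≤
      v ^ (p - 1) * C * ENNReal.ofReal (r ^ (-(α / 2))) * rieszPotential α p u x := by
    refine h1.trans ?_
    calc v ^ (p - 1) * (ENNReal.ofReal (r ^ (-(N : ℝ))) * ∫⁻ y in Metric.ball x r, ‖u y‖ₑ ^ p)
        ≤ v ^ (p - 1) * (ENNReal.ofReal (r ^ (-(N : ℝ))) *
          (C * ENNReal.ofReal (r ^ (N - α / 2)) * rieszPotential α p u x)) := by
          gcongr; exact hC p hp0.le u x r hr
      _ = v ^ (p - 1) * C * (ENNReal.ofReal (r ^ (-(N : ℝ))) * ENNReal.ofReal (r ^ (N - α / 2))) *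
          rieszPotential α p u x := by ring
      _ = _ := by
          rw [← ENNReal.ofReal_mul (by positivity), ← Real.rpow_add hr]
          congr 4; ring
  have h3 := ENNReal.rpow_le_rpow h2 (show 0 ≤ 1 / p by positivity)
  rw [← ENNReal.rpow_mul, mul_one_div_cancel hp0.ne', ENNReal.rpow_one,
    ENNReal.mul_rpow_of_nonneg _ _ (by positivity), ENNReal.mul_rpow_of_nonneg _ _ (by positivity),
    ENNReal.ofReal_rpow_of_nonneg (by positivity) (by positivity), ← Real.rpow_mul hr.le] at h3
  refine h3.trans (le_of_eq ?_)
  congr 4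
  field_simp

theorem ballMean_le_of_lintegral_sq_le_one {g : EuclideanSpace ℝ (Fin N) → ℝ≥0∞} (hg : Measurable g)
    (hD : ∫⁻ x, g x ^ 2 ≤ 1) (x : EuclideanSpace ℝ (Fin N)) {s : ℝ} (hs : 0 < s) :
    ballMean volume g x s ≤
      volume (Metric.ball (0 : EuclideanSpace ℝ (Fin N)) 1) ^ (1 / 2 : ℝ) *
        ENNReal.ofReal (s ^ (-((N : ℝ) / 2))) := by
  have h1 := ballMean_rpow_le hg (p := 2) (by norm_num) x s
  rw [ballMean_rpow_eq (g := fun y => g y ^ (2 : ℝ)) x hs] at h1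
  have h2 : ballMean volume g x s ^ (2 : ℝ) ≤
      volume (Metric.ball (0 : EuclideanSpace ℝ (Fin N)) 1) * ENNReal.ofReal (s ^ (-(N : ℝ))) := by
    refine h1.trans ?_
    rw [show (2 : ℝ) - 1 = 1 by norm_num, ENNReal.rpow_one]
    gcongr
    refine mul_le_of_le_one_right' ?_
    refine (setLIntegral_le_lintegral _ _).trans ?_
    simpa using hD
  have h3 := ENNReal.rpow_le_rpow h2 (show (0 : ℝ) ≤ 1 / 2 by positivity)
  rw [← ENNReal.rpow_mul, show (2 : ℝ) * (1 / 2) = 1 by norm_num, ENNReal.rpow_one,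
    ENNReal.mul_rpow_of_nonneg _ _ (by positivity),
    ENNReal.ofReal_rpow_of_nonneg (by positivity) (by positivity), ← Real.rpow_mul hs.le] at h3
  refine h3.trans (le_of_eq ?_)
  congr 3
  ring


theorem rpow_le_of_mul_le {v a K T : ℝ≥0∞} (hv : v ≠ 0) (hv' : v ≠ ⊤) {q : ℝ} (hq : 0 < q)
    (h : v * a ≤ K * T ^ (1 / q)) : a ^ q ≤ (v⁻¹ * K) ^ q * T := by
  have h1 : a ≤ v⁻¹ * K * T ^ (1 / q) := by
    calc a = v⁻¹ * (v * a) := by rw [← mul_assoc, ENNReal.inv_mul_cancel hv hv', one_mul]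
      _ ≤ v⁻¹ * (K * T ^ (1 / q)) := by gcongr
      _ = _ := by ring
  calc a ^ q ≤ (v⁻¹ * K * T ^ (1 / q)) ^ q := by gcongr
    _ = _ := by
      rw [ENNReal.mul_rpow_of_nonneg _ _ hq.le, ← ENNReal.rpow_mul, one_div_mul_cancel hq.ne',
        ENNReal.rpow_one]

/-- The endpoint exponent for the Coulomb–Sobolev embedding without symmetry. -/
def endpointExponent (α p : ℝ) : ℝ := 2 * (2 * p + α) / (2 + α)

theorem endpointExponent_pos {α p : ℝ} (hα : 0 < α) (hp : 1 ≤ p) : 0 < endpointExponent α p := by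
  unfold endpointExponent
  have : 0 < p := by linarith
  positivity

theorem two_le_endpointExponent {α p : ℝ} (hα : 0 < α) (hp : 1 ≤ p) :
    2 ≤ endpointExponent α p := by
  unfold endpointExponent
  rw [le_div_iff₀ (by linarith)]
  linarith

theorem le_rpow_half_of_sq_le {a T : ℝ≥0∞} (h : a ^ 2 ≤ T) : a ≤ T ^ (1 / 2 : ℝ) := by
  calc a = (a ^ 2) ^ (1 / 2 : ℝ) := by
        rw [← ENNReal.rpow_natCast, ← ENNReal.rpow_mul]; norm_num
    _ ≤ _ := by gcongr

theorem lintegral_Ioo_const_le (r : ℝ) (c : ℝ≥0∞) :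
    ∫⁻ _ in Set.Ioo 0 r, c = ENNReal.ofReal r * c := by
  rw [setLIntegral_const, Real.volume_Ioo, sub_zero, mul_comm]

/-- A Hedberg-type argument: |u(x)| is bounded by r^(-α/(2p)) G^(1/p) + r M for every r > 0, and the
best r depends on T = M² + G² at the point x only. -/
theorem exists_enorm_rpow_endpoint_le {α p : ℝ} (hα0 : 0 < α) (hαN : α < N) (hp : 1 ≤ p) :
    ∃ C : ℝ≥0, ∀ u : EuclideanSpace ℝ (Fin N) → ℝ, ContDiff ℝ ∞ u → ∀ x,
      ‖u x‖ₑ ^ endpointExponent α p ≤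
        C * (maximalFun volume (fun y => ‖fderiv ℝ u y‖ₑ) x ^ 2 + rieszPotential α p u x ^ 2) := by
  have hp0 : 0 < p := by linarith
  have hq0 := endpointExponent_pos hα0 hp
  obtain ⟨C, hC⟩ := exists_ballMean_le_rieszPotential hα0 hαN hp
  set v := volume (Metric.ball (0 : EuclideanSpace ℝ (Fin N)) 1) with hv
  have hv0 : v ≠ 0 := (Metric.measure_ball_pos _ _ one_pos).ne'
  have hvtop : v ≠ ⊤ := measure_ball_lt_top.ne
  set K : ℝ≥0∞ := C + ENNReal.ofReal (2 ^ N) with hK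
  have hKtop : (v⁻¹ * K) ^ endpointExponent α p ≠ ⊤ := by finiteness
  set L := ((v⁻¹ * K) ^ endpointExponent α p).toNNReal
  have hL : (L : ℝ≥0∞) = (v⁻¹ * K) ^ endpointExponent α p := ENNReal.coe_toNNReal hKtop
  refine ⟨L + 1, fun u hu x => ?_⟩
  set M := maximalFun volume (fun y => ‖fderiv ℝ u y‖ₑ) x
  set G := rieszPotential α p u x
  have hbase : ∀ r : ℝ, 0 < r → v * ‖u x‖ₑ ≤
      C * ENNReal.ofReal (r ^ (-(α / (2 * p)))) * G ^ (1 / p) +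
        ENNReal.ofReal (2 ^ N) * (ENNReal.ofReal r * M) := by
    intro r hr
    refine (measure_ball_mul_enorm_le hu x hr).trans (add_le_add (hC u hu.continuous x r hr) ?_)
    calc _ ≤ ∫⁻ s in Set.Ioo 0 r, ENNReal.ofReal (2 ^ N) * M := by
          refine setLIntegral_mono' measurableSet_Ioo fun s hs => ?_
          have := ballMean_le_maximalFun volume (fun y => ‖fderiv ℝ u y‖ₑ) x hs.1
          rwa [finrank_euclideanSpace_fin] at this
      _ = _ := by rw [lintegral_Ioo_const_le]; ring
  by_cases hTtop : M ^ 2 + G ^ 2 = ⊤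
  · rw [hTtop, ENNReal.mul_top (by simp)]; exact le_top
  refine le_trans (rpow_le_of_mul_le (T := M ^ 2 + G ^ 2) (K := K) hv0 hvtop hq0 ?_) ?_
  · set T := M ^ 2 + G ^ 2
    have hMT : M ≤ T ^ (1 / 2 : ℝ) := le_rpow_half_of_sq_le le_self_add
    have hGT : G ≤ T ^ (1 / 2 : ℝ) := le_rpow_half_of_sq_le le_add_self
    by_cases hT0 : T = 0
    · have hM0 : M = 0 := by rw [hT0, ENNReal.zero_rpow_of_pos (by norm_num)] at hMT; simpa using hMT
      have hG0 : G = 0 := by rw [hT0, ENNReal.zero_rpow_of_pos (by norm_num)] at hGT; simpa using hGT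
      have := hbase 1 one_pos
      rw [hM0, hG0, ENNReal.zero_rpow_of_pos (by positivity)] at this
      simp only [mul_zero, add_zero] at this
      exact this.trans zero_le
    set τ := T.toReal with hτ
    have hτ0 : 0 < τ := ENNReal.toReal_pos hT0 hTtop
    have hTτ : T = ENNReal.ofReal τ := (ENNReal.ofReal_toReal hTtop).symm
    -- With G and M both replaced by T^(1/2), the choice r = T^κ makes the two terms equal, each
    -- becoming T^(1/q₀).
    set κ := (1 - p) / (2 * p + α) with hκ
    have h := hbase (τ ^ κ) (by positivity)
    have hden : 2 * p + α ≠ 0 := by positivity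
    have h2α : 2 + α ≠ 0 := by positivity
    have e1 : κ * (-(α / (2 * p))) + 1 / 2 * (1 / p) = 1 / endpointExponent α p := by
      unfold endpointExponent
      rw [hκ]
      field_simp
      ring
    have e2 : κ + 1 / 2 = 1 / endpointExponent α p := by
      unfold endpointExponent
      rw [hκ]
      field_simp
      ring
    refine h.trans ?_
    calc _ ≤ C * ENNReal.ofReal ((τ ^ κ) ^ (-(α / (2 * p)))) * (T ^ (1 / 2 : ℝ)) ^ (1 / p) +
          ENNReal.ofReal (2 ^ N) * (ENNReal.ofReal (τ ^ κ) * T ^ (1 / 2 : ℝ)) := by gcongr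
      _ = C * (ENNReal.ofReal (τ ^ (κ * (-(α / (2 * p))))) *
            ENNReal.ofReal (τ ^ (1 / 2 * (1 / p)))) +
          ENNReal.ofReal (2 ^ N) * (ENNReal.ofReal (τ ^ κ) * ENNReal.ofReal (τ ^ (1 / 2 : ℝ))) := by
          rw [hTτ, ← ENNReal.rpow_mul, ENNReal.ofReal_rpow_of_pos hτ0,
            ENNReal.ofReal_rpow_of_pos hτ0, Real.rpow_mul hτ0.le κ, mul_assoc]
      _ = _ := by
          rw [← ENNReal.ofReal_mul (by positivity), ← ENNReal.ofReal_mul (by positivity),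
            ← Real.rpow_add hτ0, ← Real.rpow_add hτ0, e1, e2, hTτ, ENNReal.ofReal_rpow_of_pos hτ0]
          ring
  · rw [← hL]
    gcongr
    exact_mod_cast le_self_add

theorem nontrivial_euclideanSpace (hN : 0 < N) : Nontrivial (EuclideanSpace ℝ (Fin N)) := by
  have : Nonempty (Fin N) := ⟨⟨0, hN⟩⟩
  infer_instance

theorem pos_of_lt_natCast {α : ℝ} (hα0 : 0 < α) (hαN : α < N) : 0 < N := by
  exact_mod_cast hα0.trans hαN

theorem exists_lintegral_maximalFun_fderiv_sq_le (hN : 0 < N) :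
    ∃ C : ℝ≥0, ∀ u : EuclideanSpace ℝ (Fin N) → ℝ, ContDiff ℝ ∞ u →
      ∫⁻ x, ‖fderiv ℝ u x‖ₑ ^ 2 ≤ 1 →
      ∫⁻ x, maximalFun volume (fun y => ‖fderiv ℝ u y‖ₑ) x ^ 2 ≤ C := by
  have := nontrivial_euclideanSpace hN
  obtain ⟨C, hC⟩ := exists_lintegral_maximalFun_sq_le
    (volume : Measure (EuclideanSpace ℝ (Fin N)))
  refine ⟨C, fun u hu hD => ?_⟩
  have hc : Continuous (fderiv ℝ u) := hu.continuous_fderiv (by simp)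
  exact (hC _ (by fun_prop)).trans (mul_le_of_le_one_right' hD)

theorem measurable_maximalFun_fderiv {u : EuclideanSpace ℝ (Fin N) → ℝ} (hu : ContDiff ℝ ∞ u) :
    Measurable (maximalFun volume (fun y => ‖fderiv ℝ u y‖ₑ)) := by
  have hc : Continuous (fderiv ℝ u) := hu.continuous_fderiv (by simp)
  exact measurable_maximalFun _ (by fun_prop)

theorem normalizedBound_endpoint {α p : ℝ} (hα0 : 0 < α) (hαN : α < N) (hp : 1 ≤ p)
    (P : (EuclideanSpace ℝ (Fin N) → ℝ) → Prop) :
    NormalizedBound α p (endpointExponent α p) P := by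
  obtain ⟨C, hC⟩ := exists_enorm_rpow_endpoint_le hα0 hαN hp
  obtain ⟨C', hC'⟩ := exists_lintegral_maximalFun_fderiv_sq_le (pos_of_lt_natCast hα0 hαN)
  refine ⟨C * (C' + 1), fun u hu _ hD hV => ?_⟩
  calc ∫⁻ x, ‖u x‖ₑ ^ endpointExponent α p
      ≤ ∫⁻ x, C * (maximalFun volume (fun y => ‖fderiv ℝ u y‖ₑ) x ^ 2 +
          rieszPotential α p u x ^ 2) := lintegral_mono fun x => hC u hu x
    _ = C * ((∫⁻ x, maximalFun volume (fun y => ‖fderiv ℝ u y‖ₑ) x ^ 2) + coulombEnergy α p u) := by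
        have h1 := measurable_maximalFun_fderiv hu
        rw [lintegral_const_mul' _ _ ENNReal.coe_ne_top, lintegral_add_left (h1.pow_const 2)]
        rfl
    _ ≤ C * (C' + 1) := by
        gcongr
        exact hC' u hu hD
    _ = _ := by push_cast; rfl

/-- The pointwise form of Sobolev's inequality. Finiteness of the Riesz potential at x serves only
to make the mean of |u| over large balls vanish in the limit. The gradient means at scale s are
bounded by the maximal function for s ≤ δ and by s^(-N/2), from the Dirichlet bound, for s > δ. -/
theorem exists_enorm_rpow_sobolev_le {α p : ℝ} (hα0 : 0 < α) (hαN : α < N) (hp : 1 ≤ p)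
    (hN : 2 < N) :
    ∃ C : ℝ≥0, ∀ u : EuclideanSpace ℝ (Fin N) → ℝ, ContDiff ℝ ∞ u →
      ∫⁻ x, ‖fderiv ℝ u x‖ₑ ^ 2 ≤ 1 → ∀ x, rieszPotential α p u x ≠ ⊤ →
      ‖u x‖ₑ ^ (2 * N / ((N : ℝ) - 2)) ≤
        C * maximalFun volume (fun y => ‖fderiv ℝ u y‖ₑ) x ^ 2 := by
  have hp0 : 0 < p := by linarith
  have hN2 : (2 : ℝ) < N := by exact_mod_cast hN
  have hq0 : 0 < 2 * N / ((N : ℝ) - 2) := div_pos (by linarith) (by linarith)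
  obtain ⟨C, hC⟩ := exists_ballMean_le_rieszPotential hα0 hαN hp
  set v := volume (Metric.ball (0 : EuclideanSpace ℝ (Fin N)) 1) with hv
  have hv0 : v ≠ 0 := (Metric.measure_ball_pos _ _ one_pos).ne'
  have hvtop : v ≠ ⊤ := measure_ball_lt_top.ne
  set B : ℝ≥0∞ := v ^ (1 / 2 : ℝ) * ENNReal.ofReal (1 / (N / 2 - 1)) with hB
  have hBtop : B ≠ ⊤ := by finiteness
  set K : ℝ≥0∞ := ENNReal.ofReal (2 ^ N) + B with hK
  have hKtop : (v⁻¹ * K) ^ (2 * N / ((N : ℝ) - 2)) ≠ ⊤ := by finiteness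
  set L := ((v⁻¹ * K) ^ (2 * N / ((N : ℝ) - 2))).toNNReal
  have hL : (L : ℝ≥0∞) = (v⁻¹ * K) ^ (2 * N / ((N : ℝ) - 2)) := ENNReal.coe_toNNReal hKtop
  refine ⟨L + 1, fun u hu hD x hG => ?_⟩
  have hc : Continuous (fderiv ℝ u) := hu.continuous_fderiv (by simp)
  set M := maximalFun volume (fun y => ‖fderiv ℝ u y‖ₑ) x
  set G := rieszPotential α p u x
  have hbase : ∀ δ : ℝ, 0 < δ → ∀ r : ℝ, 0 < r → v * ‖u x‖ₑ ≤
      C * ENNReal.ofReal (r ^ (-(α / (2 * p)))) * G ^ (1 / p) +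
        (ENNReal.ofReal (2 ^ N) * (ENNReal.ofReal δ * M) +
          B * ENNReal.ofReal (δ ^ (1 - (N : ℝ) / 2))) := by
    intro δ hδ r hr
    refine (measure_ball_mul_enorm_le hu x hr).trans (add_le_add (hC u hu.continuous x r hr) ?_)
    have hsub : Set.Ioo 0 r ⊆ Set.Ioc 0 δ ∪ Set.Ioi δ := by
      intro s hs
      rcases le_or_gt s δ with h | h
      · exact Or.inl ⟨hs.1, h⟩
      · exact Or.inr h
    refine (lintegral_mono_set hsub).trans ((lintegral_union_le _ _ _).trans (add_le_add ?_ ?_))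
    · calc _ ≤ ∫⁻ s in Set.Ioc 0 δ, ENNReal.ofReal (2 ^ N) * M := by
            refine setLIntegral_mono' measurableSet_Ioc fun s hs => ?_
            have := ballMean_le_maximalFun volume (fun y => ‖fderiv ℝ u y‖ₑ) x hs.1
            rwa [finrank_euclideanSpace_fin] at this
        _ = _ := by rw [setLIntegral_const, Real.volume_Ioc, sub_zero]; ring
    · calc _ ≤ ∫⁻ s in Set.Ioi δ, v ^ (1 / 2 : ℝ) * ENNReal.ofReal (s ^ (-((N : ℝ) / 2))) := by
            refine setLIntegral_mono' measurableSet_Ioi fun s hs => ?_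
            exact ballMean_le_of_lintegral_sq_le_one (by fun_prop) hD x (hδ.trans hs)
        _ = _ := by
            rw [lintegral_const_mul' _ _ (by finiteness), lintegral_Ioi_rpow (by linarith) hδ, hB,
              mul_assoc, ← ENNReal.ofReal_mul (one_div_nonneg.2 (by linarith))]
            congr 2
            rw [show -((N : ℝ) / 2) + 1 = 1 - N / 2 by ring, neg_sub]
            ring
  -- Let r tend to infinity at fixed δ: the term with G carries a negative power of r, and G is
  -- finite.
  have hbase2 : ∀ δ : ℝ, 0 < δ → v * ‖u x‖ₑ ≤ ENNReal.ofReal (2 ^ N) * (ENNReal.ofReal δ * M) +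
          B * ENNReal.ofReal (δ ^ (1 - (N : ℝ) / 2)) := by
    intro δ hδ
    have hlim : Filter.Tendsto (fun r : ℝ => C * ENNReal.ofReal (r ^ (-(α / (2 * p)))) *
        G ^ (1 / p) + (ENNReal.ofReal (2 ^ N) * (ENNReal.ofReal δ * M) +
          B * ENNReal.ofReal (δ ^ (1 - (N : ℝ) / 2)))) Filter.atTop
        (nhds (C * ENNReal.ofReal 0 * G ^ (1 / p) + (ENNReal.ofReal (2 ^ N) *
          (ENNReal.ofReal δ * M) + B * ENNReal.ofReal (δ ^ (1 - (N : ℝ) / 2))))) := by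
      refine Filter.Tendsto.add_const _ ?_
      refine ENNReal.Tendsto.mul_const ?_ (Or.inr (by finiteness))
      refine ENNReal.Tendsto.const_mul ?_ (Or.inr (by finiteness))
      exact ENNReal.tendsto_ofReal (tendsto_rpow_neg_atTop (by positivity))
    simp only [ENNReal.ofReal_zero, mul_zero, zero_mul, zero_add] at hlim
    refine ge_of_tendsto hlim ?_
    filter_upwards [Filter.eventually_gt_atTop 0] with r hr using hbase δ hδ r hr
  by_cases hTtop : M ^ 2 = ⊤
  · rw [hTtop, ENNReal.mul_top (by simp)]; exact le_top
  refine le_trans (rpow_le_of_mul_le (T := M ^ 2) (K := K) hv0 hvtop hq0 ?_) ?_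
  · set T := M ^ 2
    have hMT : M ≤ T ^ (1 / 2 : ℝ) := le_rpow_half_of_sq_le le_rfl
    by_cases hT0 : T = 0
    · have hM0 : M = 0 := by rw [hT0, ENNReal.zero_rpow_of_pos (by norm_num)] at hMT; simpa using hMT
      rw [hM0] at hbase2
      simp only [mul_zero, zero_add] at hbase2
      have hlim : Filter.Tendsto (fun δ : ℝ => B * ENNReal.ofReal (δ ^ (-((N : ℝ) / 2 - 1))))
          Filter.atTop (nhds (B * ENNReal.ofReal 0)) := by
        refine ENNReal.Tendsto.const_mul ?_ (Or.inr hBtop)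
        exact ENNReal.tendsto_ofReal (tendsto_rpow_neg_atTop (by linarith))
      simp only [ENNReal.ofReal_zero, mul_zero, neg_sub] at hlim
      refine (ge_of_tendsto hlim ?_).trans zero_le
      filter_upwards [Filter.eventually_gt_atTop 0] with δ hδ using hbase2 δ hδ
    set τ := T.toReal with hτ
    have hτ0 : 0 < τ := ENNReal.toReal_pos hT0 hTtop
    have hTτ : T = ENNReal.ofReal τ := (ENNReal.ofReal_toReal hTtop).symm
    -- This δ solves δ T^(1/2) = δ^(1-N/2), so that the two terms balance.
    have h := hbase2 (τ ^ (-(1 / (N : ℝ)))) (by positivity)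
    have hN0 : (N : ℝ) ≠ 0 := by linarith
    have e1 : -(1 / (N : ℝ)) * (1 - N / 2) = 1 / (2 * N / ((N : ℝ) - 2)) := by
      field_simp; ring
    have e2 : -(1 / (N : ℝ)) + 1 / 2 = 1 / (2 * N / ((N : ℝ) - 2)) := by
      field_simp; ring
    refine h.trans ?_
    calc _ ≤ ENNReal.ofReal (2 ^ N) * (ENNReal.ofReal (τ ^ (-(1 / (N : ℝ)))) * T ^ (1 / 2 : ℝ)) +
          B * ENNReal.ofReal ((τ ^ (-(1 / (N : ℝ)))) ^ (1 - (N : ℝ) / 2)) := by gcongr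
      _ = _ := by
          rw [hTτ, ENNReal.ofReal_rpow_of_pos hτ0, ENNReal.ofReal_rpow_of_pos hτ0,
            ← ENNReal.ofReal_mul (by positivity), ← Real.rpow_add hτ0, ← Real.rpow_mul hτ0.le, e1,
            e2]
          ring
  · rw [← hL]
    gcongr
    exact_mod_cast le_self_add

theorem normalizedBound_sobolev {α p : ℝ} (hα0 : 0 < α) (hαN : α < N) (hp : 1 ≤ p)
    (hN : 2 < N) (P : (EuclideanSpace ℝ (Fin N) → ℝ) → Prop) :
    NormalizedBound α p (2 * N / ((N : ℝ) - 2)) P := by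
  obtain ⟨C, hC⟩ := exists_enorm_rpow_sobolev_le hα0 hαN hp hN
  obtain ⟨C', hC'⟩ := exists_lintegral_maximalFun_fderiv_sq_le (pos_of_lt_natCast hα0 hαN)
  refine ⟨C * C', fun u hu _ hD hV => ?_⟩
  have hfin : ∀ᵐ x, rieszPotential α p u x ^ 2 < ⊤ :=
    ae_lt_top ((measurable_rieszPotential hu.continuous.aestronglyMeasurable).pow_const 2)
      (hV.trans_lt ENNReal.one_lt_top).ne
  calc _ ≤ ∫⁻ x, C * maximalFun volume (fun y => ‖fderiv ℝ u y‖ₑ) x ^ 2 := by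
        refine lintegral_mono_ae ?_
        filter_upwards [hfin] with x hx
        refine hC u hu hD x fun h => ?_
        simp [h] at hx
    _ = C * (∫⁻ x, maximalFun volume (fun y => ‖fderiv ℝ u y‖ₑ) x ^ 2) :=
        lintegral_const_mul' _ _ ENNReal.coe_ne_top
    _ ≤ C * C' := by
        gcongr
        exact hC' u hu hD
    _ = _ := by push_cast; rfl

theorem le_rpow_mul_rpow {a x y : ℝ≥0∞} {t : ℝ} (h0 : 0 ≤ t) (h1 : t ≤ 1) (hx : a ≤ x)
    (hy : a ≤ y) : a ≤ x ^ (1 - t) * y ^ t := by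
  calc a = a ^ (1 - t) * a ^ t := by
        rw [← ENNReal.rpow_add_of_nonneg _ _ (by linarith) h0]; simp
    _ ≤ _ := by
        have : 0 ≤ 1 - t := by linarith
        gcongr

/-- At the fixed radius r = 1 the mean of |u| is controlled by the bound for q₀. The gradient means
are estimated by a geometric mean of the maximal function and of s^(-N/2). -/
theorem normalizedBound_of_dim_le_two {α p q : ℝ} (hα0 : 0 < α) (hαN : α < N) (hp : 1 ≤ p)
    (hN : N ≤ 2) (hq : endpointExponent α p ≤ q) (P : (EuclideanSpace ℝ (Fin N) → ℝ) → Prop) :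
    NormalizedBound α p q P := by
  obtain ⟨C₀, hC₀⟩ := normalizedBound_endpoint hα0 hαN hp P
  obtain ⟨C', hC'⟩ := exists_lintegral_maximalFun_fderiv_sq_le (pos_of_lt_natCast hα0 hαN)
  set q₀ := endpointExponent α p
  have hq₀ : 2 ≤ q₀ := two_le_endpointExponent hα0 hp
  have hq2 : 2 ≤ q := hq₀.trans hq
  have hN2 : (N : ℝ) ≤ 2 := by exact_mod_cast hN
  -- The weight 2/q on the maximal function is the one whose q-th power is its square, which is
  -- integrable. The remaining factor s^(-(N/2)t) is integrable near 0 because N ≤ 2 and t < 1.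
  set t : ℝ := 1 - 2 / q with ht
  have h2q : 2 / q ≤ 1 := (div_le_one (by linarith)).2 hq2
  have h2q0 : 0 < 2 / q := by positivity
  have htN : -1 < -((N : ℝ) / 2) * t := by nlinarith
  set v := volume (Metric.ball (0 : EuclideanSpace ℝ (Fin N)) 1) with hv
  have hv0 : v ≠ 0 := (Metric.measure_ball_pos _ _ one_pos).ne'
  have hvtop : v ≠ ⊤ := measure_ball_lt_top.ne
  set B₀ : ℝ≥0∞ := (v ^ (q₀ - 1) * C₀) ^ (1 / q₀) with hB₀
  have hB₀top : B₀ ≠ ⊤ := by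
    have : 0 ≤ q₀ - 1 := by linarith
    have : 0 ≤ 1 / q₀ := by positivity
    finiteness
  set B₁ : ℝ≥0∞ := ENNReal.ofReal (2 ^ N) ^ (2 / q) * ((v ^ (1 / 2 : ℝ)) ^ t *
    ENNReal.ofReal (1 ^ (-((N : ℝ) / 2) * t + 1) / (-((N : ℝ) / 2) * t + 1))) with hB₁
  have ht0 : 0 ≤ t := by linarith
  have hB₁top : B₁ ≠ ⊤ := by finiteness
  set K₁ : ℝ≥0∞ := (v⁻¹ * (2 * B₀)) ^ (q - q₀)
  have hK₁ : K₁ ≠ ⊤ := ENNReal.rpow_ne_top_of_nonneg (by linarith) (by finiteness)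
  set K₂ : ℝ≥0∞ := (v⁻¹ * (2 * B₁)) ^ q
  have hK₂ : K₂ ≠ ⊤ := ENNReal.rpow_ne_top_of_nonneg (by linarith) (by finiteness)
  refine ⟨(K₁ * C₀ + K₂ * C').toNNReal, fun u hu hP hD hV => ?_⟩
  rw [ENNReal.coe_toNNReal (by finiteness)]
  have hc : Continuous (fderiv ℝ u) := hu.continuous_fderiv (by simp)
  have hE := hC₀ u hu hP hD hV
  have hum := hu.continuous.measurable
  have hpt : ∀ x, ‖u x‖ₑ ^ q ≤ K₁ * ‖u x‖ₑ ^ q₀ +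
      K₂ * maximalFun volume (fun y => ‖fderiv ℝ u y‖ₑ) x ^ 2 := by
    intro x
    set M := maximalFun volume (fun y => ‖fderiv ℝ u y‖ₑ) x
    have h0 : ballMean volume (fun y => ‖u y‖ₑ) x 1 ≤ B₀ := by
      have h1 := ballMean_rpow_le (g := fun y => ‖u y‖ₑ) (by fun_prop) (p := q₀) (by linarith) x 1
      rw [ballMean_rpow_eq (g := fun y => ‖u y‖ₑ ^ q₀) x one_pos, Real.one_rpow,
        ENNReal.ofReal_one, one_mul] at h1
      have h2 : ballMean volume (fun y => ‖u y‖ₑ) x 1 ^ q₀ ≤ v ^ (q₀ - 1) * C₀ :=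
        h1.trans (by gcongr; exact (setLIntegral_le_lintegral _ _).trans hE)
      have h3 := ENNReal.rpow_le_rpow h2 (show 0 ≤ 1 / q₀ by positivity)
      rwa [← ENNReal.rpow_mul, mul_one_div_cancel (by positivity), ENNReal.rpow_one] at h3
    have h1 : ∫⁻ s in Set.Ioo (0 : ℝ) 1, ballMean volume (fun y => ‖fderiv ℝ u y‖ₑ) x s ≤
        B₁ * (M ^ 2) ^ (1 / q) := by
      calc _ ≤ ∫⁻ s in Set.Ioo (0 : ℝ) 1, (ENNReal.ofReal (2 ^ N) * M) ^ (2 / q) *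
            ((v ^ (1 / 2 : ℝ)) ^ t * ENNReal.ofReal (s ^ (-((N : ℝ) / 2) * t))) := by
            refine setLIntegral_mono' measurableSet_Ioo fun s hs => ?_
            have e1 := ballMean_le_maximalFun volume (fun y => ‖fderiv ℝ u y‖ₑ) x hs.1
            rw [finrank_euclideanSpace_fin] at e1
            have e2 := ballMean_le_of_lintegral_sq_le_one
              (g := fun y => ‖fderiv ℝ u y‖ₑ) (by fun_prop) hD x hs.1
            refine (le_rpow_mul_rpow ht0 (by linarith) e1 e2).trans (le_of_eq ?_)
            rw [ENNReal.mul_rpow_of_nonneg _ _ ht0, ENNReal.ofReal_rpow_of_nonneg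
              (Real.rpow_nonneg hs.1.le _) ht0, ← Real.rpow_mul hs.1.le, ht, sub_sub_cancel]
        _ = (ENNReal.ofReal (2 ^ N) * M) ^ (2 / q) * ((v ^ (1 / 2 : ℝ)) ^ t *
            ENNReal.ofReal (1 ^ (-((N : ℝ) / 2) * t + 1) / (-((N : ℝ) / 2) * t + 1))) := by
            rw [lintegral_const_mul _ (by fun_prop), lintegral_const_mul _ (by fun_prop),
              lintegral_Ioo_rpow htN zero_le_one]
        _ = _ := by
            have eM : (M ^ 2) ^ (1 / q) = M ^ (2 / q) := by
              rw [← ENNReal.rpow_natCast, ← ENNReal.rpow_mul]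
              congr 1
              push_cast
              ring
            rw [ENNReal.mul_rpow_of_nonneg _ _ h2q0.le, eM, hB₁]
            ring
    have hmain := (measure_ball_mul_enorm_le hu x one_pos).trans (add_le_add h0 h1)
    -- If the constant term dominates, |u(x)| is bounded and |u|^q is at most a multiple of |u|^q₀;
    -- otherwise |u|^q is at most a multiple of the squared maximal function.
    rcases le_total (B₁ * (M ^ 2) ^ (1 / q)) B₀ with h | h
    · have h2 : ‖u x‖ₑ ≤ v⁻¹ * (2 * B₀) := by
        calc ‖u x‖ₑ = v⁻¹ * (v * ‖u x‖ₑ) := by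
              rw [← mul_assoc, ENNReal.inv_mul_cancel hv0 hvtop, one_mul]
          _ ≤ v⁻¹ * (2 * B₀) := by
              rw [two_mul]
              gcongr
              exact hmain.trans (by gcongr)
      refine le_add_right ?_
      calc ‖u x‖ₑ ^ q = ‖u x‖ₑ ^ (q - q₀) * ‖u x‖ₑ ^ q₀ := by
            rw [← ENNReal.rpow_add_of_nonneg _ _ (by linarith) (by linarith)]; simp
        _ ≤ _ := by
            gcongr
            exact ENNReal.rpow_le_rpow h2 (by linarith)
    · refine le_add_left (rpow_le_of_mul_le hv0 hvtop (by linarith) ?_)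
      calc _ ≤ B₁ * (M ^ 2) ^ (1 / q) + B₁ * (M ^ 2) ^ (1 / q) := hmain.trans (by gcongr)
        _ = _ := by ring
  calc ∫⁻ x, ‖u x‖ₑ ^ q ≤ ∫⁻ x, (K₁ * ‖u x‖ₑ ^ q₀ +
      K₂ * maximalFun volume (fun y => ‖fderiv ℝ u y‖ₑ) x ^ 2) := lintegral_mono hpt
    _ = K₁ * (∫⁻ x, ‖u x‖ₑ ^ q₀) +
        K₂ * ∫⁻ x, maximalFun volume (fun y => ‖fderiv ℝ u y‖ₑ) x ^ 2 := by
        rw [lintegral_add_left (by fun_prop), lintegral_const_mul' _ _ hK₁,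
          lintegral_const_mul' _ _ hK₂]
    _ ≤ _ := by
        gcongr
        exact hC' u hu hD

theorem rpow_le_rpow_add_rpow (a : ℝ≥0∞) {q q₁ q₂ : ℝ} (h₁ : q₁ ≤ q)
    (h₂ : q ≤ q₂) : a ^ q ≤ a ^ q₁ + a ^ q₂ := by
  rcases le_total a 1 with h | h
  · exact le_add_right (ENNReal.rpow_le_rpow_of_exponent_ge h h₁)
  · exact le_add_left (ENNReal.rpow_le_rpow_of_exponent_le h h₂)

theorem NormalizedBound.of_between {α p q q₁ q₂ : ℝ} {P : (EuclideanSpace ℝ (Fin N) → ℝ) → Prop}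
    (h₁ : NormalizedBound α p q₁ P) (h₂ : NormalizedBound α p q₂ P) (hq₁ : q₁ ≤ q)
    (hq₂ : q ≤ q₂) : NormalizedBound α p q P := by
  obtain ⟨C₁, hC₁⟩ := h₁
  obtain ⟨C₂, hC₂⟩ := h₂
  refine ⟨C₁ + C₂, fun u hu hP hD hV => ?_⟩
  have := hu.continuous.measurable
  calc ∫⁻ x, ‖u x‖ₑ ^ q ≤ ∫⁻ x, (‖u x‖ₑ ^ q₁ + ‖u x‖ₑ ^ q₂) :=
        lintegral_mono fun x => rpow_le_rpow_add_rpow _ hq₁ hq₂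
    _ = (∫⁻ x, ‖u x‖ₑ ^ q₁) + ∫⁻ x, ‖u x‖ₑ ^ q₂ := lintegral_add_left (by fun_prop) _
    _ ≤ _ := by
        push_cast
        exact add_le_add (hC₁ u hu hP hD hV) (hC₂ u hu hP hD hV)

/-! ### One-variable estimates for radial profiles. -/

theorem enorm_le_enorm_add_lintegral_deriv {f : ℝ → ℝ} (hf : ContDiff ℝ 1 f) {a b r s : ℝ}
    (hr : r ∈ Set.Icc a b) (hs : s ∈ Set.Icc a b) :
    ‖f r‖ₑ ≤ ‖f s‖ₑ + ∫⁻ t in Set.Ioo a b, ‖deriv f t‖ₑ := by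
  have hc : Continuous (deriv f) := hf.continuous_deriv le_rfl
  have hft := intervalIntegral.integral_eq_sub_of_hasDerivAt
    (fun t _ => (hf.differentiable (by simp) t).hasDerivAt) (hc.intervalIntegrable s r)
  have e : f r = f s + ∫ t in s..r, deriv f t := by rw [hft]; ring
  calc ‖f r‖ₑ ≤ ‖f s‖ₑ + ‖∫ t in s..r, deriv f t‖ₑ := by
        conv_lhs => rw [e]
        exact enorm_add_le _ _
    _ ≤ _ := by
        gcongr
        rw [← ofReal_norm, intervalIntegral.norm_intervalIntegral_eq, ofReal_norm]
        refine (enorm_integral_le_lintegral_enorm _).trans ?_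
        rw [setLIntegral_congr Ioo_ae_eq_Icc]
        refine lintegral_mono_set fun t ht => ?_
        rw [Set.uIoc, Set.mem_Ioc] at ht
        exact ⟨(le_min hs.1 hr.1).trans ht.1.le, ht.2.trans (max_le hs.2 hr.2)⟩

/-- For every s in the interval, |f(r)| minus the total variation is at most |f(s)|. Truncated
subtraction allows the p-th power and the integration over s without a case distinction. -/
theorem enorm_le_average_add_lintegral_deriv {f : ℝ → ℝ} (hf : ContDiff ℝ 1 f) {a b r p : ℝ}
    (hp : 0 < p) (hab : a < b) (hr : r ∈ Set.Icc a b) {m : ℝ≥0∞}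
    (hm : ∫⁻ s in Set.Ioo a b, ‖f s‖ₑ ^ p ≤ m) :
    ‖f r‖ₑ ≤ (m / ENNReal.ofReal (b - a)) ^ (1 / p) + ∫⁻ t in Set.Ioo a b, ‖deriv f t‖ₑ := by
  have hba : 0 < b - a := sub_pos.2 hab
  set J := ∫⁻ t in Set.Ioo a b, ‖deriv f t‖ₑ
  have h1 : (‖f r‖ₑ - J) ^ p * ENNReal.ofReal (b - a) ≤ m := by
    calc _ = ∫⁻ s in Set.Ioo a b, (‖f r‖ₑ - J) ^ p := by rw [setLIntegral_const, Real.volume_Ioo]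
      _ ≤ ∫⁻ s in Set.Ioo a b, ‖f s‖ₑ ^ p := by
        refine setLIntegral_mono' measurableSet_Ioo fun s hs => ?_
        gcongr
        rw [tsub_le_iff_right]
        exact enorm_le_enorm_add_lintegral_deriv hf hr (Set.Ioo_subset_Icc_self hs)
      _ ≤ m := hm
  rw [← tsub_le_iff_right]
  have h2 : (‖f r‖ₑ - J) ^ p ≤ m / ENNReal.ofReal (b - a) := by
    rw [ENNReal.le_div_iff_mul_le (Or.inl (by simpa using hab)) (Or.inl ENNReal.ofReal_ne_top)]
    exact h1
  have h3 := ENNReal.rpow_le_rpow h2 (show 0 ≤ 1 / p by positivity)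
  rwa [← ENNReal.rpow_mul, mul_one_div_cancel hp.ne', ENNReal.rpow_one] at h3

theorem lintegral_le_of_weighted_sq {g : ℝ → ℝ≥0∞} (hg : Measurable g) {A : ℝ≥0∞} {k : ℝ}
    (hA : ∫⁻ r in Set.Ioi (0 : ℝ), ENNReal.ofReal (r ^ k) * g r ^ 2 ≤ A) {S : Set ℝ}
    (hS : MeasurableSet S) (hS0 : S ⊆ Set.Ioi 0) :
    ∫⁻ r in S, g r ≤ A ^ (1 / 2 : ℝ) * (∫⁻ r in S, ENNReal.ofReal (r ^ (-k))) ^ (1 / 2 : ℝ) := by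
  have hol := ENNReal.lintegral_mul_norm_pow_le (μ := volume.restrict S)
    (f := fun r => ENNReal.ofReal (r ^ k) * g r ^ 2) (g := fun r => ENNReal.ofReal (r ^ (-k)))
    (by fun_prop) (by fun_prop) (p := 1 / 2) (q := 1 / 2) (by norm_num) (by norm_num) (by norm_num)
  calc ∫⁻ r in S, g r = ∫⁻ r in S, (ENNReal.ofReal (r ^ k) * g r ^ 2) ^ (1 / 2 : ℝ) *
        ENNReal.ofReal (r ^ (-k)) ^ (1 / 2 : ℝ) := by
        refine setLIntegral_congr_fun hS fun r hr => ?_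
        have hr0 : 0 < r := hS0 hr
        rw [← ENNReal.mul_rpow_of_nonneg _ _ (by norm_num), mul_right_comm,
          ← ENNReal.ofReal_mul (by positivity), ← Real.rpow_add hr0, add_neg_cancel, Real.rpow_zero,
          ENNReal.ofReal_one, one_mul, ← ENNReal.rpow_natCast, ← ENNReal.rpow_mul]
        norm_num
    _ ≤ _ := hol
    _ ≤ _ := by
        gcongr
        exact (lintegral_mono_set hS0).trans hA

/-- Tonelli applied to r^(-κ) = κ ∫_r^∞ ρ^(-κ-1) dρ. It turns growth bounds for the partial
integrals of `g` into weighted integrability, with no pointwise information on `g`. -/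
theorem lintegral_mul_rpow_neg_eq {g : ℝ → ℝ≥0∞} (hg : Measurable g) {κ : ℝ} (hκ : 0 < κ) :
    ∫⁻ r in Set.Ioi (0 : ℝ), g r * ENNReal.ofReal (r ^ (-κ)) =
      ENNReal.ofReal κ * ∫⁻ ρ in Set.Ioi (0 : ℝ), ENNReal.ofReal (ρ ^ (-κ - 1)) *
        ∫⁻ r in Set.Ioo 0 ρ, g r := by
  have hms : MeasurableSet {q : ℝ × ℝ | q.1 < q.2} := measurableSet_lt measurable_fst measurable_snd
  calc _ = ∫⁻ r in Set.Ioi (0 : ℝ), ∫⁻ ρ in Set.Ioi (0 : ℝ), ENNReal.ofReal κ *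
        (ENNReal.ofReal (ρ ^ (-κ - 1)) * (g r * Set.indicator {q : ℝ × ℝ | q.1 < q.2} 1 (r, ρ))) := by
        refine setLIntegral_congr_fun measurableSet_Ioi fun r hr => ?_
        have hr0 : (0 : ℝ) < r := hr
        have h1 := lintegral_Ioi_rpow (a := -κ - 1) (by linarith) hr0
        have h2 : ENNReal.ofReal (r ^ (-κ)) =
            ENNReal.ofReal κ * ∫⁻ ρ in Set.Ioi r, ENNReal.ofReal (ρ ^ (-κ - 1)) := by
          rw [h1, ← ENNReal.ofReal_mul hκ.le, show -κ - 1 + 1 = -κ by ring, neg_neg,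
            mul_div_cancel₀ _ hκ.ne']
        rw [h2, mul_left_comm, lintegral_const_mul' _ _ ENNReal.ofReal_ne_top]
        congr 1
        rw [← lintegral_const_mul _ (by fun_prop), ← lintegral_indicator measurableSet_Ioi,
          ← lintegral_indicator measurableSet_Ioi]
        refine lintegral_congr fun ρ => ?_
        by_cases h : r < ρ
        · have : (0 : ℝ) < ρ := hr0.trans h
          simp [h, this, mul_comm]
        · by_cases h' : (0 : ℝ) < ρ <;> simp [h, h']
    _ = ∫⁻ ρ in Set.Ioi (0 : ℝ), ∫⁻ r in Set.Ioi (0 : ℝ), ENNReal.ofReal κ *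
        (ENNReal.ofReal (ρ ^ (-κ - 1)) * (g r * Set.indicator {q : ℝ × ℝ | q.1 < q.2} 1 (r, ρ))) := by
        refine lintegral_lintegral_swap (Measurable.aemeasurable ?_)
        have := (measurable_one (α := ℝ≥0∞) (β := ℝ × ℝ)).indicator hms
        exact measurable_const.mul (Measurable.mul (by fun_prop) (Measurable.mul (by fun_prop) this))
    _ = _ := by
        rw [← lintegral_const_mul' _ _ ENNReal.ofReal_ne_top]
        refine setLIntegral_congr_fun measurableSet_Ioi fun ρ hρ => ?_
        rw [lintegral_const_mul' _ _ ENNReal.ofReal_ne_top,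
          lintegral_const_mul' _ _ ENNReal.ofReal_ne_top]
        congr 2
        rw [← lintegral_indicator measurableSet_Ioi, ← lintegral_indicator measurableSet_Ioo]
        refine lintegral_congr fun r => ?_
        by_cases h : r < ρ <;> by_cases h' : (0 : ℝ) < r <;> simp [h, h']

/-- Bounds on a function of one variable corresponding to bounds on the Dirichlet and Coulomb
energies of a radial function on `ℝ^N`. -/
structure RadialBounds (N : ℕ) (α p : ℝ) (A B : ℝ≥0) (f : ℝ → ℝ) : Prop where
  contDiff : ContDiff ℝ 1 f
  deriv_bound : ∫⁻ r in Set.Ioi (0 : ℝ), ENNReal.ofReal (r ^ ((N : ℝ) - 1)) * ‖deriv f r‖ₑ ^ 2 ≤ A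
  mass_bound : ∀ R : ℝ, 0 < R → ∫⁻ r in Set.Ioo 0 R,
    ENNReal.ofReal (r ^ ((N : ℝ) - 1)) * ‖f r‖ₑ ^ p ≤ B * ENNReal.ofReal (R ^ (((N : ℝ) - α) / 2))

namespace RadialBounds

variable {N : ℕ} {α p : ℝ} {A B : ℝ≥0} {f : ℝ → ℝ}

theorem lintegral_deriv_le (h : RadialBounds N α p A B f) {S : Set ℝ} (hS : MeasurableSet S)
    (hS0 : S ⊆ Set.Ioi 0) : ∫⁻ r in S, ‖deriv f r‖ₑ ≤
      (A : ℝ≥0∞) ^ (1 / 2 : ℝ) *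
        (∫⁻ r in S, ENNReal.ofReal (r ^ (1 - (N : ℝ)))) ^ (1 / 2 : ℝ) := by
  have := lintegral_le_of_weighted_sq (g := fun r => ‖deriv f r‖ₑ)
    (by have := h.contDiff.continuous_deriv le_rfl; fun_prop) h.deriv_bound hS hS0
  rwa [neg_sub] at this

theorem lintegral_rpow_le (h : RadialBounds N α p A B f) (hN : 1 ≤ N) {R l : ℝ} (hR : 0 < R)
    (hlR : l ≤ R) : ∫⁻ r in Set.Ioo R (R + l), ‖f r‖ₑ ^ p ≤
      B * ENNReal.ofReal (R ^ (1 - (N : ℝ)) * (2 * R) ^ (((N : ℝ) - α) / 2)) := by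
  have hN1 : (1 : ℝ) ≤ N := by exact_mod_cast hN
  calc _ ≤ ∫⁻ r in Set.Ioo R (R + l), ENNReal.ofReal (R ^ (1 - (N : ℝ))) *
        (ENNReal.ofReal (r ^ ((N : ℝ) - 1)) * ‖f r‖ₑ ^ p) := by
        refine setLIntegral_mono' measurableSet_Ioo fun r hr => ?_
        have hr0 : 0 < r := hR.trans hr.1
        rw [← mul_assoc, ← ENNReal.ofReal_mul (by positivity)]
        refine le_mul_of_one_le_left' ?_
        rw [← ENNReal.ofReal_one]
        refine ENNReal.ofReal_le_ofReal ?_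
        calc (1 : ℝ) = R ^ (1 - (N : ℝ)) * R ^ ((N : ℝ) - 1) := by
              rw [← Real.rpow_add hR]; simp
          _ ≤ _ := by
              refine mul_le_mul_of_nonneg_left ?_ (by positivity)
              exact Real.rpow_le_rpow hR.le hr.1.le (by linarith)
    _ = ENNReal.ofReal (R ^ (1 - (N : ℝ))) * ∫⁻ r in Set.Ioo R (R + l),
        (ENNReal.ofReal (r ^ ((N : ℝ) - 1)) * ‖f r‖ₑ ^ p) :=
        lintegral_const_mul' _ _ ENNReal.ofReal_ne_top
    _ ≤ ENNReal.ofReal (R ^ (1 - (N : ℝ))) *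
        (B * ENNReal.ofReal ((2 * R) ^ (((N : ℝ) - α) / 2))) := by
        gcongr
        refine (lintegral_mono_set ?_).trans (h.mass_bound (2 * R) (by positivity))
        exact Set.Ioo_subset_Ioo hR.le (by linarith)
    _ = _ := by
        rw [ENNReal.ofReal_mul (by positivity)]; ring

/-- Bound at a point `R` in terms of an auxiliary length `l ≤ R`. -/
theorem enorm_le (h : RadialBounds N α p A B f) (hN : 1 ≤ N) (hp : 0 < p) {R l : ℝ} (hR : 0 < R)
    (hl : 0 < l) (hlR : l ≤ R) : ‖f R‖ₑ ≤
      (B : ℝ≥0∞) ^ (1 / p) * ENNReal.ofReal ((2 ^ (((N : ℝ) - α) / 2) *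
        (R ^ (1 - (N : ℝ) + ((N : ℝ) - α) / 2) * l⁻¹)) ^ (1 / p)) +
      (A : ℝ≥0∞) ^ (1 / 2 : ℝ) * ENNReal.ofReal ((l * R ^ (1 - (N : ℝ))) ^ (1 / 2 : ℝ)) := by
  have hN1 : (1 : ℝ) ≤ N := by exact_mod_cast hN
  have h1 := enorm_le_average_add_lintegral_deriv h.contDiff hp (show R < R + l by linarith)
    (Set.left_mem_Icc.2 (by linarith)) (h.lintegral_rpow_le hN hR hlR)
  rw [add_sub_cancel_left] at h1
  refine h1.trans (add_le_add (le_of_eq ?_) ?_)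
  · rw [mul_div_assoc, ← ENNReal.ofReal_div_of_pos hl,
      ENNReal.mul_rpow_of_nonneg _ _ (by positivity),
      ENNReal.ofReal_rpow_of_nonneg (by positivity) (by positivity),
      Real.mul_rpow (by norm_num) hR.le, Real.rpow_add hR]
    congr 3
    ring
  · refine (h.lintegral_deriv_le measurableSet_Ioo fun r hr => hR.trans hr.1).trans ?_
    gcongr
    rw [← ENNReal.ofReal_rpow_of_nonneg (by positivity) (by norm_num)]
    gcongr
    calc _ ≤ ∫⁻ r in Set.Ioo R (R + l), ENNReal.ofReal (R ^ (1 - (N : ℝ))) := by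
          refine setLIntegral_mono' measurableSet_Ioo fun r hr => ?_
          refine ENNReal.ofReal_le_ofReal ?_
          exact Real.rpow_le_rpow_of_nonpos hR hr.1.le (by linarith)
      _ = _ := by
          rw [setLIntegral_const, Real.volume_Ioo, add_sub_cancel_left,
            ← ENNReal.ofReal_mul (by positivity), mul_comm]

/-- The exponent of the pointwise bound for radial functions. -/
def decayExponent (N : ℕ) (α p : ℝ) : ℝ := (3 * N + α - 4) / (2 * (p + 2))

/-- The exponent `ω` such that annuli of radius `R` and width `R^ω` are critical. -/
def widthExponent (N : ℕ) (α p : ℝ) : ℝ := (p * (N - 1) - (N - 2 + α)) / (p + 2)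

/-- The averaging length l = R^ω makes the mass term and the derivative term carry the same power
R^(-κ). The condition R^ω ≤ R keeps the interval inside (0, 2R); it holds for R ≥ 1 if ω ≤ 1 and for
R ≤ 1 if ω ≥ 1. -/
theorem exists_enorm_le_rpow (hN : 1 ≤ N) (hp : 0 < p) (α : ℝ) (A B : ℝ≥0) :
    ∃ K : ℝ≥0, ∀ f : ℝ → ℝ, RadialBounds N α p A B f → ∀ R : ℝ, 0 < R →
      R ^ widthExponent N α p ≤ R → ‖f R‖ₑ ≤ K * ENNReal.ofReal (R ^ (-decayExponent N α p)) := by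
  have hp2 : p + 2 ≠ 0 := by positivity
  set K : ℝ≥0∞ := (B : ℝ≥0∞) ^ (1 / p) * ENNReal.ofReal ((2 ^ (((N : ℝ) - α) / 2)) ^ (1 / p)) +
    (A : ℝ≥0∞) ^ (1 / 2 : ℝ)
  have hK : K ≠ ⊤ := by
    have : 0 ≤ 1 / p := by positivity
    finiteness
  refine ⟨K.toNNReal, fun f h R hR hω => ?_⟩
  rw [ENNReal.coe_toNNReal hK]
  refine (h.enorm_le hN hp hR (by positivity) hω).trans (le_of_eq ?_)
  rw [← Real.rpow_neg hR.le, ← Real.rpow_add hR, ← Real.rpow_add hR,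
    Real.mul_rpow (by positivity) (by positivity), ← Real.rpow_mul hR.le, ← Real.rpow_mul hR.le,
    ENNReal.ofReal_mul (by positivity)]
  have e1 : (1 - (N : ℝ) + ((N : ℝ) - α) / 2 + -widthExponent N α p) * (1 / p) =
      -decayExponent N α p := by
    unfold widthExponent decayExponent
    field_simp
    ring
  have e2 : (widthExponent N α p + (1 - (N : ℝ))) * (1 / 2) = -decayExponent N α p := by
    unfold widthExponent decayExponent
    field_simp
    ring
  rw [e1, e2]
  ring

end RadialBounds

namespace RadialBounds

variable {N : ℕ} {α p : ℝ} {A B : ℝ≥0} {f : ℝ → ℝ}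

theorem enorm_rpow_le_mul {a K : ℝ≥0∞} {r κ p q : ℝ} (hr : 0 < r) (hp : 0 ≤ p) (hpq : p ≤ q)
    (h : a ≤ K * ENNReal.ofReal (r ^ (-κ))) :
    a ^ q ≤ K ^ (q - p) * (a ^ p * ENNReal.ofReal (r ^ (-(κ * (q - p))))) := by
  have hqp : 0 ≤ q - p := by linarith
  calc a ^ q = a ^ (q - p) * a ^ p := by
        rw [← ENNReal.rpow_add_of_nonneg _ _ hqp hp]; simp
    _ ≤ (K * ENNReal.ofReal (r ^ (-κ))) ^ (q - p) * a ^ p := by gcongr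
    _ = _ := by
        rw [ENNReal.mul_rpow_of_nonneg _ _ hqp, ENNReal.ofReal_rpow_of_nonneg (by positivity) hqp,
          ← Real.rpow_mul hr.le, neg_mul]
        ring

/-- The pointwise decay absorbs q - p powers of f. The rest is the p-mass, which grows at most like
ρ^β, against the weight r^(-κ), with κ now denoting the decay exponent times q - p; the layer-cake
integral of ρ^(-κ-1+β) converges at infinity because β < κ. -/
theorem exists_lintegral_Ici_le (hN : 1 ≤ N) (hp : 0 < p) {q : ℝ} (hpq : p ≤ q)
    (hω : widthExponent N α p ≤ 1) (hα : α < N)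
    (hκ : ((N : ℝ) - α) / 2 < decayExponent N α p * (q - p)) (A B : ℝ≥0) :
    ∃ C : ℝ≥0, ∀ f : ℝ → ℝ, RadialBounds N α p A B f →
      ∫⁻ r in Set.Ici (1 : ℝ), ENNReal.ofReal (r ^ ((N : ℝ) - 1)) * ‖f r‖ₑ ^ q ≤ C := by
  obtain ⟨K, hK⟩ := exists_enorm_le_rpow hN hp α A B
  set κ := decayExponent N α p * (q - p) with hκdef
  set β := ((N : ℝ) - α) / 2 with hβ
  have hβ0 : 0 < β := by rw [hβ]; linarith
  have hqp : 0 ≤ q - p := by linarith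
  have hκ0 : 0 < κ := hβ0.trans hκ
  set L : ℝ≥0∞ := (K : ℝ≥0∞) ^ (q - p) * (ENNReal.ofReal κ * (B * ENNReal.ofReal
    (1 ^ (-κ - 1 + β + 1) / (-(-κ - 1 + β + 1)))))
  have hL : L ≠ ⊤ := by finiteness
  refine ⟨L.toNNReal, fun f h => ?_⟩
  rw [ENNReal.coe_toNNReal hL]
  have hfm := h.contDiff.continuous.measurable
  set g : ℝ → ℝ≥0∞ := (Set.Ici (1 : ℝ)).indicator
    (fun r => ENNReal.ofReal (r ^ ((N : ℝ) - 1)) * ‖f r‖ₑ ^ p) with hg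
  have hgm : Measurable g := Measurable.indicator (by fun_prop) measurableSet_Ici
  have hinner : ∀ ρ : ℝ, 0 < ρ → ∫⁻ r in Set.Ioo 0 ρ, g r ≤
      (Set.Ioi (1 : ℝ)).indicator (fun ρ => B * ENNReal.ofReal (ρ ^ β)) ρ := by
    intro ρ hρ
    by_cases h1 : ρ ≤ 1
    · rw [Set.indicator_of_notMem (by simpa using h1)]
      refine le_of_eq ?_
      rw [setLIntegral_congr_fun (g := fun _ => 0) measurableSet_Ioo]
      · simp
      · intro r hr
        exact Set.indicator_of_notMem (by simpa using hr.2.trans_le h1) _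
    · rw [Set.indicator_of_mem (by simpa using h1)]
      refine le_trans (lintegral_mono fun r => ?_) (h.mass_bound ρ hρ)
      exact Set.indicator_le_self _ _ r
  calc _ ≤ ∫⁻ r in Set.Ici (1 : ℝ), (K : ℝ≥0∞) ^ (q - p) * (g r * ENNReal.ofReal (r ^ (-κ))) := by
        refine setLIntegral_mono' measurableSet_Ici fun r hr => ?_
        have hr1 : (1 : ℝ) ≤ r := hr
        have hr0 : 0 < r := by linarith
        have h1 := enorm_rpow_le_mul hr0 hp.le hpq (hK f h r hr0 (by
          conv_rhs => rw [← Real.rpow_one r]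
          exact Real.rpow_le_rpow_of_exponent_le hr1 hω))
        rw [hg, Set.indicator_of_mem hr]
        calc _ ≤ ENNReal.ofReal (r ^ ((N : ℝ) - 1)) * ((K : ℝ≥0∞) ^ (q - p) *
            (‖f r‖ₑ ^ p * ENNReal.ofReal (r ^ (-κ)))) := mul_le_mul_right h1 _
          _ = _ := by ring
    _ = (K : ℝ≥0∞) ^ (q - p) * ∫⁻ r in Set.Ici (1 : ℝ), (g r * ENNReal.ofReal (r ^ (-κ))) :=
        lintegral_const_mul' _ _ (by finiteness)
    _ ≤ (K : ℝ≥0∞) ^ (q - p) * ∫⁻ r in Set.Ioi (0 : ℝ), (g r * ENNReal.ofReal (r ^ (-κ))) := by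
        gcongr
        exact one_pos
    _ = (K : ℝ≥0∞) ^ (q - p) * (ENNReal.ofReal κ * ∫⁻ ρ in Set.Ioi (0 : ℝ),
          ENNReal.ofReal (ρ ^ (-κ - 1)) * ∫⁻ r in Set.Ioo 0 ρ, g r) := by
        rw [lintegral_mul_rpow_neg_eq hgm hκ0]
    _ ≤ (K : ℝ≥0∞) ^ (q - p) * (ENNReal.ofReal κ * ∫⁻ ρ in Set.Ioi (1 : ℝ),
          B * ENNReal.ofReal (ρ ^ (-κ - 1 + β))) := by
        refine mul_le_mul_right (mul_le_mul_right ?_ _) _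
        calc _ ≤ ∫⁻ ρ in Set.Ioi (0 : ℝ), (Set.Ioi (1 : ℝ)).indicator
              (fun ρ => B * ENNReal.ofReal (ρ ^ (-κ - 1 + β))) ρ := by
              refine setLIntegral_mono' measurableSet_Ioi fun ρ hρ => ?_
              have hρ0 : (0 : ℝ) < ρ := hρ
              refine (mul_le_mul_right (hinner ρ hρ0) _).trans (le_of_eq ?_)
              by_cases h1 : ρ ∈ Set.Ioi (1 : ℝ)
              · rw [Set.indicator_of_mem h1, Set.indicator_of_mem h1, Real.rpow_add hρ0,
                  ENNReal.ofReal_mul (by positivity)]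
                ring
              · rw [Set.indicator_of_notMem h1, Set.indicator_of_notMem h1, mul_zero]
          _ ≤ _ := by
              refine (setLIntegral_le_lintegral _ _).trans (le_of_eq ?_)
              rw [lintegral_indicator measurableSet_Ioi]
    _ = L := by
        rw [lintegral_const_mul' _ _ ENNReal.coe_ne_top, lintegral_Ioi_rpow (by linarith) one_pos]

/-- The counterpart at the origin: now κ < β, so ρ^(-κ-1+β) is integrable at 0. -/
theorem exists_lintegral_Ioo_le (hN : 1 ≤ N) (hp : 0 < p) {q : ℝ} (hpq : p < q)
    (hω : 1 ≤ widthExponent N α p) (hκ0 : 0 < decayExponent N α p)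
    (hκ : decayExponent N α p * (q - p) < ((N : ℝ) - α) / 2) (A B : ℝ≥0) :
    ∃ C : ℝ≥0, ∀ f : ℝ → ℝ, RadialBounds N α p A B f →
      ∫⁻ r in Set.Ioo (0 : ℝ) 1, ENNReal.ofReal (r ^ ((N : ℝ) - 1)) * ‖f r‖ₑ ^ q ≤ C := by
  obtain ⟨K, hK⟩ := exists_enorm_le_rpow hN hp α A B
  have hqp : 0 < q - p := by linarith
  have hκ0' := mul_pos hκ0 hqp
  set κ := decayExponent N α p * (q - p) with hκdef
  set β := ((N : ℝ) - α) / 2 with hβ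
  set L : ℝ≥0∞ := (K : ℝ≥0∞) ^ (q - p) * (ENNReal.ofReal κ * (B * ENNReal.ofReal
    (1 ^ (-κ - 1 + β + 1) / (-κ - 1 + β + 1)) + B * ENNReal.ofReal
    (1 ^ (-κ - 1 + 1) / (-(-κ - 1 + 1)))))
  have hL : L ≠ ⊤ := by finiteness
  refine ⟨L.toNNReal, fun f h => ?_⟩
  rw [ENNReal.coe_toNNReal hL]
  have hfm := h.contDiff.continuous.measurable
  set g : ℝ → ℝ≥0∞ := (Set.Ioo (0 : ℝ) 1).indicator
    (fun r => ENNReal.ofReal (r ^ ((N : ℝ) - 1)) * ‖f r‖ₑ ^ p) with hg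
  have hgm : Measurable g := Measurable.indicator (by fun_prop) measurableSet_Ioo
  have hin1 : ∀ ρ : ℝ, 0 < ρ → ∫⁻ r in Set.Ioo 0 ρ, g r ≤ B * ENNReal.ofReal (ρ ^ β) := by
    intro ρ hρ
    refine le_trans (lintegral_mono fun r => ?_) (h.mass_bound ρ hρ)
    exact Set.indicator_le_self _ _ r
  -- Beyond ρ = 1 the truncated mass stays constant, and κ > 0 alone gives convergence at infinity.
  have hin2 : ∀ ρ : ℝ, ∫⁻ r in Set.Ioo 0 ρ, g r ≤ B := by
    intro ρ
    refine (setLIntegral_le_lintegral _ _).trans ?_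
    rw [lintegral_indicator measurableSet_Ioo]
    simpa using h.mass_bound 1 one_pos
  have hsplit : Set.Ioi (0 : ℝ) ⊆ Set.Ioo 0 1 ∪ Set.Ioi 1 ∪ {1} := by
    intro r hr
    rcases lt_trichotomy r 1 with h | h | h
    · exact Or.inl (Or.inl ⟨hr, h⟩)
    · exact Or.inr h
    · exact Or.inl (Or.inr h)
  calc _ ≤ ∫⁻ r in Set.Ioo (0 : ℝ) 1, (K : ℝ≥0∞) ^ (q - p) *
          (g r * ENNReal.ofReal (r ^ (-κ))) := by
        refine setLIntegral_mono' measurableSet_Ioo fun r hr => ?_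
        have h1 := enorm_rpow_le_mul hr.1 hp.le hpq.le (hK f h r hr.1 (by
          conv_rhs => rw [← Real.rpow_one r]
          exact Real.rpow_le_rpow_of_exponent_ge hr.1 hr.2.le hω))
        rw [hg, Set.indicator_of_mem hr]
        calc _ ≤ ENNReal.ofReal (r ^ ((N : ℝ) - 1)) * ((K : ℝ≥0∞) ^ (q - p) *
            (‖f r‖ₑ ^ p * ENNReal.ofReal (r ^ (-κ)))) := mul_le_mul_right h1 _
          _ = _ := by ring
    _ = (K : ℝ≥0∞) ^ (q - p) * ∫⁻ r in Set.Ioo (0 : ℝ) 1, (g r * ENNReal.ofReal (r ^ (-κ))) :=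
        lintegral_const_mul' _ _ (by finiteness)
    _ ≤ (K : ℝ≥0∞) ^ (q - p) * ∫⁻ r in Set.Ioi (0 : ℝ), (g r * ENNReal.ofReal (r ^ (-κ))) := by
        gcongr
        exact Set.Ioo_subset_Ioi_self
    _ = (K : ℝ≥0∞) ^ (q - p) * (ENNReal.ofReal κ * ∫⁻ ρ in Set.Ioi (0 : ℝ),
          ENNReal.ofReal (ρ ^ (-κ - 1)) * ∫⁻ r in Set.Ioo 0 ρ, g r) := by
        rw [lintegral_mul_rpow_neg_eq hgm hκ0']
    _ ≤ L := by
        refine mul_le_mul_right (mul_le_mul_right ?_ _) _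
        refine (lintegral_mono_set hsplit).trans ((lintegral_union_le _ _ _).trans ?_)
        rw [Measure.restrict_singleton, Real.volume_singleton, zero_smul, lintegral_zero_measure,
          add_zero]
        refine (lintegral_union_le _ _ _).trans (add_le_add ?_ ?_)
        · calc _ ≤ ∫⁻ ρ in Set.Ioo (0 : ℝ) 1, B * ENNReal.ofReal (ρ ^ (-κ - 1 + β)) := by
                refine setLIntegral_mono' measurableSet_Ioo fun ρ hρ => ?_
                refine (mul_le_mul_right (hin1 ρ hρ.1) _).trans (le_of_eq ?_)
                rw [Real.rpow_add hρ.1, ENNReal.ofReal_mul (Real.rpow_nonneg hρ.1.le _)]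
                ring
            _ = _ := by
                rw [lintegral_const_mul' _ _ ENNReal.coe_ne_top,
                  lintegral_Ioo_rpow (by linarith) zero_le_one]
        · calc _ ≤ ∫⁻ ρ in Set.Ioi (1 : ℝ), B * ENNReal.ofReal (ρ ^ (-κ - 1)) := by
                refine setLIntegral_mono' measurableSet_Ioi fun ρ hρ => ?_
                rw [mul_comm]
                gcongr
                exact hin2 ρ
            _ = _ := by
                rw [lintegral_const_mul' _ _ ENNReal.coe_ne_top,
                  lintegral_Ioi_rpow (by linarith) one_pos]

theorem exists_lintegral_Ioo_le_of_le (hN : 1 ≤ N) {q : ℝ} (hq : 0 ≤ q) (hqp : q ≤ p)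
    (B : ℝ≥0) : ∃ C : ℝ≥0, ∀ (A : ℝ≥0) (f : ℝ → ℝ), RadialBounds N α p A B f →
      ∫⁻ r in Set.Ioo (0 : ℝ) 1, ENNReal.ofReal (r ^ ((N : ℝ) - 1)) * ‖f r‖ₑ ^ q ≤ C := by
  have hN1 : (1 : ℝ) ≤ N := by exact_mod_cast hN
  refine ⟨1 + B, fun A f h => ?_⟩
  have hfm := h.contDiff.continuous.measurable
  calc _ ≤ ∫⁻ r in Set.Ioo (0 : ℝ) 1, (1 + ENNReal.ofReal (r ^ ((N : ℝ) - 1)) * ‖f r‖ₑ ^ p) := by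
        refine setLIntegral_mono' measurableSet_Ioo fun r hr => ?_
        have h1 : ENNReal.ofReal (r ^ ((N : ℝ) - 1)) ≤ 1 := by
          rw [← ENNReal.ofReal_one]
          exact ENNReal.ofReal_le_ofReal (Real.rpow_le_one hr.1.le hr.2.le (by linarith))
        have h2 := rpow_le_rpow_add_rpow ‖f r‖ₑ hq hqp
        rw [ENNReal.rpow_zero] at h2
        calc _ ≤ ENNReal.ofReal (r ^ ((N : ℝ) - 1)) * (1 + ‖f r‖ₑ ^ p) := by gcongr
          _ = ENNReal.ofReal (r ^ ((N : ℝ) - 1)) +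
              ENNReal.ofReal (r ^ ((N : ℝ) - 1)) * ‖f r‖ₑ ^ p := by ring
          _ ≤ _ := by gcongr
    _ = 1 + ∫⁻ r in Set.Ioo (0 : ℝ) 1, ENNReal.ofReal (r ^ ((N : ℝ) - 1)) * ‖f r‖ₑ ^ p := by
        rw [lintegral_add_left measurable_const, setLIntegral_const, Real.volume_Ioo]
        simp
    _ ≤ _ := by
        push_cast
        gcongr
        simpa using h.mass_bound 1 one_pos

/-- Integrating f' from r to 1 with Cauchy–Schwarz gives |f(r)| ≤ M r^(-k) for every positive k
above (N-2)/2, and r^(N-1-kq) is integrable at 0 when kq < N. -/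
theorem exists_lintegral_Ioo_le_of_subcritical (hN : 1 ≤ N) (hp : 0 < p) {q : ℝ} (hq : 0 < q)
    (hqN : ((N : ℝ) - 2) / 2 < N / q) (A B : ℝ≥0) :
    ∃ C : ℝ≥0, ∀ f : ℝ → ℝ, RadialBounds N α p A B f →
      ∫⁻ r in Set.Ioo (0 : ℝ) 1, ENNReal.ofReal (r ^ ((N : ℝ) - 1)) * ‖f r‖ₑ ^ q ≤ C := by
  have hN1 : (1 : ℝ) ≤ N := by exact_mod_cast hN
  obtain ⟨K, hK⟩ := exists_enorm_le_rpow hN hp α A B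
  -- A strict margin above (N-2)/2, together with k > 0, avoids the logarithm in dimension 2 and
  -- treats dimension 1 in the same way.
  obtain ⟨k, hk1, hk2⟩ : ∃ k : ℝ, max 0 (((N : ℝ) - 2) / 2) < k ∧ k < N / q := exists_between
    (max_lt (by positivity) hqN)
  have hk0 : 0 < k := (le_max_left _ _).trans_lt hk1
  have hkN : (N : ℝ) - 2 < 2 * k := by linarith [(le_max_right _ _).trans_lt hk1]
  have hkq : k * q < N := by rwa [lt_div_iff₀ hq] at hk2
  set M : ℝ≥0∞ := K + (A : ℝ≥0∞) ^ (1 / 2 : ℝ) * ENNReal.ofReal ((1 / (2 * k)) ^ (1 / 2 : ℝ))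
  have hM : M ≠ ⊤ := by finiteness
  set L : ℝ≥0∞ := M ^ q * ENNReal.ofReal (1 ^ ((N : ℝ) - 1 + -k * q + 1) / ((N : ℝ) - 1 + -k * q + 1))
  have hL : L ≠ ⊤ := by finiteness
  refine ⟨L.toNNReal, fun f h => ?_⟩
  rw [ENNReal.coe_toNNReal hL]
  have hpt : ∀ r ∈ Set.Ioo (0 : ℝ) 1, ‖f r‖ₑ ≤ M * ENNReal.ofReal (r ^ (-k)) := by
    intro r hr
    have h1 : (1 : ℝ≥0∞) ≤ ENNReal.ofReal (r ^ (-k)) := by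
      rw [← ENNReal.ofReal_one]
      exact ENNReal.ofReal_le_ofReal (Real.one_le_rpow_of_pos_of_le_one_of_nonpos hr.1 hr.2.le
        (by linarith))
    have h2 : ‖f 1‖ₑ ≤ K := by simpa using hK f h 1 one_pos (by simp)
    have h3 : ∫⁻ s in Set.Ioo r 1, ENNReal.ofReal (s ^ (1 - (N : ℝ))) ≤
        ENNReal.ofReal (r ^ (-(2 * k)) / (2 * k)) := by
      calc _ ≤ ∫⁻ s in Set.Ioo r 1, ENNReal.ofReal (s ^ (-(2 * k) - 1)) := by
            refine setLIntegral_mono' measurableSet_Ioo fun s hs => ?_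
            exact ENNReal.ofReal_le_ofReal (Real.rpow_le_rpow_of_exponent_ge (hr.1.trans hs.1)
              hs.2.le (by linarith))
        _ ≤ ∫⁻ s in Set.Ioi r, ENNReal.ofReal (s ^ (-(2 * k) - 1)) :=
            lintegral_mono_set Set.Ioo_subset_Ioi_self
        _ = _ := by rw [lintegral_Ioi_rpow (by linarith) hr.1]; congr 2 <;> ring_nf
    calc ‖f r‖ₑ ≤ ‖f 1‖ₑ + ∫⁻ t in Set.Ioo r 1, ‖deriv f t‖ₑ :=
          enorm_le_enorm_add_lintegral_deriv h.contDiff (Set.left_mem_Icc.2 hr.2.le)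
            (Set.right_mem_Icc.2 hr.2.le)
      _ ≤ K * ENNReal.ofReal (r ^ (-k)) + (A : ℝ≥0∞) ^ (1 / 2 : ℝ) *
          (ENNReal.ofReal (r ^ (-(2 * k)) / (2 * k))) ^ (1 / 2 : ℝ) := by
          refine add_le_add (h2.trans (le_mul_of_one_le_right' h1)) ?_
          refine (h.lintegral_deriv_le measurableSet_Ioo fun s hs => hr.1.trans hs.1).trans ?_
          gcongr
      _ = _ := by
          rw [ENNReal.ofReal_rpow_of_nonneg (div_nonneg (Real.rpow_nonneg hr.1.le _) (by positivity))
            (by norm_num), div_eq_mul_one_div (r ^ (-(2 * k))), Real.mul_rpow (Real.rpow_nonneg hr.1.le _)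
            (by positivity), ← Real.rpow_mul hr.1.le,
            ENNReal.ofReal_mul (Real.rpow_nonneg hr.1.le _),
            show -(2 * k) * (1 / 2) = -k by ring]
          ring
  calc _ ≤ ∫⁻ r in Set.Ioo (0 : ℝ) 1, M ^ q * ENNReal.ofReal (r ^ ((N : ℝ) - 1 + -k * q)) := by
        refine setLIntegral_mono' measurableSet_Ioo fun r hr => ?_
        calc _ ≤ ENNReal.ofReal (r ^ ((N : ℝ) - 1)) * (M * ENNReal.ofReal (r ^ (-k))) ^ q := by
              gcongr; exact hpt r hr
          _ = _ := by
              rw [ENNReal.mul_rpow_of_nonneg _ _ hq.le, ENNReal.ofReal_rpow_of_nonneg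
                (Real.rpow_nonneg hr.1.le _) hq.le, ← Real.rpow_mul hr.1.le, Real.rpow_add hr.1,
                ENNReal.ofReal_mul (Real.rpow_nonneg hr.1.le _)]
              ring
    _ = L := by
        rw [lintegral_const_mul' _ _ (by finiteness),
          lintegral_Ioo_rpow (by linarith) zero_le_one]

/-- The mass bound forces f to tend to 0 at infinity, so f is controlled by the integral of |f'|
over (r, ∞), that is by r^(-(N-2)/2). The q-th power of this is integrable against r^(N-1) when q
exceeds the Sobolev exponent. -/
theorem exists_lintegral_Ici_le_of_supercritical (hN : 2 < N) (hp : 0 < p) (hα0 : 0 < α)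
    {q : ℝ} (hqN : N / q < ((N : ℝ) - 2) / 2) (hq : 0 < q) (A B : ℝ≥0) :
    ∃ C : ℝ≥0, ∀ f : ℝ → ℝ, RadialBounds N α p A B f →
      ∫⁻ r in Set.Ici (1 : ℝ), ENNReal.ofReal (r ^ ((N : ℝ) - 1)) * ‖f r‖ₑ ^ q ≤ C := by
  have hN2 : (2 : ℝ) < N := by exact_mod_cast hN
  set k : ℝ := ((N : ℝ) - 2) / 2 with hk
  have hk0 : 0 < k := by rw [hk]; linarith
  have hkq : N < k * q := by rwa [div_lt_iff₀ hq] at hqN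
  set M : ℝ≥0∞ := 2 * ((A : ℝ≥0∞) ^ (1 / 2 : ℝ) * ENNReal.ofReal ((1 / (2 * k)) ^ (1 / 2 : ℝ)))
  have hM : M ≠ ⊤ := by finiteness
  set L : ℝ≥0∞ := M ^ q *
    ENNReal.ofReal (1 ^ ((N : ℝ) - 1 + -k * q + 1) / (-((N : ℝ) - 1 + -k * q + 1)))
  have hL : L ≠ ⊤ := by finiteness
  refine ⟨L.toNNReal, fun f h => ?_⟩
  rw [ENNReal.coe_toNNReal hL]
  have hpt : ∀ r ∈ Set.Ici (1 : ℝ), ‖f r‖ₑ ≤ M * ENNReal.ofReal (r ^ (-k)) := by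
    intro r hr
    have hr1 : (1 : ℝ) ≤ r := hr
    have hr0 : 0 < r := by linarith
    have hJ : ∫⁻ t in Set.Ioi r, ‖deriv f t‖ₑ ≤ (A : ℝ≥0∞) ^ (1 / 2 : ℝ) *
        ENNReal.ofReal ((1 / (2 * k)) ^ (1 / 2 : ℝ)) * ENNReal.ofReal (r ^ (-k)) := by
      refine (h.lintegral_deriv_le measurableSet_Ioi fun s hs => hr0.trans hs).trans ?_
      rw [lintegral_Ioi_rpow (by linarith) hr0, ENNReal.ofReal_rpow_of_nonneg
        (div_nonneg (by positivity) (by linarith)) (by norm_num),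
        div_eq_mul_one_div (r ^ (1 - (N : ℝ) + 1)), Real.mul_rpow (by positivity) (one_div_nonneg.2 (by linarith)), ← Real.rpow_mul hr0.le,
        ENNReal.ofReal_mul (by positivity), show (1 - (N : ℝ) + 1) * (1 / 2) = -k by rw [hk]; ring,
        show -(1 - (N : ℝ) + 1) = 2 * k by rw [hk]; ring]
      exact le_of_eq (by ring)
    set c := ((N : ℝ) + α) / 2 * (1 / p)
    have hc : 0 < c := by positivity
    -- The factor 2 counts the variation of f on (r, R) and again on (R, 2R), where the average is
    -- taken. That average is O(R^(-c)).
    have hR : ∀ R : ℝ, r < R → ‖f r‖ₑ ≤ (B : ℝ≥0∞) ^ (1 / p) *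
        ENNReal.ofReal ((2 ^ (((N : ℝ) - α) / 2)) ^ (1 / p)) * ENNReal.ofReal (R ^ (-c)) +
        2 * ∫⁻ t in Set.Ioi r, ‖deriv f t‖ₑ := by
      intro R hrR
      have hR0 : 0 < R := hr0.trans hrR
      have h1 := enorm_le_enorm_add_lintegral_deriv h.contDiff (Set.left_mem_Icc.2 hrR.le)
        (Set.right_mem_Icc.2 hrR.le)
      have h2 := enorm_le_average_add_lintegral_deriv h.contDiff hp (show R < R + R by linarith)
        (Set.left_mem_Icc.2 (by linarith)) (h.lintegral_rpow_le (by omega) hR0 le_rfl)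
      have h3 : ∫⁻ t in Set.Ioo r R, ‖deriv f t‖ₑ ≤ ∫⁻ t in Set.Ioi r, ‖deriv f t‖ₑ :=
        lintegral_mono_set Set.Ioo_subset_Ioi_self
      have h4 : ∫⁻ t in Set.Ioo R (R + R), ‖deriv f t‖ₑ ≤ ∫⁻ t in Set.Ioi r, ‖deriv f t‖ₑ :=
        lintegral_mono_set fun t ht => hrR.trans ht.1
      have h5 : (B * ENNReal.ofReal (R ^ (1 - (N : ℝ)) * (2 * R) ^ (((N : ℝ) - α) / 2)) /
          ENNReal.ofReal (R + R - R)) ^ (1 / p) = (B : ℝ≥0∞) ^ (1 / p) *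
          ENNReal.ofReal ((2 ^ (((N : ℝ) - α) / 2)) ^ (1 / p)) * ENNReal.ofReal (R ^ (-c)) := by
        rw [add_sub_cancel_right, mul_div_assoc, ← ENNReal.ofReal_div_of_pos hR0,
          ENNReal.mul_rpow_of_nonneg _ _ (by positivity),
          ENNReal.ofReal_rpow_of_nonneg (by positivity) (by positivity), mul_assoc,
          ← ENNReal.ofReal_mul (by positivity)]
        congr 2
        rw [Real.mul_rpow (by norm_num) hR0.le, show -c = -(((N : ℝ) + α) / 2) * (1 / p) by ring,
          Real.rpow_mul hR0.le, ← Real.mul_rpow (x := 2 ^ (((N : ℝ) - α) / 2)) (by positivity)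
            (by positivity)]
        congr 1
        have h7 : R ^ (-(((N : ℝ) + α) / 2)) * R = R ^ (1 - (N : ℝ)) * R ^ (((N : ℝ) - α) / 2) := by
          rw [← Real.rpow_add_one hR0.ne', ← Real.rpow_add hR0]
          ring_nf
        rw [div_eq_iff hR0.ne', mul_assoc, h7]
        ring
      rw [h5] at h2
      calc ‖f r‖ₑ ≤ _ := h1
        _ ≤ (_ + ∫⁻ t in Set.Ioi r, ‖deriv f t‖ₑ) + ∫⁻ t in Set.Ioi r, ‖deriv f t‖ₑ :=
            add_le_add (h2.trans (add_le_add le_rfl h4)) h3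
        _ = _ := by rw [two_mul, add_assoc]
    have hlim : Filter.Tendsto (fun R : ℝ => (B : ℝ≥0∞) ^ (1 / p) *
        ENNReal.ofReal ((2 ^ (((N : ℝ) - α) / 2)) ^ (1 / p)) * ENNReal.ofReal (R ^ (-c)) +
        2 * ∫⁻ t in Set.Ioi r, ‖deriv f t‖ₑ) Filter.atTop (nhds ((B : ℝ≥0∞) ^ (1 / p) *
        ENNReal.ofReal ((2 ^ (((N : ℝ) - α) / 2)) ^ (1 / p)) * ENNReal.ofReal 0 +
        2 * ∫⁻ t in Set.Ioi r, ‖deriv f t‖ₑ)) := by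
      refine Filter.Tendsto.add_const _ (ENNReal.Tendsto.const_mul ?_ (Or.inr ?_))
      · exact ENNReal.tendsto_ofReal (tendsto_rpow_neg_atTop hc)
      · have : 0 ≤ 1 / p := by positivity
        finiteness
    have h6 := ge_of_tendsto hlim (by
      filter_upwards [Filter.eventually_gt_atTop r] with R hR' using hR R hR')
    rw [ENNReal.ofReal_zero, mul_zero, zero_add] at h6
    calc _ ≤ _ := h6
      _ ≤ _ := mul_le_mul_right hJ 2
      _ = _ := (mul_assoc _ _ _).symm
  calc _ ≤ ∫⁻ r in Set.Ici (1 : ℝ), M ^ q * ENNReal.ofReal (r ^ ((N : ℝ) - 1 + -k * q)) := by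
        refine setLIntegral_mono' measurableSet_Ici fun r hr => ?_
        have hr0 : (0 : ℝ) < r := lt_of_lt_of_le one_pos hr
        calc _ ≤ ENNReal.ofReal (r ^ ((N : ℝ) - 1)) * (M * ENNReal.ofReal (r ^ (-k))) ^ q := by
              gcongr; exact hpt r hr
          _ = _ := by
              rw [ENNReal.mul_rpow_of_nonneg _ _ hq.le, ENNReal.ofReal_rpow_of_nonneg
                (by positivity) hq.le, ← Real.rpow_mul hr0.le, Real.rpow_add hr0,
                ENNReal.ofReal_mul (by positivity)]
              ring
    _ = L := by
        rw [lintegral_const_mul' _ _ (by finiteness), setLIntegral_congr Ioi_ae_eq_Ici.symm,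
          lintegral_Ioi_rpow (by linarith) one_pos]

end RadialBounds


/-! ### From radial functions on ℝ^N to one variable. -/

/-- For each x in B_R the ball of radius 2R around x contains B_R, so the p-mass m of B_R satisfies
m ≤ C R^(N-α/2) (I_{α/2}*|u|^p)(x). Squaring and integrating over B_R gives m² R^N ≤ C R^(2N-α). -/
theorem exists_lintegral_ball_le_of_coulombEnergy_le {α : ℝ} (hα0 : 0 < α) (hαN : α < N) :
    ∃ C : ℝ≥0, ∀ p : ℝ, 0 ≤ p → ∀ u : EuclideanSpace ℝ (Fin N) → ℝ, coulombEnergy α p u ≤ 1 →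
      ∀ R : ℝ, 0 < R → ∫⁻ y in Metric.ball 0 R, ‖u y‖ₑ ^ p ≤
        C * ENNReal.ofReal (R ^ (((N : ℝ) - α) / 2)) := by
  have := nontrivial_euclideanSpace (pos_of_lt_natCast hα0 hαN)
  obtain ⟨C, hC⟩ := exists_lintegral_ball_le_rieszPotential hα0 hαN
  set v := volume (Metric.ball (0 : EuclideanSpace ℝ (Fin N)) 1)
  have hv0 : v ≠ 0 := (Metric.measure_ball_pos _ _ one_pos).ne'
  have hv : v ≠ ⊤ := measure_ball_lt_top.ne
  set L : ℝ≥0∞ := C * ENNReal.ofReal (2 ^ ((N : ℝ) - α / 2)) * (v⁻¹) ^ (1 / 2 : ℝ)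
  have hL : L ≠ ⊤ := by
    have : v⁻¹ ≠ ⊤ := ENNReal.inv_ne_top.2 hv0
    finiteness
  refine ⟨L.toNNReal, fun p hp u hV R hR => ?_⟩
  rw [ENNReal.coe_toNNReal hL]
  set m := ∫⁻ y in Metric.ball 0 R, ‖u y‖ₑ ^ p
  have hvol : volume (Metric.ball (0 : EuclideanSpace ℝ (Fin N)) R) =
      ENNReal.ofReal (R ^ (N : ℝ)) * v := by
    rw [Measure.addHaar_ball volume _ hR.le, finrank_euclideanSpace_fin, Real.rpow_natCast]
  set T := C * ENNReal.ofReal ((2 * R) ^ ((N : ℝ) - α / 2))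
  have h1 : m ^ 2 * (ENNReal.ofReal (R ^ (N : ℝ)) * v) ≤ T ^ 2 := by
    calc m ^ 2 * (ENNReal.ofReal (R ^ (N : ℝ)) * v)
        = ∫⁻ x in Metric.ball (0 : EuclideanSpace ℝ (Fin N)) R, m ^ 2 := by
          rw [setLIntegral_const, hvol]
      _ ≤ ∫⁻ x in Metric.ball (0 : EuclideanSpace ℝ (Fin N)) R,
            T ^ 2 * rieszPotential α p u x ^ 2 := by
          refine setLIntegral_mono' measurableSet_ball fun x hx => ?_
          rw [← mul_pow]
          gcongr
          refine (lintegral_mono_set ?_).trans (hC p hp u x (2 * R) (by linarith))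
          refine Metric.ball_subset_ball' ?_
          rw [Metric.mem_ball, dist_comm] at hx
          linarith
      _ = T ^ 2 * ∫⁻ x in Metric.ball (0 : EuclideanSpace ℝ (Fin N)) R,
            rieszPotential α p u x ^ 2 := lintegral_const_mul' _ _ (by finiteness)
      _ ≤ T ^ 2 * 1 := by
          gcongr
          exact (setLIntegral_le_lintegral _ _).trans hV
      _ = T ^ 2 := mul_one _
  have h2 : m * (ENNReal.ofReal (R ^ ((N : ℝ) / 2)) * v ^ (1 / 2 : ℝ)) ≤ T := by
    have h3 := ENNReal.rpow_le_rpow h1 (show (0 : ℝ) ≤ 1 / 2 by norm_num)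
    rw [ENNReal.mul_rpow_of_nonneg _ _ (by norm_num), ENNReal.mul_rpow_of_nonneg _ _ (by norm_num),
      ENNReal.ofReal_rpow_of_nonneg (by positivity) (by norm_num), ← Real.rpow_mul hR.le,
      ← ENNReal.rpow_natCast, ← ENNReal.rpow_natCast, ← ENNReal.rpow_mul, ← ENNReal.rpow_mul,
      show ((2 : ℕ) : ℝ) * (1 / 2) = 1 by norm_num, ENNReal.rpow_one, ENNReal.rpow_one,
      mul_one_div] at h3
    exact h3
  have hw0 : ENNReal.ofReal (R ^ ((N : ℝ) / 2)) * v ^ (1 / 2 : ℝ) ≠ 0 := by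
    refine mul_ne_zero (by rw [ENNReal.ofReal_ne_zero_iff]; positivity) ?_
    rw [Ne, ENNReal.rpow_eq_zero_iff]
    simp [hv0]
  have hw : ENNReal.ofReal (R ^ ((N : ℝ) / 2)) * v ^ (1 / 2 : ℝ) ≠ ⊤ := by finiteness
  rw [← ENNReal.le_div_iff_mul_le (Or.inl hw0) (Or.inl hw)] at h2
  refine h2.trans (ENNReal.div_le_of_le_mul (le_of_eq ?_))
  have h4 : ENNReal.ofReal ((2 * R) ^ ((N : ℝ) - α / 2)) =
      ENNReal.ofReal (2 ^ ((N : ℝ) - α / 2)) * (ENNReal.ofReal (R ^ ((N : ℝ) / 2)) *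
        ENNReal.ofReal (R ^ (((N : ℝ) - α) / 2))) := by
    rw [← ENNReal.ofReal_mul (by positivity), ← ENNReal.ofReal_mul (by positivity),
      ← Real.rpow_add hR, Real.mul_rpow (by norm_num) hR.le]
    ring_nf
  have h5 : v ^ (1 / 2 : ℝ) ≠ 0 := by
    rw [Ne, ENNReal.rpow_eq_zero_iff]
    simp [hv0]
  simp only [T, L, h4, ENNReal.inv_rpow]
  calc _ = C * (ENNReal.ofReal (2 ^ ((N : ℝ) - α / 2)) * (ENNReal.ofReal (R ^ ((N : ℝ) / 2)) *
        ENNReal.ofReal (R ^ (((N : ℝ) - α) / 2)))) *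
        (v ^ (1 / 2 : ℝ) * (v ^ (1 / 2 : ℝ))⁻¹) := by
        rw [ENNReal.mul_inv_cancel h5 (by finiteness), mul_one]
    _ = _ := by ring

theorem lintegral_radial_euclidean (hN : 0 < N) {f : ℝ → ℝ≥0∞} (hf : Measurable f) :
    ∫⁻ x : EuclideanSpace ℝ (Fin N), f ‖x‖ =
      (volume : Measure (EuclideanSpace ℝ (Fin N))).toSphere Set.univ *
        ∫⁻ r in Set.Ioi (0 : ℝ), ENNReal.ofReal (r ^ ((N : ℝ) - 1)) * f r := by
  have := nontrivial_euclideanSpace hN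
  rw [lintegral_radial volume hf]
  congr 1
  refine setLIntegral_congr_fun measurableSet_Ioi fun r _ => ?_
  rw [pow_pred_eq_rpow _ (by rw [finrank_euclideanSpace_fin]; exact hN.ne'), finrank_euclideanSpace_fin]

theorem toSphere_univ_ne_zero (hN : 0 < N) :
    (volume : Measure (EuclideanSpace ℝ (Fin N))).toSphere Set.univ ≠ 0 := by
  have := nontrivial_euclideanSpace hN
  rw [Measure.toSphere_apply_univ, finrank_euclideanSpace_fin]
  refine mul_ne_zero (by exact_mod_cast hN.ne') (Metric.measure_ball_pos _ _ one_pos).ne'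

theorem toSphere_univ_ne_top :
    (volume : Measure (EuclideanSpace ℝ (Fin N))).toSphere Set.univ ≠ ⊤ :=
  measure_ne_top _ _

theorem exists_norm_smul_eq {E : Type*} [NormedAddCommGroup E] [NormedSpace ℝ E] [Nontrivial E]
    (x : E) : ∃ σ : E, ‖σ‖ = 1 ∧ ‖x‖ • σ = x := by
  rcases eq_or_ne x 0 with rfl | hx
  · obtain ⟨σ, hσ⟩ := exists_norm_eq E zero_le_one
    exact ⟨σ, hσ, by simp⟩
  · have : ‖x‖ ≠ 0 := norm_ne_zero_iff.2 hx
    exact ⟨‖x‖⁻¹ • x, by rw [norm_smul, norm_inv, norm_norm, inv_mul_cancel₀ this],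
      by rw [smul_smul, mul_inv_cancel₀ this, one_smul]⟩

/-- The profile does not depend on the unit vector chosen, so e can be replaced by the direction of
x. -/
theorem RadiallySymmetric.enorm_deriv_le {u : EuclideanSpace ℝ (Fin N) → ℝ}
    (hu : ContDiff ℝ ∞ u) (h : RadiallySymmetric u) {e : EuclideanSpace ℝ (Fin N)} (he : ‖e‖ = 1)
    (x : EuclideanSpace ℝ (Fin N)) :
    ‖deriv (fun r : ℝ => u (r • e)) ‖x‖‖ₑ ≤ ‖fderiv ℝ u x‖ₑ := by
  have : Nontrivial (EuclideanSpace ℝ (Fin N)) := ⟨e, 0, by rintro rfl; simp at he⟩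
  obtain ⟨σ, hσ, hx⟩ := exists_norm_smul_eq x
  have h1 : (fun r : ℝ => u (r • e)) = fun r : ℝ => u (r • σ) := by
    ext r
    exact h _ _ (by rw [norm_smul, norm_smul, he, hσ])
  have h2 : HasDerivAt (fun r : ℝ => u (r • σ)) (fderiv ℝ u (‖x‖ • σ) σ) ‖x‖ := by
    have h3 := (hu.differentiable (by simp) (‖x‖ • σ)).hasFDerivAt
    have h4 : HasDerivAt (fun r : ℝ => r • σ) σ ‖x‖ := by
      simpa using (hasDerivAt_id ‖x‖).smul_const σ
    exact h3.comp_hasDerivAt _ h4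
  rw [h1, h2.deriv, hx, ← ofReal_norm, ← ofReal_norm]
  refine ENNReal.ofReal_le_ofReal (((fderiv ℝ u x).le_opNorm σ).trans ?_)
  rw [hσ, mul_one]

theorem RadiallySymmetric.lintegral_eq (hN : 0 < N) {u : EuclideanSpace ℝ (Fin N) → ℝ}
    (hu : Continuous u) (h : RadiallySymmetric u) {e : EuclideanSpace ℝ (Fin N)} (he : ‖e‖ = 1)
    (q : ℝ) : ∫⁻ x, ‖u x‖ₑ ^ q =
      (volume : Measure (EuclideanSpace ℝ (Fin N))).toSphere Set.univ *
        ∫⁻ r in Set.Ioi (0 : ℝ), ENNReal.ofReal (r ^ ((N : ℝ) - 1)) * ‖u (r • e)‖ₑ ^ q := by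
  rw [← lintegral_radial_euclidean hN (f := fun r => ‖u (r • e)‖ₑ ^ q)
    (by have := hu.measurable; fun_prop)]
  refine lintegral_congr fun x => ?_
  rw [h x (‖x‖ • e) (by rw [norm_smul, he, norm_norm, mul_one])]

theorem RadiallySymmetric.exists_radialBounds {α : ℝ} (hα0 : 0 < α) (hαN : α < N) :
    ∃ A B : ℝ≥0, ∀ p : ℝ, 0 ≤ p → ∀ u : EuclideanSpace ℝ (Fin N) → ℝ, ContDiff ℝ ∞ u →
      RadiallySymmetric u → ∫⁻ x, ‖fderiv ℝ u x‖ₑ ^ 2 ≤ 1 → coulombEnergy α p u ≤ 1 →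
      ∀ e : EuclideanSpace ℝ (Fin N), ‖e‖ = 1 →
        RadialBounds N α p A B fun r : ℝ => u (r • e) := by
  have hN := pos_of_lt_natCast hα0 hαN
  obtain ⟨C, hC⟩ := exists_lintegral_ball_le_of_coulombEnergy_le hα0 hαN
  set S := (volume : Measure (EuclideanSpace ℝ (Fin N))).toSphere Set.univ
  have hS0 : S ≠ 0 := toSphere_univ_ne_zero hN
  have hS : S ≠ ⊤ := toSphere_univ_ne_top
  have hSi : S⁻¹ ≠ ⊤ := ENNReal.inv_ne_top.2 hS0
  have key : ∀ {a b : ℝ≥0∞}, S * a ≤ b → a ≤ S⁻¹ * b := by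
    intro a b h
    calc a = S⁻¹ * (S * a) := by rw [← mul_assoc, ENNReal.inv_mul_cancel hS0 hS, one_mul]
      _ ≤ _ := by gcongr
  refine ⟨S⁻¹.toNNReal, (S⁻¹ * C).toNNReal, fun p hp u hu hr hD hV e he => ?_⟩
  have hf : ContDiff ℝ ∞ (fun r : ℝ => u (r • e)) := hu.comp (contDiff_id.smul contDiff_const)
  have hdc : Continuous (deriv fun r : ℝ => u (r • e)) := hf.continuous_deriv (by simp)
  refine ⟨hf.of_le (by simp), ?_, fun R hR => ?_⟩
  · rw [ENNReal.coe_toNNReal hSi, ← mul_one S⁻¹]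
    refine key ?_
    rw [← lintegral_radial_euclidean hN (f := fun r => ‖deriv (fun r : ℝ => u (r • e)) r‖ₑ ^ 2)
      (by fun_prop)]
    refine le_trans (lintegral_mono fun x => ?_) hD
    have := hr.enorm_deriv_le hu he x
    gcongr
  · rw [ENNReal.coe_toNNReal (by finiteness), mul_assoc]
    refine key (le_trans (le_of_eq ?_) (hC p hp u hV R hR))
    have hcu : Continuous fun r : ℝ => u (r • e) := hf.continuous
    have h1 := lintegral_radial_euclidean hN (f := (Set.Iio R).indicator
      fun r => ‖u (r • e)‖ₑ ^ p) ((hcu.measurable.enorm.pow_const p).indicator measurableSet_Iio)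
    rw [← lintegral_indicator measurableSet_ball]
    have h2 : ∫⁻ x, (Metric.ball 0 R).indicator (fun y => ‖u y‖ₑ ^ p) x =
        ∫⁻ x : EuclideanSpace ℝ (Fin N), (Set.Iio R).indicator (fun r => ‖u (r • e)‖ₑ ^ p) ‖x‖ := by
      refine lintegral_congr fun x => ?_
      by_cases hx : ‖x‖ < R
      · rw [Set.indicator_of_mem (by simpa using hx), Set.indicator_of_mem (by simpa using hx),
          hr x (‖x‖ • e) (by rw [norm_smul, he, norm_norm, mul_one])]
      · rw [Set.indicator_of_notMem (by simpa using hx), Set.indicator_of_notMem (by simpa using hx)]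
    rw [h2, h1]
    congr 1
    rw [← Set.Ioi_inter_Iio, Set.inter_comm, ← Measure.restrict_restrict measurableSet_Iio,
      ← lintegral_indicator measurableSet_Iio]
    refine lintegral_congr fun r => ?_
    by_cases hx : r ∈ Set.Iio R
    · rw [Set.indicator_of_mem hx, Set.indicator_of_mem hx]
    · rw [Set.indicator_of_notMem hx, Set.indicator_of_notMem hx, mul_zero]

theorem normalizedBound_of_radialBounds {α p q : ℝ} (hα0 : 0 < α) (hαN : α < N) (hp : 0 ≤ p)
    (h₀ : ∀ A B : ℝ≥0, ∃ C : ℝ≥0, ∀ f : ℝ → ℝ, RadialBounds N α p A B f →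
      ∫⁻ r in Set.Ioo (0 : ℝ) 1, ENNReal.ofReal (r ^ ((N : ℝ) - 1)) * ‖f r‖ₑ ^ q ≤ C)
    (h₁ : ∀ A B : ℝ≥0, ∃ C : ℝ≥0, ∀ f : ℝ → ℝ, RadialBounds N α p A B f →
      ∫⁻ r in Set.Ici (1 : ℝ), ENNReal.ofReal (r ^ ((N : ℝ) - 1)) * ‖f r‖ₑ ^ q ≤ C) :
    NormalizedBound α p q (RadiallySymmetric (N := N)) := by
  have hN := pos_of_lt_natCast hα0 hαN
  have := nontrivial_euclideanSpace hN
  obtain ⟨A, B, hAB⟩ := RadiallySymmetric.exists_radialBounds hα0 hαN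
  obtain ⟨C₀, hC₀⟩ := h₀ A B
  obtain ⟨C₁, hC₁⟩ := h₁ A B
  obtain ⟨e, he⟩ := exists_norm_eq (EuclideanSpace ℝ (Fin N)) zero_le_one
  set S := (volume : Measure (EuclideanSpace ℝ (Fin N))).toSphere Set.univ
  refine ⟨S.toNNReal * (C₀ + C₁), fun u hu hr hD hV => ?_⟩
  have hf := hAB p hp u hu hr hD hV e he
  rw [hr.lintegral_eq hN hu.continuous he q, ENNReal.coe_mul,
    ENNReal.coe_toNNReal toSphere_univ_ne_top]
  refine mul_le_mul_right ?_ _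
  have hs : Set.Ioi (0 : ℝ) ⊆ Set.Ioo 0 1 ∪ Set.Ici 1 := by
    intro r hr
    rcases lt_or_ge r 1 with h | h
    · exact Or.inl ⟨hr, h⟩
    · exact Or.inr h
  refine (lintegral_mono_set hs).trans ((lintegral_union_le _ _ _).trans ?_)
  rw [ENNReal.coe_add]
  exact add_le_add (hC₀ _ hf) (hC₁ _ hf)

/-- Equality with the Sobolev exponent needs no symmetry. Otherwise the two alternatives of `QRad`
correspond to ω ≤ 1 and ω ≥ 1: the strict inequality handles r > 1 in the first and r < 1 in the
second, and the strict Sobolev-side inequality handles the other end. -/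
theorem normalizedBound_radial {α p q : ℝ} (hα : 1 < α) (hαN : α < N) (hp : 1 ≤ p) (hq : 1 ≤ q)
    (h : QRad N α p q) : NormalizedBound α p q (RadiallySymmetric (N := N)) := by
  have hα0 : 0 < α := by linarith
  have hN := pos_of_lt_natCast hα0 hαN
  have hN1 : 1 < N := by exact_mod_cast hα.trans hαN
  have hN2 : (2 : ℝ) ≤ N := by exact_mod_cast hN1
  have hp0 : 0 < p := by linarith
  have hq0 : 0 < q := by linarith
  have hb : 0 < 3 * N + α - 4 := by linarith
  have hc : 0 < 2 * (2 * p * ((N : ℝ) - 1) + N - α) := by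
    have : 0 ≤ 2 * p * ((N : ℝ) - 1) := by
      have : 0 ≤ (N : ℝ) - 1 := by linarith
      positivity
    linarith
  have hdecay : 0 < RadialBounds.decayExponent N α p := by
    unfold RadialBounds.decayExponent; positivity
  have hsob : 1 / 2 - 1 / (N : ℝ) = 1 / q → NormalizedBound α p q (RadiallySymmetric (N := N)) := by
    intro h0
    have hN3 : 2 < N := by
      by_contra hle
      have : N = 2 := by omega
      subst this
      norm_num at h0
      linarith
    have hN3' : (2 : ℝ) < N := by exact_mod_cast hN3
    have : q = 2 * N / ((N : ℝ) - 2) := by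
      rw [eq_div_iff (by linarith)]
      field_simp at h0
      linarith
    rw [this]
    exact normalizedBound_sobolev hα0 hαN hp hN3 _
  unfold QRad at h
  rw [max_eq_left (by linarith)] at h
  rcases h with ⟨h1, h2, h3⟩ | ⟨h1, h2, h3⟩
  · rcases h2.eq_or_lt with h2 | h2
    · exact hsob h2
    have h1' : p * ((N : ℝ) - 2) ≤ N + α := by
      rw [ge_iff_le, div_le_div_iff₀ (by linarith) hp0] at h1
      linarith
    have hω : RadialBounds.widthExponent N α p ≤ 1 := by
      unfold RadialBounds.widthExponent
      rw [div_le_one (by linarith)]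
      linarith
    have hκ : ((N : ℝ) - α) / 2 < RadialBounds.decayExponent N α p * (q - p) := by
      rw [div_lt_div_iff₀ hq0 hc] at h3
      unfold RadialBounds.decayExponent
      rw [div_mul_eq_mul_div, div_lt_div_iff₀ (by norm_num) (by linarith)]
      nlinarith
    -- By `hκ` the product of the decay exponent with q - p exceeds (N-α)/2 > 0.
    have hpq : p < q := by
      by_contra! hle
      nlinarith
    have hqN : ((N : ℝ) - 2) / 2 < N / q := by
      have h4 : (N : ℝ) * (1 / 2 - 1 / N) < N * (1 / q) := by gcongr
      have h5 : (N : ℝ) * (1 / 2 - 1 / N) = ((N : ℝ) - 2) / 2 := by field_simp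
      rw [h5, mul_one_div] at h4
      exact h4
    exact normalizedBound_of_radialBounds hα0 hαN hp0.le
      (fun A B => RadialBounds.exists_lintegral_Ioo_le_of_subcritical hN hp0 hq0 hqN A B)
      (fun A B => RadialBounds.exists_lintegral_Ici_le hN hp0 hpq.le hω hαN hκ A B)
  · rcases h2.eq_or_lt' with h2 | h2
    · exact hsob h2
    have h1' : N + α ≤ p * ((N : ℝ) - 2) := by
      rw [div_le_div_iff₀ hp0 (by linarith)] at h1
      linarith
    have hN3 : 2 < N := by
      by_contra hle
      have : N = 2 := by omega
      subst this
      norm_num at h1'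
      linarith
    have hω : 1 ≤ RadialBounds.widthExponent N α p := by
      unfold RadialBounds.widthExponent
      rw [one_le_div (by linarith)]
      linarith
    have hκ : RadialBounds.decayExponent N α p * (q - p) < ((N : ℝ) - α) / 2 := by
      rw [gt_iff_lt, div_lt_div_iff₀ hc hq0] at h3
      unfold RadialBounds.decayExponent
      rw [div_mul_eq_mul_div, div_lt_div_iff₀ (by linarith) (by norm_num)]
      nlinarith
    have hqN : N / q < ((N : ℝ) - 2) / 2 := by
      have h4 : (N : ℝ) * (1 / q) < N * (1 / 2 - 1 / N) := by gcongr
      have h5 : (N : ℝ) * (1 / 2 - 1 / N) = ((N : ℝ) - 2) / 2 := by field_simp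
      rw [h5, mul_one_div] at h4
      exact h4
    refine normalizedBound_of_radialBounds hα0 hαN hp0.le (fun A B => ?_)
      (fun A B => RadialBounds.exists_lintegral_Ici_le_of_supercritical hN3 hp0 hα0 hqN hq0 A B)
    -- Here q ≤ p can occur; near the origin |f|^q is then bounded by 1 + |f|^p, and the decay is
    -- not needed.
    rcases lt_or_ge p q with hpq | hpq
    · exact RadialBounds.exists_lintegral_Ioo_le hN hp0 hpq hω hdecay hκ A B
    · obtain ⟨C, hC⟩ := RadialBounds.exists_lintegral_Ioo_le_of_le (α := α) hN hq0.le hpq B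
      exact ⟨C, fun f hf => hC A f hf⟩


/-! ### Scaling, and the passage to embeddings and product inequalities. -/

/-- In log l and log m the two equations form a linear system of determinant 2Δ. The exponent θ is
the one for which l^q m^N is a product of powers of D and V. -/
theorem exists_scaling {α p q D V : ℝ} (hq : 0 < q) (hp : 0 < p)
    (hΔ : N + α - p * ((N : ℝ) - 2) ≠ 0) (hD : 0 < D) (hV : 0 < V) :
    ∃ l m : ℝ, 0 < l ∧ 0 < m ∧ l ^ (2 : ℝ) * m ^ ((N : ℝ) - 2) = D ∧
      l ^ (2 * p) * m ^ (N + α) = V ∧ l ^ q * m ^ (N : ℝ) =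
        (D ^ (interpolationExponent N α p q / 2) *
          V ^ ((1 - interpolationExponent N α p q) / (2 * p))) ^ q := by
  set Δ := N + α - p * ((N : ℝ) - 2) with hΔd
  set a := Real.log D
  set b := Real.log V
  have ha : D = Real.exp a := (Real.exp_log hD).symm
  have hb : V = Real.exp b := (Real.exp_log hV).symm
  clear_value a b
  subst ha hb
  set c := (b - p * a) / Δ
  have hc : b = p * a + c * Δ := by simp only [c]; field_simp; ring
  refine ⟨Real.exp (a / 2 - ((N : ℝ) - 2) / 2 * c), Real.exp c, Real.exp_pos _, Real.exp_pos _,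
    ?_, ?_, ?_⟩
  · rw [← Real.exp_mul, ← Real.exp_mul, ← Real.exp_add]
    ring_nf
  · rw [← Real.exp_mul, ← Real.exp_mul, ← Real.exp_add, hc, hΔd]
    ring_nf
  · have h1 : interpolationExponent N α p q = 1 - p / Δ * (2 * N / q - (N - 2)) := by
      unfold interpolationExponent
      rw [← hΔd]
      field_simp
      rw [hΔd]
      ring
    rw [← Real.exp_mul, ← Real.exp_mul, ← Real.exp_mul, ← Real.exp_mul, ← Real.exp_add,
      ← Real.exp_add, ← Real.exp_mul, h1, hc]
    congr 1
    field_simp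
    ring

/-- The Sobolev side of `QRad` gives θ ≤ 1. The identity `key` compares the radial threshold for 1/q
with (N+α)/(2pN), the value where θ vanishes, and gives θ ≥ 0. -/
theorem QRad.interpolationExponent_mem {α p q : ℝ} (hα : 1 < α) (hαN : α < N) (hp : 1 ≤ p)
    (hq : 1 ≤ q) (h : QRad N α p q) :
    N + α - p * ((N : ℝ) - 2) ≠ 0 ∧ 0 ≤ interpolationExponent N α p q ∧
      interpolationExponent N α p q ≤ 1 := by
  have hN1 : 1 < N := by exact_mod_cast hα.trans hαN
  have hN2 : (2 : ℝ) ≤ N := by exact_mod_cast hN1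
  have hp0 : 0 < p := by linarith
  have hq0 : 0 < q := by linarith
  have hc : 0 < 2 * (2 * p * ((N : ℝ) - 1) + N - α) := by
    have : 0 ≤ 2 * p * ((N : ℝ) - 1) := by
      have : 0 ≤ (N : ℝ) - 1 := by linarith
      positivity
    linarith
  have key : (N + α) * (2 * (2 * p * ((N : ℝ) - 1) + N - α)) - 2 * p * N * (3 * N + α - 4) =
      2 * (N - α) * (N + α - p * ((N : ℝ) - 2)) := by ring
  have key2 : (3 * N + α - 4) * (2 * N) - (N - 2) * (2 * (2 * p * ((N : ℝ) - 1) + N - α)) =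
      4 * (N - 1) * (N + α - p * ((N : ℝ) - 2)) := by ring
  unfold QRad at h
  rw [max_eq_left (by linarith), show 1 / 2 - 1 / (N : ℝ) = (N - 2) / (2 * N) by field_simp] at h
  unfold interpolationExponent
  set Δ := N + α - p * ((N : ℝ) - 2)
  set b := 3 * N + α - 4
  set c := 2 * (2 * p * ((N : ℝ) - 1) + N - α)
  rcases h with ⟨h1, h2, h3⟩ | ⟨h1, h2, h3⟩
  · have h1' : 0 ≤ Δ := by
      rw [ge_iff_le, div_le_div_iff₀ (by linarith) hp0] at h1
      simp only [Δ]
      linarith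
    -- If Δ = 0, then `key2` says that the radial threshold equals 1/2-1/N, so no 1/q lies between
    -- them.
    have hΔ : 0 < Δ := by
      refine h1'.lt_of_ne fun h0 => ?_
      have := h2.trans_lt h3
      rw [div_lt_div_iff₀ (by positivity) hc] at this
      rw [← h0] at key2
      linarith
    refine ⟨hΔ.ne', div_nonneg ?_ h1', (div_le_one hΔ).2 ?_⟩
    · rw [sub_nonneg, div_le_iff₀ hq0]
      rw [div_lt_div_iff₀ hq0 hc] at h3
      have h4 : 0 ≤ 2 * (N - α) * Δ := mul_nonneg (by linarith) h1'
      have h5 : 2 * p * N * (1 * c) ≤ 2 * p * N * (b * q) := by gcongr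
      have h6 : 2 * p * N * b * q ≤ (N + α) * c * q :=
        mul_le_mul_of_nonneg_right (by linarith) hq0.le
      exact le_of_mul_le_mul_right (by linarith : 2 * p * N * c ≤ (N + α) * q * c) hc
    · rw [div_le_div_iff₀ (by positivity) hq0] at h2
      have h4 : p * ((N : ℝ) - 2) ≤ 2 * p * N / q := by
        rw [le_div_iff₀ hq0]
        have : p * (((N : ℝ) - 2) * q) ≤ p * (1 * (2 * N)) := by gcongr
        linarith
      simp only [Δ]
      linarith
  · have h1' : Δ ≤ 0 := by
      rw [div_le_div_iff₀ hp0 (by linarith)] at h1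
      simp only [Δ]
      linarith
    have hΔ : Δ < 0 := by
      refine h1'.lt_of_ne fun h0 => ?_
      have := h3.trans_le h2
      rw [div_lt_div_iff₀ hc (by positivity)] at this
      rw [h0] at key2
      linarith
    refine ⟨hΔ.ne, div_nonneg_of_nonpos ?_ h1', (div_le_one_of_neg hΔ).2 ?_⟩
    · rw [sub_nonpos, le_div_iff₀ hq0]
      rw [gt_iff_lt, div_lt_div_iff₀ hc hq0] at h3
      have h4 : 2 * (N - α) * Δ ≤ 0 := mul_nonpos_of_nonneg_of_nonpos (by linarith) h1'
      have h5 : 2 * p * N * (b * q) ≤ 2 * p * N * (1 * c) := by gcongr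
      have h6 : (N + α) * c * q ≤ 2 * p * N * b * q :=
        mul_le_mul_of_nonneg_right (by linarith) hq0.le
      exact le_of_mul_le_mul_right (by linarith : (N + α) * q * c ≤ 2 * p * N * c) hc
    · rw [ge_iff_le, div_le_div_iff₀ hq0 (by positivity)] at h2
      have h4 : 2 * p * N / q ≤ p * ((N : ℝ) - 2) := by
        rw [div_le_iff₀ hq0]
        have : p * (1 * (2 * N)) ≤ p * (((N : ℝ) - 2) * q) := by gcongr
        linarith
      simp only [Δ]
      linarith

theorem dirichletEnergy_le_coulombSobolevNorm (α p : ℝ) (u : EuclideanSpace ℝ (Fin N) → ℝ) :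
    dirichletEnergy u ≤ coulombSobolevNorm α p u ^ (2 : ℝ) := by
  unfold coulombSobolevNorm
  rw [← ENNReal.rpow_mul]
  norm_num

theorem coulombEnergy_le_coulombSobolevNorm (α : ℝ) {p : ℝ} (hp : 0 < p)
    (u : EuclideanSpace ℝ (Fin N) → ℝ) :
    coulombEnergy α p u ≤ coulombSobolevNorm α p u ^ (2 * p) := by
  unfold coulombSobolevNorm
  rw [← ENNReal.rpow_mul, show 1 / 2 * (2 * p) = p by ring]
  calc coulombEnergy α p u = (coulombEnergy α p u ^ (1 / p)) ^ p := by
        rw [← ENNReal.rpow_mul, one_div_mul_cancel hp.ne', ENNReal.rpow_one]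
    _ ≤ _ := by gcongr; exact le_add_self

theorem eLpNorm_ofReal_eq {q : ℝ} (hq : 0 < q) (u : EuclideanSpace ℝ (Fin N) → ℝ) :
    eLpNorm u (ENNReal.ofReal q) = (∫⁻ x, ‖u x‖ₑ ^ q) ^ (1 / q) := by
  rw [eLpNorm_eq_lintegral_rpow_enorm_toReal (by simpa using hq) ENNReal.ofReal_ne_top,
    ENNReal.toReal_ofReal hq.le]

/-- A bound for normalized smooth functions gives an embedding. -/
theorem NormalizedBound.embedsInLq {α p q : ℝ} (hp : 1 ≤ p) (hq : 0 < q)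
    {P : (EuclideanSpace ℝ (Fin N) → ℝ) → Prop} (h : NormalizedBound α p q P)
    (hP : DilationInvariant P) {X : Set (EuclideanSpace ℝ (Fin N) → ℝ)} (hX : X ⊆ space N α p)
    (hXP : ∀ u ∈ X, ∀ ε > 0, P (mollify u ε)) : EmbedsInLq α p q X := by
  have hp0 : 0 < p := by linarith
  obtain ⟨C, hC⟩ := h.exists_lintegral_le hp hq.le hP
  refine ⟨C ^ (1 / q), fun u hu => ?_⟩
  obtain ⟨hum, hud, hun⟩ := hX hu
  set n := coulombSobolevNorm α p u
  -- Scaling with m = 1 and l equal to the norm; the shift by δ keeps l positive when the norm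
  -- vanishes, and δ tends to 0 afterwards.
  have h1 : ∀ δ : ℝ, 0 < δ → ∫⁻ x, ‖u x‖ₑ ^ q ≤ C * ENNReal.ofReal ((n.toReal + δ) ^ q) := by
    intro δ hδ
    have h0 : 0 < n.toReal + δ := by positivity
    have hn : n ≤ ENNReal.ofReal (n.toReal + δ) := by
      rw [← ENNReal.ofReal_toReal hun.ne]
      exact ENNReal.ofReal_le_ofReal (by simpa using hδ.le)
    have h2 := hC u hum hud (hXP u hu) (n.toReal + δ) 1 h0 one_pos ?_ ?_
    · simpa using h2
    · rw [Real.one_rpow, mul_one, ← ENNReal.ofReal_rpow_of_pos h0]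
      exact (dirichletEnergy_le_coulombSobolevNorm α p u).trans (by gcongr)
    · rw [Real.one_rpow, mul_one, ← ENNReal.ofReal_rpow_of_pos h0]
      exact (coulombEnergy_le_coulombSobolevNorm α hp0 u).trans (by gcongr)
  have h2 : ∫⁻ x, ‖u x‖ₑ ^ q ≤ C * n ^ q := by
    have h3 : Filter.Tendsto (fun δ : ℝ => (C : ℝ≥0∞) * ENNReal.ofReal ((n.toReal + δ) ^ q))
        (nhdsWithin 0 (Set.Ioi 0)) (nhds (C * ENNReal.ofReal ((n.toReal + 0) ^ q))) := by
      refine ENNReal.Tendsto.const_mul (ENNReal.tendsto_ofReal ?_) (Or.inr ENNReal.coe_ne_top)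
      refine Filter.Tendsto.mono_left ?_ nhdsWithin_le_nhds
      exact ((continuous_const.add continuous_id).rpow_const fun _ => Or.inr hq.le).tendsto 0
    have h4 := ge_of_tendsto h3 (Filter.eventually_of_mem self_mem_nhdsWithin fun δ hδ => h1 δ hδ)
    rwa [add_zero, ENNReal.ofReal_rpow_of_nonneg ENNReal.toReal_nonneg hq.le |>.symm,
      ENNReal.ofReal_toReal hun.ne] at h4
  have h3 : eLpNorm u (ENNReal.ofReal q) ≤ (C ^ (1 / q) : ℝ≥0) * n := by
    rw [eLpNorm_ofReal_eq hq, ENNReal.coe_rpow_of_nonneg _ (by positivity)]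
    calc _ ≤ ((C : ℝ≥0∞) * n ^ q) ^ (1 / q) := by gcongr
      _ = _ := by
        rw [ENNReal.mul_rpow_of_nonneg _ _ (by positivity), ← ENNReal.rpow_mul,
          mul_one_div_cancel hq.ne', ENNReal.rpow_one]
  exact ⟨⟨hum, h3.trans_lt (ENNReal.mul_lt_top ENNReal.coe_lt_top hun)⟩, h3⟩

/-- A bound for normalized smooth functions gives a multiplicative inequality. -/
theorem NormalizedBound.exists_mul_le {α p q : ℝ} (hp : 1 ≤ p) (hq : 0 < q)
    {P : (EuclideanSpace ℝ (Fin N) → ℝ) → Prop} (h : NormalizedBound α p q P)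
    (hP : DilationInvariant P) (hΔ : N + α - p * ((N : ℝ) - 2) ≠ 0)
    (hθ0 : 0 ≤ interpolationExponent N α p q) (hθ1 : interpolationExponent N α p q ≤ 1) :
    ∃ S : ℝ, 0 < S ∧ ∀ u ∈ space N α p, (∀ ε > 0, P (mollify u ε)) →
      ENNReal.ofReal S * (∫⁻ x, ‖u x‖ₑ ^ q) ^ (1 / q) ≤
        dirichletEnergy u ^ (interpolationExponent N α p q / 2) *
          coulombEnergy α p u ^ ((1 - interpolationExponent N α p q) / (2 * p)) := by
  have hp0 : 0 < p := by linarith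
  obtain ⟨C, hC⟩ := h.exists_lintegral_le hp hq.le hP
  set s := interpolationExponent N α p q / 2 with hs
  set t := (1 - interpolationExponent N α p q) / (2 * p) with ht
  have hs0 : 0 ≤ s := by positivity
  have ht0 : 0 ≤ t := div_nonneg (by linarith) (by positivity)
  -- The added 1 makes K invertible even if C = 0, so that S = K⁻¹ is positive.
  set K : ℝ≥0 := C ^ (1 / q) + 1
  have hK : (0 : ℝ) < K := by positivity
  refine ⟨(K : ℝ)⁻¹, by positivity, fun u ⟨hum, hud, hun⟩ hPu => ?_⟩
  have hDt : dirichletEnergy u ≠ ⊤ :=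
    ne_top_of_le_ne_top (by finiteness) (dirichletEnergy_le_coulombSobolevNorm α p u)
  have hVt : coulombEnergy α p u ≠ ⊤ :=
    ne_top_of_le_ne_top (by finiteness) (coulombEnergy_le_coulombSobolevNorm α hp0 u)
  set D := dirichletEnergy u
  set V := coulombEnergy α p u
  -- Either energy may vanish, while the scaling requires positive values, hence the shifts by δ.
  have h1 : ∀ δ : ℝ, 0 < δ → (∫⁻ x, ‖u x‖ₑ ^ q) ^ (1 / q) ≤
      K * (ENNReal.ofReal (D.toReal + δ) ^ s * ENNReal.ofReal (V.toReal + δ) ^ t) := by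
    intro δ hδ
    have hDδ : 0 < D.toReal + δ := by positivity
    have hVδ : 0 < V.toReal + δ := by positivity
    obtain ⟨l, m, hl, hm, h1, h2, h3⟩ := exists_scaling hq hp0 hΔ hDδ hVδ
    have h4 := hC u hum hud hPu l m hl hm ?_ ?_
    · rw [h3] at h4
      calc _ ≤ (C * ENNReal.ofReal (((D.toReal + δ) ^ s * (V.toReal + δ) ^ t) ^ q)) ^ (1 / q) := by
            gcongr
        _ = (C : ℝ≥0∞) ^ (1 / q) *
            (ENNReal.ofReal (D.toReal + δ) ^ s * ENNReal.ofReal (V.toReal + δ) ^ t) := by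
            rw [ENNReal.mul_rpow_of_nonneg _ _ (by positivity),
              ENNReal.ofReal_rpow_of_nonneg (by positivity) (by positivity),
              ← Real.rpow_mul (by positivity), mul_one_div_cancel hq.ne', Real.rpow_one,
              ENNReal.ofReal_mul (by positivity), ENNReal.ofReal_rpow_of_pos hDδ,
              ENNReal.ofReal_rpow_of_pos hVδ]
        _ ≤ _ := by
            gcongr
            simp only [K]
            rw [ENNReal.coe_add, ENNReal.coe_rpow_of_nonneg _ (by positivity)]
            exact le_self_add
    · rw [h1]
      exact (ENNReal.ofReal_toReal hDt).symm.le.trans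
        (ENNReal.ofReal_le_ofReal (le_add_of_nonneg_right hδ.le))
    · rw [h2]
      exact (ENNReal.ofReal_toReal hVt).symm.le.trans
        (ENNReal.ofReal_le_ofReal (le_add_of_nonneg_right hδ.le))
  have h2 : (∫⁻ x, ‖u x‖ₑ ^ q) ^ (1 / q) ≤ K * (D ^ s * V ^ t) := by
    have hlim : ∀ (x : ℝ≥0∞) (a : ℝ), x ≠ ⊤ → Filter.Tendsto
        (fun δ : ℝ => ENNReal.ofReal (x.toReal + δ) ^ a) (nhdsWithin 0 (Set.Ioi 0))
        (nhds (x ^ a)) := by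
      intro x a hx
      refine (ENNReal.continuous_rpow_const.tendsto x).comp ?_
      refine Filter.Tendsto.mono_left ?_ nhdsWithin_le_nhds
      have := (ENNReal.continuous_ofReal.comp (continuous_const.add continuous_id)).tendsto
        (f := fun δ : ℝ => ENNReal.ofReal (x.toReal + δ)) 0
      rwa [add_zero, ENNReal.ofReal_toReal hx] at this
    refine ge_of_tendsto (ENNReal.Tendsto.const_mul (ENNReal.Tendsto.mul (hlim D s hDt)
      (Or.inr (by finiteness)) (hlim V t hVt) (Or.inr (by finiteness)))
      (Or.inr ENNReal.coe_ne_top)) (Filter.eventually_of_mem self_mem_nhdsWithin fun δ hδ => h1 δ hδ)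
  calc _ ≤ ENNReal.ofReal (K : ℝ)⁻¹ * (K * (D ^ s * V ^ t)) := by gcongr
    _ = D ^ s * V ^ t := by
      rw [← mul_assoc, ← ENNReal.ofReal_coe_nnreal, ← ENNReal.ofReal_mul (by positivity),
        inv_mul_cancel₀ hK.ne', ENNReal.ofReal_one, one_mul]


/-! ### Composition of Riesz kernels and the double-integral form of the energy. -/

theorem rieszKernel_eq (s : ℝ) : ∃ c : ℝ, ∀ x : EuclideanSpace ℝ (Fin N),
    rieszKernel s x = c * ‖x‖ ^ (-((N : ℝ) - s)) := by
  refine ⟨Real.Gamma (((N : ℝ) - s) / 2) /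
    (Real.Gamma (s / 2) * Real.pi ^ ((N : ℝ) / 2) * (2 : ℝ) ^ s), fun x => ?_⟩
  rw [rieszKernel, Real.rpow_neg (norm_nonneg _), div_eq_mul_inv]

/-- In polar coordinates the integrand is r^(α/2-1) d^(-(N-α/2)) below d, integrable since α > 0,
and r^(α-N-1) above d, integrable since α < N. -/
theorem exists_lintegral_rpow_mul_max_le {α : ℝ} (hα0 : 0 < α) (hαN : α < N) :
    ∃ C : ℝ≥0, ∀ d : ℝ, 0 < d → ∫⁻ x : EuclideanSpace ℝ (Fin N),
      ENNReal.ofReal (‖x‖ ^ (-((N : ℝ) - α / 2)) * max d ‖x‖ ^ (-((N : ℝ) - α / 2))) ≤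
        C * ENNReal.ofReal (d ^ (α - N)) := by
  have hN := pos_of_lt_natCast hα0 hαN
  set S := (volume : Measure (EuclideanSpace ℝ (Fin N))).toSphere Set.univ
  refine ⟨S.toNNReal * (1 / (α / 2) + 1 / (N - α)).toNNReal, fun d hd => ?_⟩
  rw [lintegral_radial_euclidean hN (f := fun r => ENNReal.ofReal (r ^ (-((N : ℝ) - α / 2)) *
    max d r ^ (-((N : ℝ) - α / 2)))) (by fun_prop), ENNReal.coe_mul,
    ENNReal.coe_toNNReal toSphere_univ_ne_top, mul_assoc]
  refine mul_le_mul_right ?_ _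
  have hs : Set.Ioi (0 : ℝ) ⊆ Set.Ioo 0 d ∪ Set.Ioi d ∪ {d} := by
    intro r hr
    rcases lt_trichotomy r d with h | h | h
    · exact Or.inl (Or.inl ⟨hr, h⟩)
    · exact Or.inr h
    · exact Or.inl (Or.inr h)
  refine (lintegral_mono_set hs).trans ((lintegral_union_le _ _ _).trans ?_)
  rw [Measure.restrict_singleton, Real.volume_singleton, zero_smul, lintegral_zero_measure,
    add_zero]
  have h1 : ∫⁻ r in Set.Ioo 0 d, ENNReal.ofReal (r ^ ((N : ℝ) - 1)) *
      ENNReal.ofReal (r ^ (-((N : ℝ) - α / 2)) * max d r ^ (-((N : ℝ) - α / 2))) =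
      ENNReal.ofReal (d ^ (-((N : ℝ) - α / 2))) *
        ENNReal.ofReal (d ^ (α / 2 - 1 + 1) / (α / 2 - 1 + 1)) := by
    rw [← lintegral_Ioo_rpow (by linarith) hd.le, ← lintegral_const_mul' _ _ ENNReal.ofReal_ne_top]
    refine setLIntegral_congr_fun measurableSet_Ioo fun r hr => ?_
    rw [max_eq_left hr.2.le, ← ENNReal.ofReal_mul (Real.rpow_nonneg hr.1.le _),
      ← ENNReal.ofReal_mul (Real.rpow_nonneg hd.le _), ← mul_assoc, ← Real.rpow_add hr.1, mul_comm]
    ring_nf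
  have h2 : ∫⁻ r in Set.Ioi d, ENNReal.ofReal (r ^ ((N : ℝ) - 1)) *
      ENNReal.ofReal (r ^ (-((N : ℝ) - α / 2)) * max d r ^ (-((N : ℝ) - α / 2))) =
        ENNReal.ofReal (d ^ (α - N - 1 + 1) / (-(α - N - 1 + 1))) := by
    rw [← lintegral_Ioi_rpow (by linarith) hd]
    refine setLIntegral_congr_fun measurableSet_Ioi fun r hr => ?_
    have hr0 : 0 < r := hd.trans hr
    rw [max_eq_right (le_of_lt hr), ← ENNReal.ofReal_mul (Real.rpow_nonneg hr0.le _),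
      ← Real.rpow_add hr0, ← Real.rpow_add hr0]
    ring_nf
  refine (lintegral_union_le _ _ _).trans ?_
  have hα2 : 0 ≤ 1 / (α / 2) := by positivity
  have hNα : 0 ≤ 1 / (N - α) := one_div_nonneg.2 (by linarith)
  rw [h1, h2, ENNReal.ofNNReal_toNNReal, ← ENNReal.ofReal_mul (by positivity),
    ← ENNReal.ofReal_mul (by positivity), ← ENNReal.ofReal_add (by ring_nf; positivity)
    (div_nonneg (by positivity) (by linarith))]
  refine ENNReal.ofReal_le_ofReal (le_of_eq ?_)
  rw [← mul_div_assoc, ← Real.rpow_add hd, show -((N : ℝ) - α / 2) + (α / 2 - 1 + 1) = α - N by ring,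
    show α - (N : ℝ) - 1 + 1 = α - N by ring, show α / 2 - 1 + 1 = α / 2 by ring, neg_sub]
  ring

/-- The upper half of the semigroup property, up to a constant. If x is nearer to y, then |x-z| is
at least |x-y| and at least half of |y-z|, so the product of kernels is dominated by the integrand
of `exists_lintegral_rpow_mul_max_le` centred at y. -/
theorem exists_lintegral_rieszKernel_mul_le {α : ℝ} (hα0 : 0 < α) (hαN : α < N) :
    ∃ C : ℝ≥0, ∀ y z : EuclideanSpace ℝ (Fin N), y ≠ z →
      ∫⁻ x, ENNReal.ofReal (rieszKernel (α / 2) (x - y)) *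
        ENNReal.ofReal (rieszKernel (α / 2) (x - z)) ≤
          C * ENNReal.ofReal (‖y - z‖ ^ (α - N)) := by
  obtain ⟨C, hC⟩ := exists_lintegral_rpow_mul_max_le hα0 hαN
  obtain ⟨c, hc⟩ := rieszKernel_eq (N := N) (α / 2)
  set a := (N : ℝ) - α / 2 with ha
  have ha0 : 0 < a := by rw [ha]; linarith
  refine ⟨2 * c.toNNReal ^ 2 * C * (2 ^ ((N : ℝ) - α)), fun y z hyz => ?_⟩
  have hd : 0 < ‖y - z‖ / 2 := half_pos (norm_pos_iff.2 (sub_ne_zero.2 hyz))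
  set d := ‖y - z‖ / 2 with hdd
  set h : EuclideanSpace ℝ (Fin N) → ℝ≥0∞ :=
    fun w => ENNReal.ofReal (‖w‖ ^ (-a) * max d ‖w‖ ^ (-a))
  have hhm : Measurable h := by fun_prop
  have key : ∀ v w : EuclideanSpace ℝ (Fin N), ‖v‖ ≤ ‖w‖ → 2 * d ≤ ‖v‖ + ‖w‖ →
      ENNReal.ofReal (‖v‖ ^ (-a)) * ENNReal.ofReal (‖w‖ ^ (-a)) ≤ h v := by
    intro v w hvw hdvw
    rw [← ENNReal.ofReal_mul (by positivity)]
    refine ENNReal.ofReal_le_ofReal (mul_le_mul_of_nonneg_left ?_ (by positivity))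
    exact Real.rpow_le_rpow_of_nonpos (lt_max_of_lt_left hd) (max_le (by linarith) hvw)
      (by linarith)
  have hpt : ∀ x, ENNReal.ofReal (rieszKernel (α / 2) (x - y)) *
      ENNReal.ofReal (rieszKernel (α / 2) (x - z)) ≤
        ENNReal.ofReal c ^ 2 * (h (x - y) + h (x - z)) := by
    intro x
    have h1 : 2 * d ≤ ‖x - y‖ + ‖x - z‖ := by
      have := norm_sub_le (x - z) (x - y)
      rw [sub_sub_sub_cancel_left] at this
      linarith
    rw [hc, hc, ENNReal.ofReal_mul' (by positivity), ENNReal.ofReal_mul' (by positivity)]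
    calc _ = ENNReal.ofReal c ^ 2 *
          (ENNReal.ofReal (‖x - y‖ ^ (-a)) * ENNReal.ofReal (‖x - z‖ ^ (-a))) := by ring
      _ ≤ _ := by
        refine mul_le_mul_right ?_ _
        rcases le_total ‖x - y‖ ‖x - z‖ with h2 | h2
        · exact (key _ _ h2 h1).trans le_self_add
        · rw [mul_comm]
          exact (key _ _ h2 (by linarith)).trans le_add_self
  calc _ ≤ ∫⁻ x, ENNReal.ofReal c ^ 2 * (h (x - y) + h (x - z)) := lintegral_mono hpt
    _ = ENNReal.ofReal c ^ 2 * ((∫⁻ x, h x) + ∫⁻ x, h x) := by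
        rw [lintegral_const_mul _ (by fun_prop), lintegral_add_left (by fun_prop),
          lintegral_sub_right_eq_self, lintegral_sub_right_eq_self]
    _ ≤ ENNReal.ofReal c ^ 2 * (C * ENNReal.ofReal (d ^ (α - N)) +
          C * ENNReal.ofReal (d ^ (α - N))) := by
        exact mul_le_mul_right (add_le_add (hC d hd) (hC d hd)) _
    _ = _ := by
        rw [hdd, Real.div_rpow (norm_nonneg _) (by norm_num), div_eq_mul_inv,
          ← Real.rpow_neg (by norm_num), neg_sub, ENNReal.ofReal_mul (by positivity)]
        push_cast
        rw [ENNReal.ofReal, ← ENNReal.ofReal_coe_nnreal (p := 2 ^ ((N : ℝ) - α)), NNReal.coe_rpow,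
          NNReal.coe_ofNat]
        ring

theorem exists_coulombEnergy_le {α : ℝ} (hα0 : 0 < α) (hαN : α < N) :
    ∃ C : ℝ≥0, ∀ (p : ℝ) (u : EuclideanSpace ℝ (Fin N) → ℝ), Measurable u →
      coulombEnergy α p u ≤ C * ∫⁻ y, ∫⁻ z, ENNReal.ofReal (|u y| ^ p) *
        ENNReal.ofReal (|u z| ^ p) * ENNReal.ofReal (‖y - z‖ ^ (α - N)) := by
  have := nontrivial_euclideanSpace (pos_of_lt_natCast hα0 hαN)
  obtain ⟨C, hC⟩ := exists_lintegral_rieszKernel_mul_le hα0 hαN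
  refine ⟨C, fun p u hu => ?_⟩
  have hK := measurable_rieszKernel (N := N) (α / 2)
  set k : EuclideanSpace ℝ (Fin N) → ℝ≥0∞ := fun x => ENNReal.ofReal (rieszKernel (α / 2) x)
  have hk : Measurable k := by fun_prop
  set f : EuclideanSpace ℝ (Fin N) → ℝ≥0∞ := fun x => ENNReal.ofReal (|u x| ^ p)
  have hf : Measurable f := by fun_prop
  have h1 : ∀ x, rieszPotential α p u x ^ 2 = ∫⁻ y, ∫⁻ z, f y * f z * (k (x - y) * k (x - z)) := by
    intro x
    have h2 : rieszPotential α p u x = ∫⁻ y, k (x - y) * f y := rfl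
    rw [h2, sq, ← lintegral_mul_const _ (by fun_prop)]
    refine lintegral_congr fun y => ?_
    rw [← lintegral_const_mul _ (by fun_prop)]
    refine lintegral_congr fun z => ?_
    ring
  calc coulombEnergy α p u = ∫⁻ x, ∫⁻ y, ∫⁻ z, f y * f z * (k (x - y) * k (x - z)) :=
        lintegral_congr h1
    _ = ∫⁻ y, ∫⁻ x, ∫⁻ z, f y * f z * (k (x - y) * k (x - z)) := by
        refine lintegral_lintegral_swap (Measurable.aemeasurable ?_)
        exact Measurable.lintegral_prod_right' (f := fun q : (EuclideanSpace ℝ (Fin N) ×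
          EuclideanSpace ℝ (Fin N)) × EuclideanSpace ℝ (Fin N) =>
            f q.1.2 * f q.2 * (k (q.1.1 - q.1.2) * k (q.1.1 - q.2))) (by fun_prop)
    _ = ∫⁻ y, ∫⁻ z, ∫⁻ x, f y * f z * (k (x - y) * k (x - z)) := by
        refine lintegral_congr fun y => lintegral_lintegral_swap (Measurable.aemeasurable ?_)
        unfold Function.uncurry
        fun_prop
    _ ≤ ∫⁻ y, C * ∫⁻ z, f y * f z * ENNReal.ofReal (‖y - z‖ ^ (α - N)) := by
        refine lintegral_mono fun y => ?_
        rw [← lintegral_const_mul _ (by fun_prop)]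
        refine lintegral_mono_ae ?_
        have hne : ∀ᵐ z, z ≠ y := by simp [ae_iff]
        filter_upwards [hne] with z hz
        rw [lintegral_const_mul _ (by fun_prop)]
        calc _ ≤ f y * f z * (C * ENNReal.ofReal (‖y - z‖ ^ (α - N))) :=
              mul_le_mul_right (hC y z hz.symm) _
          _ = _ := by ring
    _ = _ := by
        refine lintegral_const_mul _ ?_
        exact Measurable.lintegral_prod_right' (f := fun q : EuclideanSpace ℝ (Fin N) ×
          EuclideanSpace ℝ (Fin N) => f q.1 * f q.2 * ENNReal.ofReal (‖q.1 - q.2‖ ^ (α - N)))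
            (by fun_prop)


/-! ### Volumes and Riesz energies of annuli. -/

/-- The closed annulus of radius `R` and half-width `w`. -/
def annulus (N : ℕ) (R w : ℝ) : Set (EuclideanSpace ℝ (Fin N)) := {x | |‖x‖ - R| ≤ w}

theorem measurableSet_annulus (R w : ℝ) : MeasurableSet (annulus N R w) :=
  (isClosed_le (by fun_prop) continuous_const).measurableSet

theorem volume_annulus (hN : 0 < N) (R w : ℝ) : volume (annulus N R w) =
    (volume : Measure (EuclideanSpace ℝ (Fin N))).toSphere Set.univ *
      ∫⁻ r in Set.Ioi (0 : ℝ), ENNReal.ofReal (r ^ ((N : ℝ) - 1)) *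
        (Set.Icc (R - w) (R + w)).indicator 1 r := by
  rw [← lintegral_radial_euclidean hN (f := (Set.Icc (R - w) (R + w)).indicator 1)
    (measurable_one.indicator measurableSet_Icc), ← lintegral_indicator_one
      (measurableSet_annulus R w)]
  refine lintegral_congr fun x => ?_
  have : x ∈ annulus N R w ↔ ‖x‖ ∈ Set.Icc (R - w) (R + w) := by
    rw [annulus, Set.mem_ofPred_eq, abs_le, Set.mem_Icc]
    constructor <;> rintro ⟨h1, h2⟩ <;> constructor <;> linarith
  by_cases h : x ∈ annulus N R w
  · rw [Set.indicator_of_mem h, Set.indicator_of_mem (this.1 h)]; rfl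
  · rw [Set.indicator_of_notMem h, Set.indicator_of_notMem (fun h' => h (this.2 h'))]

theorem lintegral_Icc_rpow_le (hN : 0 < N) {R w : ℝ} (hw : 0 < w) (hwR : w ≤ R) (c : ℝ≥0∞) :
    ∫⁻ r in Set.Ioi (0 : ℝ), ENNReal.ofReal (r ^ ((N : ℝ) - 1)) *
      (Set.Icc (R - w) (R + w)).indicator (fun _ => c) r ≤
        ENNReal.ofReal (2 ^ (N : ℝ) * (R ^ ((N : ℝ) - 1) * w)) * c := by
  have hN1 : (1 : ℝ) ≤ N := by exact_mod_cast hN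
  have hR : 0 < R := hw.trans_le hwR
  calc _ ≤ ∫⁻ r in Set.Ioi (0 : ℝ), (Set.Icc (R - w) (R + w)).indicator
        (fun _ => ENNReal.ofReal ((2 * R) ^ ((N : ℝ) - 1)) * c) r := by
        refine setLIntegral_mono' measurableSet_Ioi fun r hr => ?_
        by_cases h : r ∈ Set.Icc (R - w) (R + w)
        · rw [Set.indicator_of_mem h, Set.indicator_of_mem h]
          refine mul_le_mul_left (ENNReal.ofReal_le_ofReal ?_) _
          exact Real.rpow_le_rpow (le_of_lt hr) (by linarith [h.2]) (by linarith)
        · rw [Set.indicator_of_notMem h, Set.indicator_of_notMem h, mul_zero]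
    _ ≤ ∫⁻ r, (Set.Icc (R - w) (R + w)).indicator
        (fun _ => ENNReal.ofReal ((2 * R) ^ ((N : ℝ) - 1)) * c) r := setLIntegral_le_lintegral _ _
    _ = ENNReal.ofReal ((2 * R) ^ ((N : ℝ) - 1)) * c * ENNReal.ofReal (2 * w) := by
        rw [lintegral_indicator_const measurableSet_Icc, Real.volume_Icc]
        ring_nf
    _ = _ := by
        rw [mul_right_comm, ← ENNReal.ofReal_mul (by positivity), Real.mul_rpow (by norm_num) hR.le]
        congr 2
        have : (2 : ℝ) ^ (N : ℝ) = 2 ^ ((N : ℝ) - 1) * 2 := by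
          rw [← Real.rpow_add_one (by norm_num), sub_add_cancel]
        rw [this]
        ring

theorem exists_volume_annulus_le (hN : 0 < N) : ∃ C : ℝ≥0, ∀ R w : ℝ, 0 < w → w ≤ R →
    volume (annulus N R w) ≤ C * ENNReal.ofReal (R ^ ((N : ℝ) - 1) * w) := by
  refine ⟨((volume : Measure (EuclideanSpace ℝ (Fin N))).toSphere Set.univ).toNNReal *
    2 ^ (N : ℝ), fun R w hw hwR => ?_⟩
  rw [volume_annulus hN, ENNReal.coe_mul, ENNReal.coe_toNNReal toSphere_univ_ne_top, mul_assoc]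
  refine mul_le_mul_right ((lintegral_Icc_rpow_le hN hw hwR 1).trans (le_of_eq ?_)) _
  rw [mul_one, ENNReal.ofReal_mul (by positivity), ← ENNReal.ofReal_coe_nnreal, NNReal.coe_rpow,
    NNReal.coe_ofNat]

theorem exists_le_volume_annulus (hN : 0 < N) : ∃ c : ℝ, 0 < c ∧ ∀ R w : ℝ, 0 < w → 0 < R →
    ENNReal.ofReal (c * (R ^ ((N : ℝ) - 1) * w)) ≤ volume (annulus N R w) := by
  have hN1 : (1 : ℝ) ≤ N := by exact_mod_cast hN
  refine ⟨((volume : Measure (EuclideanSpace ℝ (Fin N))).toSphere Set.univ).toReal,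
    ENNReal.toReal_pos (toSphere_univ_ne_zero hN) toSphere_univ_ne_top, fun R w hw hR => ?_⟩
  rw [volume_annulus hN, ENNReal.ofReal_mul ENNReal.toReal_nonneg,
    ENNReal.ofReal_toReal toSphere_univ_ne_top]
  refine mul_le_mul_right ?_ _
  calc _ = ∫⁻ _ in Set.Icc R (R + w), ENNReal.ofReal (R ^ ((N : ℝ) - 1)) := by
        rw [setLIntegral_const, Real.volume_Icc, add_sub_cancel_left,
          ENNReal.ofReal_mul (by positivity)]
    _ ≤ ∫⁻ r in Set.Icc R (R + w), ENNReal.ofReal (r ^ ((N : ℝ) - 1)) *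
        (Set.Icc (R - w) (R + w)).indicator 1 r := by
        refine setLIntegral_mono' measurableSet_Icc fun r hr => ?_
        rw [Set.indicator_of_mem (show r ∈ Set.Icc (R - w) (R + w) from
          ⟨by linarith [hr.1], hr.2⟩), Pi.one_apply, mul_one]
        exact ENNReal.ofReal_le_ofReal (Real.rpow_le_rpow hR.le hr.1 (by linarith))
    _ ≤ _ := lintegral_mono_set fun r hr => hR.trans_le hr.1

theorem lintegral_polar_euclidean (hN : 0 < N) {f : EuclideanSpace ℝ (Fin N) → ℝ≥0∞}
    (hf : Measurable f) : ∫⁻ x, f x =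
      ∫⁻ σ : Metric.sphere (0 : EuclideanSpace ℝ (Fin N)) 1, (∫⁻ r in Set.Ioi (0 : ℝ),
        ENNReal.ofReal (r ^ ((N : ℝ) - 1)) * f (r • (σ : EuclideanSpace ℝ (Fin N))))
          ∂volume.toSphere := by
  have := nontrivial_euclideanSpace hN
  rw [lintegral_polar volume hf]
  refine lintegral_congr fun σ => setLIntegral_congr_fun measurableSet_Ioi fun r _ => ?_
  rw [pow_pred_eq_rpow _ (by rw [finrank_euclideanSpace_fin]; exact hN.ne'),
    finrank_euclideanSpace_fin]

/-- The surface integral is dominated by a volume integral with one more power. With t = |σ-e|, the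
points rσ with 1 < r < 1+t lie within 2t ≤ 4 of e, and this segment of length t contributes at least
a multiple of t · t^(-(b+1)). The ball of radius 5 around e contains all these points. -/
theorem exists_lintegral_sphere_rpow_le {b : ℝ} (hb0 : 0 < b) (hbN : b + 1 < N) :
    ∃ K : ℝ≥0, ∀ e : EuclideanSpace ℝ (Fin N), ‖e‖ = 1 →
      ∫⁻ σ : Metric.sphere (0 : EuclideanSpace ℝ (Fin N)) 1,
        ENNReal.ofReal (‖(σ : EuclideanSpace ℝ (Fin N)) - e‖ ^ (-b)) ∂volume.toSphere ≤ K := by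
  have hN : 0 < N := by
    have : (0 : ℝ) < N := by linarith
    exact_mod_cast this
  have hN1 : (1 : ℝ) ≤ N := by exact_mod_cast hN
  have := nontrivial_euclideanSpace hN
  have hfin := lintegral_ball_rpow_lt_top (volume : Measure (EuclideanSpace ℝ (Fin N)))
    (γ := b + 1) (R := 5) (by rwa [finrank_euclideanSpace_fin])
  set I := ∫⁻ x in Metric.ball (0 : EuclideanSpace ℝ (Fin N)) 5, ENNReal.ofReal (‖x‖ ^ (-(b + 1)))
  refine ⟨(ENNReal.ofReal (2 ^ (b + 1)) * I).toNNReal, fun e he => ?_⟩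
  rw [ENNReal.coe_toNNReal (by finiteness)]
  set g : EuclideanSpace ℝ (Fin N) → ℝ≥0∞ := (Metric.ball e 5).indicator
    fun y => ENNReal.ofReal (‖y - e‖ ^ (-(b + 1))) with hg
  have hgm : Measurable g := Measurable.indicator (by fun_prop) measurableSet_ball
  have hI : ∫⁻ y, g y = I := by
    simp only [I]
    rw [← lintegral_indicator measurableSet_ball, ← lintegral_add_right_eq_self g e]
    refine lintegral_congr fun x => ?_
    rw [hg]
    by_cases h : x ∈ Metric.ball (0 : EuclideanSpace ℝ (Fin N)) 5
    · rw [Set.indicator_of_mem h, Set.indicator_of_mem (by simpa [dist_eq_norm] using h),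
        add_sub_cancel_right]
    · rw [Set.indicator_of_notMem h, Set.indicator_of_notMem (by simpa [dist_eq_norm] using h)]
  rw [← hI, lintegral_polar_euclidean hN hgm, ← lintegral_const_mul' _ _ ENNReal.ofReal_ne_top]
  refine lintegral_mono fun σ => ?_
  set t := ‖(σ : EuclideanSpace ℝ (Fin N)) - e‖ with ht
  have hσ : ‖(σ : EuclideanSpace ℝ (Fin N))‖ = 1 := by simp
  have ht2 : t ≤ 2 := by
    have := norm_sub_le (σ : EuclideanSpace ℝ (Fin N)) e
    rw [hσ, he] at this
    linarith
  -- At σ = e the integrand has the default value 0, since 0 raised to a nonzero real power is 0.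
  rcases (norm_nonneg ((σ : EuclideanSpace ℝ (Fin N)) - e)).eq_or_lt with h0 | h0
  · simp only
    rw [ht, ← h0, Real.zero_rpow (by linarith), ENNReal.ofReal_zero]
    exact zero_le
  rw [← ht] at h0
  calc ENNReal.ofReal (t ^ (-b)) = ENNReal.ofReal (2 ^ (b + 1)) *
        ∫⁻ _ in Set.Ioo 1 (1 + t), ENNReal.ofReal ((2 * t) ^ (-(b + 1))) := by
        rw [setLIntegral_const, Real.volume_Ioo, add_sub_cancel_left,
          ← ENNReal.ofReal_mul (by positivity), ← ENNReal.ofReal_mul (by positivity)]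
        congr 1
        rw [Real.mul_rpow (by norm_num) h0.le, ← mul_assoc, ← mul_assoc, ← Real.rpow_add (by norm_num),
          add_neg_cancel, Real.rpow_zero, one_mul, ← Real.rpow_add_one h0.ne']
        ring_nf
    _ ≤ ENNReal.ofReal (2 ^ (b + 1)) * ∫⁻ r in Set.Ioo 1 (1 + t),
        ENNReal.ofReal (r ^ ((N : ℝ) - 1)) * g (r • (σ : EuclideanSpace ℝ (Fin N))) := by
        refine mul_le_mul_right (setLIntegral_mono' measurableSet_Ioo fun r hr => ?_) _
        have h1 : ‖r • (σ : EuclideanSpace ℝ (Fin N)) - e‖ ≤ 2 * t := by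
          have h2 : r • (σ : EuclideanSpace ℝ (Fin N)) - e = (r - 1) • (σ : EuclideanSpace ℝ (Fin N))
            + (σ - e) := by rw [sub_smul, one_smul]; abel
          rw [h2]
          refine (norm_add_le _ _).trans ?_
          rw [norm_smul, hσ, mul_one, Real.norm_of_nonneg (by linarith [hr.1])]
          linarith [hr.2]
        have h3 : 0 < ‖r • (σ : EuclideanSpace ℝ (Fin N)) - e‖ := by
          have := norm_sub_norm_le (r • (σ : EuclideanSpace ℝ (Fin N))) e
          rw [norm_smul, hσ, he, mul_one, Real.norm_of_nonneg (by linarith [hr.1])] at this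
          linarith [hr.1]
        have hdim : 1 ≤ ENNReal.ofReal (r ^ ((N : ℝ) - 1)) := by
          rw [← ENNReal.ofReal_one]
          exact ENNReal.ofReal_le_ofReal (Real.one_le_rpow hr.1.le (by linarith))
        rw [hg, Set.indicator_of_mem (by rw [Metric.mem_ball, dist_eq_norm]; linarith [hr.1, hr.2])]
        refine le_mul_of_one_le_of_le hdim (ENNReal.ofReal_le_ofReal ?_)
        exact Real.rpow_le_rpow_of_nonpos h3 h1 (by linarith)
    _ ≤ _ := mul_le_mul_right (lintegral_mono_set fun r hr => one_pos.trans hr.1) _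

theorem ae_toSphere_ne (hN : 1 < N) (e : EuclideanSpace ℝ (Fin N)) :
    ∀ᵐ σ : Metric.sphere (0 : EuclideanSpace ℝ (Fin N)) 1 ∂volume.toSphere,
      (σ : EuclideanSpace ℝ (Fin N)) ≠ e := by
  rw [ae_iff]
  simp only [ne_eq, not_not]
  have hm : MeasurableSet {σ : Metric.sphere (0 : EuclideanSpace ℝ (Fin N)) 1 |
      (σ : EuclideanSpace ℝ (Fin N)) = e} := measurable_subtype_coe (measurableSet_singleton e)
  rw [Measure.toSphere_apply' _ hm]
  refine mul_eq_zero_of_right _ (measure_mono_null (t := (ℝ ∙ e : Submodule ℝ _)) ?_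
    (Measure.addHaar_submodule _ _ ?_))
  · rintro _ ⟨r, _, _, ⟨σ, hσ, rfl⟩, rfl⟩
    have hσ' : (σ : EuclideanSpace ℝ (Fin N)) = e := hσ
    simp only [hσ']
    exact Submodule.smul_mem _ _ (Submodule.mem_span_singleton_self e)
  · intro h
    have h1 := finrank_span_le_card (R := ℝ) ({e} : Set (EuclideanSpace ℝ (Fin N)))
    rw [h, finrank_top, finrank_euclideanSpace_fin, Set.toFinset_singleton,
      Finset.card_singleton] at h1
    omega

/-- With x = ρe and ρ ≥ R/2, the triangle inequality gives |x-rσ| ≥ (R/4)|σ-e|, so the kernel is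
bounded independently of r. Radial integration yields R^(N-1) w, and the spherical integral of
|σ-e|^(-(N-β)) converges because β > 1. -/
theorem exists_lintegral_annulus_le_of_lt {β : ℝ} (hβ1 : 1 < β) (hβN : β < N) :
    ∃ C : ℝ≥0, ∀ R w : ℝ, 0 < w → w ≤ R / 2 → ∀ x ∈ annulus N R w,
      ∫⁻ y in annulus N R w, ENNReal.ofReal (‖x - y‖ ^ (β - N)) ≤
        C * ENNReal.ofReal (w * R ^ (β - 1)) := by
  have hN1 : 1 < N := by exact_mod_cast hβ1.trans hβN
  have hN : 0 < N := by omega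
  have := nontrivial_euclideanSpace hN
  obtain ⟨K, hK⟩ := exists_lintegral_sphere_rpow_le (N := N) (b := N - β) (by linarith)
    (by linarith)
  refine ⟨K * (2 ^ (N : ℝ) * 4 ^ (N - β)), fun R w hw hwR x hx => ?_⟩
  have hR : 0 < R := by linarith
  obtain ⟨e, he, hxe⟩ := exists_norm_smul_eq x
  have hρ : R / 2 ≤ ‖x‖ := by
    have := (abs_le.1 (show |‖x‖ - R| ≤ w from hx)).1
    linarith
  set ρ := ‖x‖
  have hpt : ∀ σ : Metric.sphere (0 : EuclideanSpace ℝ (Fin N)) 1,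
      (σ : EuclideanSpace ℝ (Fin N)) ≠ e → ∀ r : ℝ, 0 < r →
      ENNReal.ofReal (‖x - r • (σ : EuclideanSpace ℝ (Fin N))‖ ^ (β - N)) ≤
        ENNReal.ofReal ((R / 4) ^ (β - N)) *
          ENNReal.ofReal (‖(σ : EuclideanSpace ℝ (Fin N)) - e‖ ^ (-(N - β))) := by
    intro σ hσe r hr
    have hσ : ‖(σ : EuclideanSpace ℝ (Fin N))‖ = 1 := by simp
    have h0 : 0 < ‖(σ : EuclideanSpace ℝ (Fin N)) - e‖ := norm_pos_iff.2 (sub_ne_zero.2 hσe)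
    rw [← ENNReal.ofReal_mul (by positivity), neg_sub, ← Real.mul_rpow (by positivity) h0.le]
    refine ENNReal.ofReal_le_ofReal (Real.rpow_le_rpow_of_nonpos (by positivity) ?_ (by linarith))
    have h1 : ρ * ‖(σ : EuclideanSpace ℝ (Fin N)) - e‖ =
        ‖(r - ρ) • (σ : EuclideanSpace ℝ (Fin N)) + (x - r • (σ : EuclideanSpace ℝ (Fin N)))‖ := by
      have h2 : (r - ρ) • (σ : EuclideanSpace ℝ (Fin N)) + (x - r • (σ : EuclideanSpace ℝ (Fin N))) =
          ρ • (e - σ) := by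
        rw [← hxe]
        module
      rw [h2, norm_smul, norm_sub_rev, Real.norm_of_nonneg (norm_nonneg x)]
    have h3 : |r - ρ| ≤ ‖x - r • (σ : EuclideanSpace ℝ (Fin N))‖ := by
      have := abs_norm_sub_norm_le x (r • (σ : EuclideanSpace ℝ (Fin N)))
      rwa [norm_smul, hσ, mul_one, Real.norm_of_nonneg hr.le, abs_sub_comm] at this
    have h4 := norm_add_le ((r - ρ) • (σ : EuclideanSpace ℝ (Fin N)))
      (x - r • (σ : EuclideanSpace ℝ (Fin N)))
    rw [← h1, norm_smul, hσ, mul_one, Real.norm_eq_abs] at h4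
    have h5 : R / 2 * ‖(σ : EuclideanSpace ℝ (Fin N)) - e‖ ≤
      ρ * ‖(σ : EuclideanSpace ℝ (Fin N)) - e‖ := by gcongr
    linarith
  set c := ENNReal.ofReal ((R / 4) ^ (β - N))
  rw [← lintegral_indicator (measurableSet_annulus R w), lintegral_polar_euclidean hN
    (Measurable.indicator (by fun_prop) (measurableSet_annulus R w))]
  calc _ ≤ ∫⁻ σ : Metric.sphere (0 : EuclideanSpace ℝ (Fin N)) 1,
        ENNReal.ofReal (2 ^ (N : ℝ) * (R ^ ((N : ℝ) - 1) * w)) *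
          (c * ENNReal.ofReal (‖(σ : EuclideanSpace ℝ (Fin N)) - e‖ ^ (-(N - β))))
          ∂volume.toSphere := by
        refine lintegral_mono_ae ?_
        filter_upwards [ae_toSphere_ne hN1 e] with σ hσe
        refine le_trans (setLIntegral_mono' measurableSet_Ioi fun r hr => ?_)
          (lintegral_Icc_rpow_le hN hw (by linarith) _)
        have hr0 : (0 : ℝ) < r := hr
        have hnorm : ‖r • (σ : EuclideanSpace ℝ (Fin N))‖ = r := by
          rw [norm_smul, norm_eq_of_mem_sphere, mul_one, Real.norm_of_nonneg hr0.le]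
        refine mul_le_mul_right ?_ _
        by_cases h : r • (σ : EuclideanSpace ℝ (Fin N)) ∈ annulus N R w
        · rw [Set.indicator_of_mem h, Set.indicator_of_mem]
          · exact hpt σ hσe r hr0
          · have h' : |‖r • (σ : EuclideanSpace ℝ (Fin N))‖ - R| ≤ w := h
            rw [hnorm, abs_le] at h'
            exact ⟨by linarith, by linarith⟩
        · rw [Set.indicator_of_notMem h]
          exact zero_le
    _ = ENNReal.ofReal (2 ^ (N : ℝ) * (R ^ ((N : ℝ) - 1) * w)) * (c *
          ∫⁻ σ : Metric.sphere (0 : EuclideanSpace ℝ (Fin N)) 1,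
            ENNReal.ofReal (‖(σ : EuclideanSpace ℝ (Fin N)) - e‖ ^ (-(N - β)))
              ∂volume.toSphere) := by
        rw [lintegral_const_mul' _ _ ENNReal.ofReal_ne_top,
          lintegral_const_mul' _ _ ENNReal.ofReal_ne_top]
    _ ≤ ENNReal.ofReal (2 ^ (N : ℝ) * (R ^ ((N : ℝ) - 1) * w)) * (c * K) :=
        mul_le_mul_right (mul_le_mul_right (hK e he) _) _
    _ = _ := by
        have h1 : ENNReal.ofReal (2 ^ (N : ℝ) * (R ^ ((N : ℝ) - 1) * w)) * c =
            ENNReal.ofReal (2 ^ (N : ℝ) * 4 ^ (N - β)) * ENNReal.ofReal (w * R ^ (β - 1)) := by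
          rw [← ENNReal.ofReal_mul (by positivity), ← ENNReal.ofReal_mul (by positivity),
            Real.div_rpow hR.le (by norm_num), div_eq_mul_inv, ← Real.rpow_neg (by norm_num),
            neg_sub, show β - 1 = ((N : ℝ) - 1) + (β - N) by ring, Real.rpow_add hR]
          ring_nf
        rw [← mul_assoc, h1, ENNReal.coe_mul, ← ENNReal.ofReal_coe_nnreal
          (p := 2 ^ (N : ℝ) * 4 ^ (N - β))]
        push_cast
        ring

/-- The mass-type bound for the Riesz kernel of order `β` on annuli, for `1 < β < N` or `β = N`. -/
theorem exists_lintegral_annulus_le {β : ℝ} (hN : 0 < N) (hβ : (1 < β ∧ β < N) ∨ β = N) :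
    ∃ C : ℝ≥0, ∀ R w : ℝ, 0 < w → w ≤ R / 2 → ∀ x ∈ annulus N R w,
      ∫⁻ y in annulus N R w, ENNReal.ofReal (‖x - y‖ ^ (β - N)) ≤
        C * ENNReal.ofReal (w * R ^ (β - 1)) := by
  rcases hβ with ⟨h1, h2⟩ | rfl
  · exact exists_lintegral_annulus_le_of_lt h1 h2
  · obtain ⟨C, hC⟩ := exists_volume_annulus_le hN
    refine ⟨C, fun R w hw hwR x _ => ?_⟩
    simp only [sub_self, Real.rpow_zero, ENNReal.ofReal_one, lintegral_const,
      Measure.restrict_apply_univ, one_mul]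
    rw [mul_comm w]
    exact hC R w hw (by linarith)

theorem exists_annulus_energy_le {β : ℝ} (hN : 0 < N) (hβ : (1 < β ∧ β < N) ∨ β = N) :
    ∃ C : ℝ≥0, ∀ R w : ℝ, 0 < w → w ≤ R / 2 →
      ∫⁻ x in annulus N R w, ∫⁻ y in annulus N R w, ENNReal.ofReal (‖x - y‖ ^ (β - N)) ≤
        C * ENNReal.ofReal (w ^ 2 * R ^ (N + β - 2)) := by
  obtain ⟨C, hC⟩ := exists_lintegral_annulus_le hN hβ
  obtain ⟨C', hC'⟩ := exists_volume_annulus_le hN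
  refine ⟨C * C', fun R w hw hwR => ?_⟩
  have hR : 0 < R := by linarith
  calc _ ≤ ∫⁻ x in annulus N R w, C * ENNReal.ofReal (w * R ^ (β - 1)) :=
        setLIntegral_mono' (measurableSet_annulus R w) fun x hx => hC R w hw hwR x hx
    _ ≤ C * ENNReal.ofReal (w * R ^ (β - 1)) * (C' * ENNReal.ofReal (R ^ ((N : ℝ) - 1) * w)) := by
        rw [setLIntegral_const]
        exact mul_le_mul_right (hC' R w hw (by linarith)) _
    _ = _ := by
        have h1 : ENNReal.ofReal (w * R ^ (β - 1)) * ENNReal.ofReal (R ^ ((N : ℝ) - 1) * w) =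
            ENNReal.ofReal (w ^ 2 * R ^ (N + β - 2)) := by
          rw [← ENNReal.ofReal_mul (by positivity), show N + β - 2 = (β - 1) + ((N : ℝ) - 1) by ring,
            Real.rpow_add hR]
          ring_nf
        rw [← h1, ENNReal.coe_mul]
        ring

/-- For α ≤ 1 the spherical integral with exponent N - α may diverge, so the kernel is split: where
|x-y| < 1 it is locally integrable and contributes a multiple of the volume, and elsewhere it is at
most |x-y|^(β-N), with β ≥ α free to choose. -/
theorem exists_annulus_energy_le_of_le {α β : ℝ} (hN : 0 < N) (hα0 : 0 < α) (hαβ : α ≤ β)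
    (hβ : (1 < β ∧ β < N) ∨ β = N) : ∃ C : ℝ≥0, ∀ R : ℝ, 2 ≤ R →
      ∫⁻ x in annulus N R 1, ∫⁻ y in annulus N R 1, ENNReal.ofReal (‖x - y‖ ^ (α - N)) ≤
        C * ENNReal.ofReal (R ^ (N + β - 2)) := by
  have hN1 : (1 : ℝ) ≤ N := by exact_mod_cast hN
  have := nontrivial_euclideanSpace hN
  have hβ1 : 1 ≤ β := by
    rcases hβ with h | rfl
    · exact h.1.le
    · exact hN1
  obtain ⟨C, hC⟩ := exists_annulus_energy_le hN hβ
  obtain ⟨C', hC'⟩ := exists_volume_annulus_le hN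
  have hfin := lintegral_ball_rpow_lt_top (volume : Measure (EuclideanSpace ℝ (Fin N)))
    (γ := N - α) (R := 1) (by rw [finrank_euclideanSpace_fin]; linarith)
  set I := ∫⁻ x in Metric.ball (0 : EuclideanSpace ℝ (Fin N)) 1, ENNReal.ofReal (‖x‖ ^ (-(N - α)))
  refine ⟨I.toNNReal * C' + C, fun R hR => ?_⟩
  have hR0 : 0 < R := by linarith
  have hpt : ∀ x y : EuclideanSpace ℝ (Fin N), ENNReal.ofReal (‖x - y‖ ^ (α - N)) ≤
      (Metric.ball (0 : EuclideanSpace ℝ (Fin N)) 1).indicator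
        (fun z => ENNReal.ofReal (‖z‖ ^ (-(N - α)))) (x - y) +
      ENNReal.ofReal (‖x - y‖ ^ (β - N)) := by
    intro x y
    by_cases h : x - y ∈ Metric.ball (0 : EuclideanSpace ℝ (Fin N)) 1
    · rw [Set.indicator_of_mem h, neg_sub]
      exact le_self_add
    · rw [Set.indicator_of_notMem h, zero_add]
      rw [mem_ball_zero_iff, not_lt] at h
      exact ENNReal.ofReal_le_ofReal (Real.rpow_le_rpow_of_exponent_le h (by linarith))
  have hm : Measurable ((Metric.ball (0 : EuclideanSpace ℝ (Fin N)) 1).indicator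
        (fun z => ENNReal.ofReal (‖z‖ ^ (-(N - α))))) :=
    Measurable.indicator (by fun_prop) measurableSet_ball
  calc _ ≤ ∫⁻ x in annulus N R 1, (I + ∫⁻ y in annulus N R 1,
        ENNReal.ofReal (‖x - y‖ ^ (β - N))) := by
        refine lintegral_mono fun x => (lintegral_mono fun y => hpt x y).trans ?_
        rw [lintegral_add_left (by fun_prop)]
        refine add_le_add ((setLIntegral_le_lintegral _ _).trans (le_of_eq ?_)) le_rfl
        rw [lintegral_sub_left_eq_self, lintegral_indicator measurableSet_ball]
    _ = I * volume (annulus N R 1) + ∫⁻ x in annulus N R 1, ∫⁻ y in annulus N R 1,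
        ENNReal.ofReal (‖x - y‖ ^ (β - N)) := by
        rw [lintegral_add_left measurable_const, setLIntegral_const]
    _ ≤ I * (C' * ENNReal.ofReal (R ^ (N + β - 2))) + C * ENNReal.ofReal (R ^ (N + β - 2)) := by
        refine add_le_add (mul_le_mul_right ?_ _) ?_
        · refine (hC' R 1 one_pos (by linarith)).trans
            (mul_le_mul_right (ENNReal.ofReal_le_ofReal ?_) _)
          rw [mul_one]
          exact Real.rpow_le_rpow_of_exponent_le (by linarith) (by linarith)
        · simpa using hC R 1 one_pos (by linarith)
    _ = _ := by
        push_cast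
        rw [ENNReal.coe_toNNReal hfin.ne]
        ring


/-! ### Radial bumps on separated annuli. -/

/-- A smooth cutoff function on the real line. -/
def cutoff : ContDiffBump (0 : ℝ) := ⟨3 / 4, 1, by norm_num, by norm_num⟩

theorem exists_abs_deriv_cutoff_le : ∃ K : ℝ, 0 < K ∧ ∀ t, |deriv cutoff t| ≤ K := by
  have h : Continuous (deriv cutoff) := (cutoff.contDiff (n := 1)).continuous_deriv le_rfl
  obtain ⟨K, hK⟩ := h.bounded_above_of_compact_support cutoff.hasCompactSupport.deriv
  exact ⟨max K 1, by positivity, fun t => (hK t).trans (le_max_left _ _)⟩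

theorem deriv_cutoff_eq_zero {t : ℝ} (ht : 1 < |t|) : deriv cutoff t = 0 := by
  by_contra h
  have h1 := support_deriv_subset (f := cutoff) (show t ∈ Function.support (deriv cutoff) from h)
  rw [cutoff.tsupport_eq, mem_closedBall_zero_iff, Real.norm_eq_abs] at h1
  exact absurd h1 (not_le.2 ht)

/-- A smooth radial cutoff function of an annulus. -/
def annularBump (R w : ℝ) (x : EuclideanSpace ℝ (Fin N)) : ℝ :=
  cutoff ((‖x‖ ^ 2 - R ^ 2) / (R * w))

/-- The bump is a function of ‖x‖² and not of ‖x‖, hence smooth at the origin as well. -/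
theorem contDiff_annularBump (R w : ℝ) : ContDiff ℝ ∞ (annularBump (N := N) R w) := by
  refine cutoff.contDiff.comp ?_
  exact ((contDiff_norm_sq ℝ).sub contDiff_const).div_const _

theorem annularBump_nonneg (R w : ℝ) (x : EuclideanSpace ℝ (Fin N)) : 0 ≤ annularBump R w x :=
  cutoff.nonneg

theorem annularBump_le_one (R w : ℝ) (x : EuclideanSpace ℝ (Fin N)) : annularBump R w x ≤ 1 :=
  cutoff.le_one

theorem radiallySymmetric_annularBump (R w : ℝ) :
    RadiallySymmetric (annularBump (N := N) R w) := by
  intro x y h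
  rw [annularBump, annularBump, h]

theorem one_lt_abs_of_notMem_annulus {R w : ℝ} (hR : 0 < R) (hw : 0 < w)
    {x : EuclideanSpace ℝ (Fin N)} (hx : x ∉ annulus N R w) :
    1 < |(‖x‖ ^ 2 - R ^ 2) / (R * w)| := by
  have h1 : w < |‖x‖ - R| := not_le.1 hx
  have h2 : ‖x‖ ^ 2 - R ^ 2 = (‖x‖ - R) * (‖x‖ + R) := by ring
  rw [abs_div, abs_of_pos (mul_pos hR hw), one_lt_div (by positivity), h2, abs_mul,
    abs_of_pos (a := ‖x‖ + R) (by positivity), mul_comm R]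
  exact mul_lt_mul h1 (le_add_of_nonneg_left (norm_nonneg x)) hR (abs_nonneg _)

theorem annularBump_eq_zero {R w : ℝ} (hR : 0 < R) (hw : 0 < w)
    {x : EuclideanSpace ℝ (Fin N)} (hx : x ∉ annulus N R w) : annularBump R w x = 0 := by
  refine cutoff.zero_of_le_dist ?_
  rw [dist_zero_right]
  exact (one_lt_abs_of_notMem_annulus hR hw hx).le

/-- On the annulus of half-width w/4 the argument of the cutoff is at most (w/4)(3R)/(Rw) = 3/4, the
inner radius of `cutoff`. -/
theorem annularBump_eq_one {R w : ℝ} (hw : 0 < w) (hwR : w ≤ R / 4)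
    {x : EuclideanSpace ℝ (Fin N)} (hx : x ∈ annulus N R (w / 4)) : annularBump R w x = 1 := by
  have hR : 0 < R := by linarith
  have h1 : |‖x‖ - R| ≤ w / 4 := hx
  refine cutoff.one_of_mem_closedBall ?_
  rw [mem_closedBall_zero_iff, Real.norm_eq_abs, abs_div, abs_of_pos (mul_pos hR hw),
    show ‖x‖ ^ 2 - R ^ 2 = (‖x‖ - R) * (‖x‖ + R) by ring, abs_mul,
    abs_of_pos (a := ‖x‖ + R) (by positivity)]
  show _ ≤ (3 / 4 : ℝ)
  rw [div_le_iff₀ (by positivity)]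
  have h2 : ‖x‖ + R ≤ 3 * R := by linarith [(abs_le.1 h1).2]
  calc |‖x‖ - R| * (‖x‖ + R) ≤ w / 4 * (3 * R) := by gcongr
    _ = _ := by ring

theorem fderiv_annularBump (R w : ℝ) (x : EuclideanSpace ℝ (Fin N)) :
    fderiv ℝ (annularBump R w) x =
      (deriv cutoff ((‖x‖ ^ 2 - R ^ 2) / (R * w)) * (2 / (R * w))) • innerSL ℝ x := by
  have h1 : HasFDerivAt (fun y : EuclideanSpace ℝ (Fin N) => (‖y‖ ^ 2 - R ^ 2) / (R * w))
      ((R * w)⁻¹ • (2 • innerSL ℝ x)) x := by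
    simp only [div_eq_mul_inv]
    exact ((hasStrictFDerivAt_norm_sq x).hasFDerivAt.sub_const (R ^ 2)).mul_const (R * w)⁻¹
  have h2 := ((cutoff.contDiff (n := 1)).differentiable (by simp)
    ((‖x‖ ^ 2 - R ^ 2) / (R * w))).hasDerivAt
  have h3 := (h2.comp_hasFDerivAt x h1).fderiv
  refine (show fderiv ℝ (annularBump R w) x = _ from h3).trans ?_
  ext y
  simp
  ring

theorem fderiv_annularBump_eq_zero {R w : ℝ} (hR : 0 < R) (hw : 0 < w)
    {x : EuclideanSpace ℝ (Fin N)} (hx : x ∉ annulus N R w) :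
    fderiv ℝ (annularBump R w) x = 0 := by
  rw [fderiv_annularBump, deriv_cutoff_eq_zero (one_lt_abs_of_notMem_annulus hR hw hx), zero_mul,
    zero_smul]

theorem exists_norm_fderiv_annularBump_le : ∃ K : ℝ, 0 < K ∧ ∀ R w : ℝ, 0 < w → w ≤ R / 4 →
    ∀ x : EuclideanSpace ℝ (Fin N), ‖fderiv ℝ (annularBump R w) x‖ ≤ K / w := by
  obtain ⟨K, hK0, hK⟩ := exists_abs_deriv_cutoff_le
  refine ⟨K * 4, by positivity, fun R w hw hwR x => ?_⟩
  have hR : 0 < R := by linarith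
  by_cases hx : x ∈ annulus N R w
  · have h1 : ‖x‖ ≤ 2 * R := by linarith [(abs_le.1 (show |‖x‖ - R| ≤ w from hx)).2]
    rw [fderiv_annularBump, norm_smul, innerSL_apply_norm, Real.norm_eq_abs, abs_mul,
      abs_of_pos (a := 2 / (R * w)) (by positivity)]
    calc _ ≤ K * (2 / (R * w)) * (2 * R) := by
          gcongr
          exact hK _
      _ = _ := by field_simp; norm_num
  · rw [fderiv_annularBump_eq_zero hR hw hx, norm_zero]
    positivity

theorem enorm_sum_rpow_eq {ι F : Type*} [NormedAddCommGroup F] (s : Finset ι) (f : ι → F)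
    (h : ∀ j ∈ s, ∀ k ∈ s, f j ≠ 0 → f k ≠ 0 → j = k) {p : ℝ} (hp : 0 < p) :
    ‖∑ k ∈ s, f k‖ₑ ^ p = ∑ k ∈ s, ‖f k‖ₑ ^ p := by
  by_cases h0 : ∃ k ∈ s, f k ≠ 0
  · obtain ⟨k, hk, hk0⟩ := h0
    have h1 : ∀ j ∈ s, j ≠ k → f j = 0 := fun j hj hjk => by
      by_contra hj0
      exact hjk (h j hj k hk hj0 hk0)
    rw [Finset.sum_eq_single_of_mem k hk h1, Finset.sum_eq_single_of_mem k hk]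
    intro j hj hjk
    rw [h1 j hj hjk, enorm_zero, ENNReal.zero_rpow_of_pos hp]
  · push Not at h0
    rw [Finset.sum_eq_zero h0, enorm_zero, ENNReal.zero_rpow_of_pos hp, Finset.sum_eq_zero]
    intro j hj
    rw [h0 j hj, enorm_zero, ENNReal.zero_rpow_of_pos hp]

/-- A sequence of thin annuli, pairwise far apart. -/
structure SeparatedAnnuli (R w : ℕ → ℝ) : Prop where
  w_pos : ∀ k, 0 < w k
  w_le : ∀ k, w k ≤ R k / 4
  separated : ∀ j k, j ≠ k → 4 * R j ≤ R k ∨ 4 * R k ≤ R j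

/-- A superposition of bumps on annuli. -/
def annularSum (n : ℕ) (a R w : ℕ → ℝ) (x : EuclideanSpace ℝ (Fin N)) : ℝ :=
  ∑ k ∈ Finset.range n, a k * annularBump (R k) (w k) x

namespace SeparatedAnnuli

variable {R w : ℕ → ℝ}

theorem R_pos (h : SeparatedAnnuli R w) (k : ℕ) : 0 < R k := by
  linarith [h.w_pos k, h.w_le k]

theorem eq_of_mem (h : SeparatedAnnuli R w) {j k : ℕ} {x : EuclideanSpace ℝ (Fin N)}
    (hj : x ∈ annulus N (R j) (w j)) (hk : x ∈ annulus N (R k) (w k)) : j = k := by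
  by_contra hjk
  have h1 := abs_le.1 (show |‖x‖ - R j| ≤ w j from hj)
  have h2 := abs_le.1 (show |‖x‖ - R k| ≤ w k from hk)
  have := h.R_pos j
  have := h.R_pos k
  rcases h.separated j k hjk with h3 | h3 <;> linarith [h.w_le j, h.w_le k]

theorem norm_sub_ge (h : SeparatedAnnuli R w) {j k : ℕ} (hjk : j ≠ k)
    {x y : EuclideanSpace ℝ (Fin N)} (hx : x ∈ annulus N (R j) (w j))
    (hy : y ∈ annulus N (R k) (w k)) : max (R j) (R k) / 4 ≤ ‖x - y‖ := by
  have h1 := abs_le.1 (show |‖x‖ - R j| ≤ w j from hx)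
  have h2 := abs_le.1 (show |‖y‖ - R k| ≤ w k from hy)
  have hj := h.R_pos j
  have hk := h.R_pos k
  have h4 := abs_le.1 (abs_norm_sub_norm_le x y)
  rcases h.separated j k hjk with h3 | h3
  · rw [max_eq_right (by linarith)]
    linarith [h.w_le j, h.w_le k]
  · rw [max_eq_left (by linarith)]
    linarith [h.w_le j, h.w_le k]

theorem contDiff_annularSum (n : ℕ) (a R w : ℕ → ℝ) :
    ContDiff ℝ ∞ (annularSum (N := N) n a R w) :=
  ContDiff.sum fun k _ => contDiff_const.mul (contDiff_annularBump (R k) (w k))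

theorem radiallySymmetric_annularSum (n : ℕ) (a R w : ℕ → ℝ) :
    RadiallySymmetric (annularSum (N := N) n a R w) := by
  intro x y hxy
  refine Finset.sum_congr rfl fun k _ => ?_
  rw [radiallySymmetric_annularBump (R k) (w k) x y hxy]

theorem enorm_annularSum_rpow (h : SeparatedAnnuli R w) (n : ℕ) (a : ℕ → ℝ) {p : ℝ} (hp : 0 < p)
    (x : EuclideanSpace ℝ (Fin N)) : ‖annularSum n a R w x‖ₑ ^ p =
      ∑ k ∈ Finset.range n, ‖a k * annularBump (R k) (w k) x‖ₑ ^ p := by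
  refine enorm_sum_rpow_eq _ _ (fun j _ k _ hj hk => ?_) hp
  refine h.eq_of_mem (x := x) ?_ ?_
  · by_contra hx
    exact hj (by rw [annularBump_eq_zero (h.R_pos j) (h.w_pos j) hx, mul_zero])
  · by_contra hx
    exact hk (by rw [annularBump_eq_zero (h.R_pos k) (h.w_pos k) hx, mul_zero])

theorem enorm_fderiv_annularSum_sq (h : SeparatedAnnuli R w) (n : ℕ) (a : ℕ → ℝ)
    (x : EuclideanSpace ℝ (Fin N)) : ‖fderiv ℝ (annularSum n a R w) x‖ₑ ^ 2 =
      ∑ k ∈ Finset.range n, ‖a k • fderiv ℝ (annularBump (R k) (w k)) x‖ₑ ^ 2 := by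
  have h1 : fderiv ℝ (annularSum n a R w) x =
      ∑ k ∈ Finset.range n, a k • fderiv ℝ (annularBump (R k) (w k)) x := by
    have hd : ∀ k, DifferentiableAt ℝ (annularBump (N := N) (R k) (w k)) x :=
      fun k => (contDiff_annularBump (R k) (w k)).differentiable (by simp) x
    unfold annularSum
    rw [fderiv_fun_sum fun k _ => (hd k).const_mul (a k)]
    exact Finset.sum_congr rfl fun k _ => fderiv_const_mul (hd k) (a k)
  have h2 := enorm_sum_rpow_eq (Finset.range n)
    (fun k => a k • fderiv ℝ (annularBump (N := N) (R k) (w k)) x) (fun j _ k _ hj hk => by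
      refine h.eq_of_mem (x := x) ?_ ?_
      · by_contra hx
        exact hj (by simp only [fderiv_annularBump_eq_zero (h.R_pos j) (h.w_pos j) hx, smul_zero])
      · by_contra hx
        exact hk (by simp only [fderiv_annularBump_eq_zero (h.R_pos k) (h.w_pos k) hx, smul_zero]))
    (p := 2) two_pos
  simp only [ENNReal.rpow_two] at h2
  rw [h1, h2]

end SeparatedAnnuli


namespace SeparatedAnnuli

/-- The supports are disjoint and the k-th gradient is at most K a_k/w_k on a set of volume of order
R_k^(N-1) w_k, so the energies add without interaction. -/
theorem exists_lintegral_fderiv_le (hN : 0 < N) :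
    ∃ C : ℝ≥0, ∀ R w : ℕ → ℝ, SeparatedAnnuli R w → ∀ (n : ℕ) (a : ℕ → ℝ) (d : ℝ),
      (∀ k < n, a k ^ 2 * (R k ^ ((N : ℝ) - 1) / w k) ≤ d) →
      ∫⁻ x : EuclideanSpace ℝ (Fin N), ‖fderiv ℝ (annularSum n a R w) x‖ₑ ^ 2 ≤
        C * (n * ENNReal.ofReal d) := by
  obtain ⟨K, hK0, hK⟩ := exists_norm_fderiv_annularBump_le (N := N)
  obtain ⟨C, hC⟩ := exists_volume_annulus_le hN
  refine ⟨(K ^ 2).toNNReal * C, fun R w h n a d hd => ?_⟩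
  simp only [h.enorm_fderiv_annularSum_sq]
  have hm : ∀ k, Measurable fun x : EuclideanSpace ℝ (Fin N) =>
      ‖a k • fderiv ℝ (annularBump (R k) (w k)) x‖ₑ ^ 2 := fun k => by
    have := ((contDiff_annularBump (N := N) (R k) (w k)).continuous_fderiv (by simp)).measurable
    fun_prop
  rw [lintegral_finsetSum _ fun k _ => hm k]
  have key : ∀ k ∈ Finset.range n, ∫⁻ x : EuclideanSpace ℝ (Fin N),
      ‖a k • fderiv ℝ (annularBump (R k) (w k)) x‖ₑ ^ 2 ≤
        ENNReal.ofReal (K ^ 2) * C * ENNReal.ofReal d := by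
    intro k hk
    have hR := h.R_pos k
    have hw := h.w_pos k
    calc _ ≤ ∫⁻ x, (annulus N (R k) (w k)).indicator
          (fun _ => ENNReal.ofReal ((a k) ^ 2 * (K / w k) ^ 2)) x := by
          refine lintegral_mono fun x => ?_
          by_cases hx : x ∈ annulus N (R k) (w k)
          · rw [Set.indicator_of_mem hx, ← ofReal_norm, ← ENNReal.ofReal_pow (norm_nonneg _)]
            refine ENNReal.ofReal_le_ofReal ?_
            rw [norm_smul, mul_pow, Real.norm_eq_abs, sq_abs]
            gcongr
            exact hK _ _ hw (h.w_le k) x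
          · rw [Set.indicator_of_notMem hx, ← ofReal_norm, fderiv_annularBump_eq_zero hR hw hx,
              smul_zero, norm_zero, ENNReal.ofReal_zero, zero_pow two_ne_zero]
      _ ≤ ENNReal.ofReal ((a k) ^ 2 * (K / w k) ^ 2) *
          (C * ENNReal.ofReal (R k ^ ((N : ℝ) - 1) * w k)) := by
          rw [lintegral_indicator_const (measurableSet_annulus _ _)]
          exact mul_le_mul_right (hC _ _ hw (by linarith [h.w_le k])) _
      _ = ENNReal.ofReal (K ^ 2) * C *
          ENNReal.ofReal (a k ^ 2 * (R k ^ ((N : ℝ) - 1) / w k)) := by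
          have h1 : ENNReal.ofReal ((a k) ^ 2 * (K / w k) ^ 2) *
              ENNReal.ofReal (R k ^ ((N : ℝ) - 1) * w k) = ENNReal.ofReal (K ^ 2) *
                ENNReal.ofReal (a k ^ 2 * (R k ^ ((N : ℝ) - 1) / w k)) := by
            rw [← ENNReal.ofReal_mul (by positivity), ← ENNReal.ofReal_mul (by positivity)]
            congr 1
            field_simp
          rw [mul_left_comm, h1]
          ring
      _ ≤ _ := mul_le_mul_right (ENNReal.ofReal_le_ofReal (hd k (Finset.mem_range.1 hk))) _
  refine (Finset.sum_le_sum key).trans (le_of_eq ?_)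
  rw [Finset.sum_const, Finset.card_range, nsmul_eq_mul, ENNReal.coe_mul,
    ENNReal.ofNNReal_toNNReal]
  ring

theorem exists_le_lintegral (hN : 0 < N) {q : ℝ} (hq : 0 < q) :
    ∃ c : ℝ, 0 < c ∧ ∀ R w : ℕ → ℝ, SeparatedAnnuli R w → ∀ (n : ℕ) (a : ℕ → ℝ) (t : ℝ),
      (∀ k, 0 < a k) → (∀ k < n, t ≤ a k ^ q * (R k ^ ((N : ℝ) - 1) * w k)) →
      n * ENNReal.ofReal (c * t) ≤
        ∫⁻ x : EuclideanSpace ℝ (Fin N), ‖annularSum n a R w x‖ₑ ^ q := by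
  obtain ⟨c, hc0, hc⟩ := exists_le_volume_annulus hN
  refine ⟨c / 4, by positivity, fun R w h n a t ha ht => ?_⟩
  simp only [h.enorm_annularSum_rpow n a hq]
  have hm : ∀ k, Measurable fun x : EuclideanSpace ℝ (Fin N) =>
      ‖a k * annularBump (R k) (w k) x‖ₑ ^ q := fun k => by
    have := (contDiff_annularBump (N := N) (R k) (w k)).continuous.measurable
    fun_prop
  rw [lintegral_finsetSum _ fun k _ => hm k]
  have key : ∀ k ∈ Finset.range n, ENNReal.ofReal (c / 4 * t) ≤
      ∫⁻ x : EuclideanSpace ℝ (Fin N), ‖a k * annularBump (R k) (w k) x‖ₑ ^ q := by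
    intro k hk
    have hR := h.R_pos k
    have hw := h.w_pos k
    have hak := ha k
    calc _ ≤ ENNReal.ofReal (a k ^ q * (c * (R k ^ ((N : ℝ) - 1) * (w k / 4)))) := by
          refine ENNReal.ofReal_le_ofReal ?_
          calc c / 4 * t ≤ c / 4 * (a k ^ q * (R k ^ ((N : ℝ) - 1) * w k)) := by
                gcongr
                exact ht k (Finset.mem_range.1 hk)
            _ = _ := by ring
      _ ≤ ENNReal.ofReal (a k ^ q) * volume (annulus N (R k) (w k / 4)) := by
          rw [ENNReal.ofReal_mul (by positivity)]
          exact mul_le_mul_right (hc _ _ (by positivity) hR) _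
      _ = ∫⁻ x in annulus N (R k) (w k / 4), ‖a k * annularBump (R k) (w k) x‖ₑ ^ q := by
          rw [← setLIntegral_const]
          refine setLIntegral_congr_fun (measurableSet_annulus _ _) fun x hx => ?_
          rw [annularBump_eq_one hw (h.w_le k) hx, mul_one, Real.enorm_of_nonneg hak.le,
            ENNReal.ofReal_rpow_of_pos hak]
      _ ≤ _ := setLIntegral_le_lintegral _ _
  refine le_trans (le_of_eq ?_) (Finset.sum_le_sum key)
  rw [Finset.sum_const, Finset.card_range, nsmul_eq_mul]

theorem exists_lintegral_annulus_annulus_le {α : ℝ} (hN : 0 < N) (hαN : α < N) :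
    ∃ C : ℝ≥0, ∀ R w : ℕ → ℝ, SeparatedAnnuli R w → ∀ j k : ℕ, j ≠ k →
      ∫⁻ y in annulus N (R j) (w j), ∫⁻ z in annulus N (R k) (w k),
        ENNReal.ofReal (‖y - z‖ ^ (α - N)) ≤
          C * ENNReal.ofReal ((R j ^ ((N : ℝ) - 1) * w j) * (R k ^ ((N : ℝ) - 1) * w k) *
            max (R j) (R k) ^ (α - N)) := by
  obtain ⟨C, hC⟩ := exists_volume_annulus_le hN
  refine ⟨C * C * (4⁻¹ ^ (α - N)), fun R w h j k hjk => ?_⟩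
  have hRj := h.R_pos j
  have hRk := h.R_pos k
  have hwj := h.w_pos j
  have hwk := h.w_pos k
  have hM : 0 < max (R j) (R k) := lt_max_of_lt_left hRj
  have hmj : volume (annulus N (R j) (w j)) ≤ C * ENNReal.ofReal (R j ^ ((N : ℝ) - 1) * w j) :=
    hC _ _ hwj (by linarith [h.w_le j])
  have hmk : volume (annulus N (R k) (w k)) ≤ C * ENNReal.ofReal (R k ^ ((N : ℝ) - 1) * w k) :=
    hC _ _ hwk (by linarith [h.w_le k])
  have hmj0 : 0 ≤ R j ^ ((N : ℝ) - 1) * w j := by positivity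
  have hmk0 : 0 ≤ R k ^ ((N : ℝ) - 1) * w k := by positivity
  generalize R j ^ ((N : ℝ) - 1) * w j = mj at *
  generalize R k ^ ((N : ℝ) - 1) * w k = mk at *
  calc _ ≤ ∫⁻ y in annulus N (R j) (w j), ∫⁻ z in annulus N (R k) (w k),
        ENNReal.ofReal ((max (R j) (R k) / 4) ^ (α - N)) := by
        refine setLIntegral_mono' (measurableSet_annulus _ _) fun y hy =>
          setLIntegral_mono' (measurableSet_annulus _ _) fun z hz => ?_
        exact ENNReal.ofReal_le_ofReal (Real.rpow_le_rpow_of_nonpos (by positivity)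
          (h.norm_sub_ge hjk hy hz) (by linarith))
    _ = ENNReal.ofReal ((max (R j) (R k) / 4) ^ (α - N)) * volume (annulus N (R k) (w k)) *
        volume (annulus N (R j) (w j)) := by rw [setLIntegral_const, setLIntegral_const]
    _ ≤ ENNReal.ofReal ((max (R j) (R k) / 4) ^ (α - N)) *
        (C * ENNReal.ofReal mk) * (C * ENNReal.ofReal mj) := by gcongr
    _ = _ := by
        rw [div_eq_mul_inv, Real.mul_rpow hM.le (by norm_num), ENNReal.ofReal_mul (by positivity),
          ENNReal.ofReal_mul (by positivity), ENNReal.ofReal_mul (by positivity)]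
        have h4 : ENNReal.ofReal ((4 : ℝ)⁻¹ ^ (α - N)) = (((4 : ℝ≥0)⁻¹ ^ (α - N) : ℝ≥0) : ℝ≥0∞) := by
          rw [← ENNReal.ofReal_coe_nnreal, NNReal.coe_rpow, NNReal.coe_inv, NNReal.coe_ofNat]
        rw [h4]
        push_cast
        ring

theorem lintegral_lintegral_sum_mul_sum {E ι : Type*} [MeasurableSpace E] (μ : Measure E) [SFinite μ]
    (s : Finset ι) {g : ι → E → ℝ≥0∞} (hg : ∀ k, Measurable (g k)) {κ : E → E → ℝ≥0∞}
    (hκ : Measurable (Function.uncurry κ)) :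
    ∫⁻ y, ∫⁻ z, (∑ j ∈ s, g j y) * (∑ k ∈ s, g k z) * κ y z ∂μ ∂μ =
      ∑ j ∈ s, ∑ k ∈ s, ∫⁻ y, ∫⁻ z, g j y * g k z * κ y z ∂μ ∂μ := by
  have hm : ∀ j k, Measurable fun q : E × E => g j q.1 * g k q.2 * κ q.1 q.2 := fun j k =>
    (((hg j).comp measurable_fst).mul ((hg k).comp measurable_snd)).mul hκ
  have h1 : ∀ y, ∫⁻ z, (∑ j ∈ s, g j y) * (∑ k ∈ s, g k z) * κ y z ∂μ =
      ∑ j ∈ s, ∑ k ∈ s, ∫⁻ z, g j y * g k z * κ y z ∂μ := by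
    intro y
    have h2 : ∀ j k, Measurable fun z => g j y * g k z * κ y z :=
      fun j k => (hm j k).comp measurable_prodMk_left
    simp_rw [← lintegral_finsetSum s fun k _ => h2 _ k]
    rw [← lintegral_finsetSum s fun j _ => Finset.measurable_sum s fun k _ => h2 j k]
    refine lintegral_congr fun z => ?_
    rw [Finset.sum_mul_sum, Finset.sum_mul]
    exact Finset.sum_congr rfl fun j _ => Finset.sum_mul _ _ _
  have h3 : ∀ j k, Measurable fun y => ∫⁻ z, g j y * g k z * κ y z ∂μ :=
    fun j k => (hm j k).lintegral_prod_right'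
  simp_rw [h1]
  rw [lintegral_finsetSum s fun j _ => Finset.measurable_sum s fun k _ => h3 j k]
  exact Finset.sum_congr rfl fun j _ => lintegral_finsetSum s fun k _ => h3 j k

theorem lintegral_lintegral_indicator_mul_indicator {E : Type*} [MeasurableSpace E] (μ : Measure E)
    {A B : Set E} (hA : MeasurableSet A) (hB : MeasurableSet B) {a b : ℝ≥0∞} (ha : a ≠ ⊤)
    (hb : b ≠ ⊤) (κ : E → E → ℝ≥0∞) :
    ∫⁻ y, ∫⁻ z, A.indicator (fun _ => a) y * B.indicator (fun _ => b) z * κ y z ∂μ ∂μ =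
      a * b * ∫⁻ y in A, ∫⁻ z in B, κ y z ∂μ ∂μ := by
  rw [← lintegral_indicator hA, ← lintegral_const_mul' _ _ (by finiteness)]
  refine lintegral_congr fun y => ?_
  by_cases hy : y ∈ A
  · rw [Set.indicator_of_mem hy, Set.indicator_of_mem hy, ← lintegral_indicator hB,
      ← lintegral_const_mul' _ _ (by finiteness)]
    refine lintegral_congr fun z => ?_
    by_cases hz : z ∈ B
    · rw [Set.indicator_of_mem hz, Set.indicator_of_mem hz]
    · rw [Set.indicator_of_notMem hz, Set.indicator_of_notMem hz, mul_zero, zero_mul, mul_zero]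
  · rw [Set.indicator_of_notMem hy, Set.indicator_of_notMem hy]
    simp

/-- In the double sum each row has one diagonal term, bounded by v, and fewer than n interactions,
each bounded by a multiple of v/n because of the factor n in the last hypothesis. Each row is thus
O(v) and the n rows give O(n v). -/
theorem exists_coulombEnergy_le {α p : ℝ} (hα0 : 0 < α) (hαN : α < N) (hp : 0 < p) :
    ∃ C : ℝ≥0, ∀ R w : ℕ → ℝ, SeparatedAnnuli R w → ∀ (n : ℕ) (a : ℕ → ℝ) (v : ℝ),
      (∀ k, 0 < a k) →
      (∀ k < n, ENNReal.ofReal ((a k ^ p) ^ 2) * (∫⁻ y in annulus N (R k) (w k),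
        ∫⁻ z in annulus N (R k) (w k), ENNReal.ofReal (‖y - z‖ ^ (α - N))) ≤ ENNReal.ofReal v) →
      (∀ j < n, ∀ k < n, j ≠ k → n * ((a j ^ p * (R j ^ ((N : ℝ) - 1) * w j)) *
        (a k ^ p * (R k ^ ((N : ℝ) - 1) * w k)) * max (R j) (R k) ^ (α - N)) ≤ v) →
      coulombEnergy α p (annularSum (N := N) n a R w) ≤ C * (n * ENNReal.ofReal v) := by
  have hN := pos_of_lt_natCast hα0 hαN
  obtain ⟨C, hC⟩ := CoulombSobolev.exists_coulombEnergy_le hα0 hαN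
  obtain ⟨C', hC'⟩ := exists_lintegral_annulus_annulus_le hN hαN
  refine ⟨C * (1 + C'), fun R w h n a v ha hv1 hv2 => ?_⟩
  have hum : Measurable (annularSum (N := N) n a R w) :=
    (contDiff_annularSum n a R w).continuous.measurable
  set A : ℕ → Set (EuclideanSpace ℝ (Fin N)) := fun k => annulus N (R k) (w k) with hA
  have hAm : ∀ k, MeasurableSet (A k) := fun k => measurableSet_annulus _ _
  set b : ℕ → ℝ≥0∞ := fun k => ENNReal.ofReal (a k ^ p) with hb
  have hf : ∀ x, ENNReal.ofReal (|annularSum n a R w x| ^ p) ≤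
      ∑ k ∈ Finset.range n, (A k).indicator (fun _ => b k) x := by
    intro x
    rw [ofReal_abs_rpow hp.le, h.enorm_annularSum_rpow n a hp]
    refine Finset.sum_le_sum fun k _ => ?_
    by_cases hx : x ∈ A k
    · have := annularBump_nonneg (R k) (w k) x
      have hak := (ha k).le
      rw [Set.indicator_of_mem hx, Real.enorm_of_nonneg (by positivity),
        ENNReal.ofReal_rpow_of_nonneg (by positivity) hp.le]
      refine ENNReal.ofReal_le_ofReal (Real.rpow_le_rpow (by positivity) ?_ hp.le)
      exact mul_le_of_le_one_right hak (annularBump_le_one _ _ x)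
    · rw [annularBump_eq_zero (h.R_pos k) (h.w_pos k) hx, mul_zero, enorm_zero,
        ENNReal.zero_rpow_of_pos hp]
      exact zero_le
  set κ : EuclideanSpace ℝ (Fin N) → EuclideanSpace ℝ (Fin N) → ℝ≥0∞ :=
    fun y z => ENNReal.ofReal (‖y - z‖ ^ (α - N)) with hκ
  have hκm : Measurable (Function.uncurry κ) := by unfold Function.uncurry; fun_prop
  have hind : ∀ k, Measurable ((A k).indicator fun _ : EuclideanSpace ℝ (Fin N) => b k) :=
    fun k => measurable_const.indicator (hAm k)
  have hterm : ∀ j ∈ Finset.range n, ∑ k ∈ Finset.range n,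
      b j * b k * ∫⁻ y in A j, ∫⁻ z in A k, κ y z ≤ (1 + C') * ENNReal.ofReal v := by
    intro j hj
    have hjn := Finset.mem_range.1 hj
    have hn : (0 : ℝ) < n := by exact_mod_cast (Nat.zero_le j).trans_lt hjn
    rw [← Finset.add_sum_erase _ _ hj, add_mul, one_mul]
    refine add_le_add ?_ ?_
    · have := hv1 j hjn
      rwa [ENNReal.ofReal_pow (Real.rpow_nonneg (ha j).le _), sq] at this
    · have hoff : ∀ k ∈ (Finset.range n).erase j,
          b j * b k * ∫⁻ y in A j, ∫⁻ z in A k, κ y z ≤ C' * ENNReal.ofReal (v / n) := by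
        intro k hk
        obtain ⟨hkj, hkn⟩ := Finset.mem_erase.1 hk
        have haj := ha j
        have hak := ha k
        calc _ ≤ b j * b k * _ := mul_le_mul_right (hC' R w h j k hkj.symm) _
          _ = C' * ENNReal.ofReal ((a j ^ p * (R j ^ ((N : ℝ) - 1) * w j)) *
              (a k ^ p * (R k ^ ((N : ℝ) - 1) * w k)) * max (R j) (R k) ^ (α - N)) := by
              rw [hb, mul_left_comm, ← ENNReal.ofReal_mul (by positivity),
                ← ENNReal.ofReal_mul (by positivity)]
              ring_nf
          _ ≤ _ := by
              refine mul_le_mul_right (ENNReal.ofReal_le_ofReal ?_) _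
              rw [le_div_iff₀ hn, mul_comm]
              exact hv2 j hjn k (Finset.mem_range.1 hkn) hkj.symm
      refine (Finset.sum_le_sum hoff).trans ?_
      refine (Finset.sum_le_sum_of_subset (Finset.erase_subset j _)).trans (le_of_eq ?_)
      rw [Finset.sum_const, Finset.card_range, nsmul_eq_mul, mul_left_comm,
        ← ENNReal.ofReal_natCast, ← ENNReal.ofReal_mul hn.le, mul_div_cancel₀ _ hn.ne']
  calc _ ≤ _ := hC p _ hum
    _ ≤ C * ∫⁻ y, ∫⁻ z, (∑ j ∈ Finset.range n, (A j).indicator (fun _ => b j) y) *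
        (∑ k ∈ Finset.range n, (A k).indicator (fun _ => b k) z) * κ y z := by
        refine mul_le_mul_right (lintegral_mono fun y => lintegral_mono fun z => ?_) _
        exact mul_le_mul_left (mul_le_mul' (hf y) (hf z)) _
    _ = C * ∑ j ∈ Finset.range n, ∑ k ∈ Finset.range n,
        b j * b k * ∫⁻ y in A j, ∫⁻ z in A k, κ y z := by
        rw [lintegral_lintegral_sum_mul_sum volume _ hind hκm]
        congr 1
        refine Finset.sum_congr rfl fun j _ => Finset.sum_congr rfl fun k _ => ?_
        exact lintegral_lintegral_indicator_mul_indicator volume (hAm j) (hAm k)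
          ENNReal.ofReal_ne_top ENNReal.ofReal_ne_top κ
    _ ≤ C * ∑ j ∈ Finset.range n, (1 + C') * ENNReal.ofReal v :=
        mul_le_mul_right (Finset.sum_le_sum hterm) _
    _ = _ := by
        rw [Finset.sum_const, Finset.card_range, nsmul_eq_mul]
        push_cast
        ring

end SeparatedAnnuli


/-! ### Consequences of a radial embedding for test functions. -/

theorem hasWeakGradient_gradient {u : EuclideanSpace ℝ (Fin N) → ℝ} (hu : ContDiff ℝ ∞ u) :
    HasWeakGradient u (gradient u) := by
  have hg : Continuous (gradient u) :=
    (InnerProductSpace.toDual ℝ (EuclideanSpace ℝ (Fin N))).symm.continuous.comp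
      (hu.continuous_fderiv (by simp))
  refine ⟨hu.continuous.locallyIntegrable, hg.locallyIntegrable, fun φ hφ hc v => ?_⟩
  have hcf : Continuous (fderiv ℝ u) := hu.continuous_fderiv (by simp)
  have hcφ : Continuous (fderiv ℝ φ) := hφ.continuous_fderiv (by simp)
  have h1 : ∀ x, φ x * inner ℝ (gradient u x) v = fderiv ℝ u x v * φ x := by
    intro x
    rw [gradient, InnerProductSpace.toDual_symm_apply, mul_comm]
  simp only [h1]
  refine integral_mul_fderiv_eq_neg_fderiv_mul_of_integrable ?_ ?_ ?_
    (fun x _ => hu.differentiable (by simp) x) (fun x _ => hφ.differentiable (by simp) x)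
  · exact Continuous.integrable_of_hasCompactSupport (by fun_prop) (hc.mul_left (f := _))
  · refine Continuous.integrable_of_hasCompactSupport (by fun_prop) ?_
    exact (hc.fderiv_apply (𝕜 := ℝ) v).mul_left
  · exact Continuous.integrable_of_hasCompactSupport (hu.continuous.mul hφ.continuous) hc.mul_left

theorem dirichletEnergy_eq_lintegral_fderiv {u : EuclideanSpace ℝ (Fin N) → ℝ}
    (hu : ContDiff ℝ ∞ u) : dirichletEnergy u = ∫⁻ x, ‖fderiv ℝ u x‖ₑ ^ 2 := by
  rw [dirichletEnergy_eq_of_hasWeakGradient (hasWeakGradient_gradient hu)]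
  refine lintegral_congr fun x => ?_
  rw [gradient, LinearIsometryEquiv.enorm_map]

theorem RadiallySymmetric.isRadial (hN : 0 < N) {u : EuclideanSpace ℝ (Fin N) → ℝ}
    (hu : RadiallySymmetric u) : IsRadial u := by
  have := nontrivial_euclideanSpace hN
  obtain ⟨e, he⟩ := exists_norm_eq (EuclideanSpace ℝ (Fin N)) zero_le_one
  exact ⟨fun r => u (r • e), Filter.Eventually.of_forall fun x =>
    hu _ _ (by rw [norm_smul, he, norm_norm, mul_one])⟩

theorem coulombSobolevNorm_le {α p : ℝ} (hp : 0 < p) {u : EuclideanSpace ℝ (Fin N) → ℝ}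
    (hD : dirichletEnergy u ≤ 1) (hV : coulombEnergy α p u ≤ 1) :
    coulombSobolevNorm α p u ≤ 2 ^ (1 / 2 : ℝ) := by
  unfold coulombSobolevNorm
  refine ENNReal.rpow_le_rpow ?_ (by norm_num)
  rw [← one_add_one_eq_two]
  exact add_le_add hD (ENNReal.rpow_le_one hV (by positivity))

/-- An embedding of the radial subspace bounds smooth radial functions, with the right
homogeneity. -/
theorem EmbedsInLq.exists_lintegral_le {α p q : ℝ} (hN : 0 < N) (hp : 0 < p) (hq : 0 < q)
    (h : EmbedsInLq α p q (radialSpace N α p)) :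
    ∃ C : ℝ≥0, ∀ u : EuclideanSpace ℝ (Fin N) → ℝ, ContDiff ℝ ∞ u → RadiallySymmetric u →
      ∀ l m : ℝ, 0 < l → 0 < m →
      ∫⁻ x, ‖fderiv ℝ u x‖ₑ ^ 2 ≤ ENNReal.ofReal (l ^ (2 : ℝ) * m ^ ((N : ℝ) - 2)) →
      coulombEnergy α p u ≤ ENNReal.ofReal (l ^ (2 * p) * m ^ (N + α)) →
      ∫⁻ x, ‖u x‖ₑ ^ q ≤ C * ENNReal.ofReal (l ^ q * m ^ (N : ℝ)) := by
  obtain ⟨C, hC⟩ := h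
  set L : ℝ≥0∞ := (C * 2 ^ (1 / 2 : ℝ)) ^ q
  have hL : L ≠ ⊤ := by finiteness
  refine ⟨L.toNNReal, fun u hu hr l m hl hm hD hV => ?_⟩
  rw [ENNReal.coe_toNNReal hL]
  refine lintegral_le_of_dilate_le hq.le hl hm ?_
  obtain ⟨h1, h2⟩ := dilate_energies_le_one hu hl hm hD hV
  set v : EuclideanSpace ℝ (Fin N) → ℝ := fun x => l⁻¹ * u (m • x)
  have hv : ContDiff ℝ ∞ v := contDiff_const.mul (hu.comp (contDiff_const_smul m))
  rw [← dirichletEnergy_eq_lintegral_fderiv hv] at h1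
  have h3 := coulombSobolevNorm_le hp h1 h2
  have hvr : RadiallySymmetric v := dilationInvariant_radiallySymmetric u hr l⁻¹ m
  have hmem : v ∈ radialSpace N α p := ⟨⟨hv.continuous.aestronglyMeasurable,
    ⟨_, hasWeakGradient_gradient hv⟩, h3.trans_lt (by finiteness)⟩, hvr.isRadial hN⟩
  have h4 := (hC v hmem).2
  rw [eLpNorm_ofReal_eq hq] at h4
  calc ∫⁻ x, ‖v x‖ₑ ^ q = ((∫⁻ x, ‖v x‖ₑ ^ q) ^ (1 / q)) ^ q := by
        rw [← ENNReal.rpow_mul, one_div_mul_cancel hq.ne', ENNReal.rpow_one]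
    _ ≤ (C * 2 ^ (1 / 2 : ℝ)) ^ q := by
        refine ENNReal.rpow_le_rpow (h4.trans ?_) hq.le
        gcongr


/-- Amplitudes, radii and widths of annuli such that the superposition of bumps has energies
at most `n d` and `n v`, and mass at least `n t`, up to constants. -/
structure AnnularTest (N : ℕ) (α p q : ℝ) (n : ℕ) (a R w : ℕ → ℝ) (d v t : ℝ) : Prop where
  separatedAnnuli : SeparatedAnnuli R w
  a_pos : ∀ k, 0 < a k
  dirichlet : ∀ k < n, a k ^ 2 * (R k ^ ((N : ℝ) - 1) / w k) ≤ d
  self_energy : ∀ k < n, ENNReal.ofReal ((a k ^ p) ^ 2) * (∫⁻ y in annulus N (R k) (w k),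
    ∫⁻ z in annulus N (R k) (w k), ENNReal.ofReal (‖y - z‖ ^ (α - N))) ≤ ENNReal.ofReal v
  mutual_energy : ∀ j < n, ∀ k < n, j ≠ k → n * ((a j ^ p * (R j ^ ((N : ℝ) - 1) * w j)) *
    (a k ^ p * (R k ^ ((N : ℝ) - 1) * w k)) * max (R j) (R k) ^ (α - N)) ≤ v
  mass : ∀ k < n, t ≤ a k ^ q * (R k ^ ((N : ℝ) - 1) * w k)

theorem AnnularTest.exists_function {α p q : ℝ} (hα0 : 0 < α) (hαN : α < N) (hp : 0 < p)
    (hq : 0 < q) : ∃ C c : ℝ, 0 < C ∧ 0 < c ∧ ∀ n a R w d v t, 0 ≤ d → 0 ≤ v →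
      AnnularTest N α p q n a R w d v t → ∃ u : EuclideanSpace ℝ (Fin N) → ℝ, ContDiff ℝ ∞ u ∧
        RadiallySymmetric u ∧ ∫⁻ x, ‖fderiv ℝ u x‖ₑ ^ 2 ≤ ENNReal.ofReal (C * (n * d)) ∧
        coulombEnergy α p u ≤ ENNReal.ofReal (C * (n * v)) ∧
        ENNReal.ofReal (c * (n * t)) ≤ ∫⁻ x, ‖u x‖ₑ ^ q := by
  have hN := pos_of_lt_natCast hα0 hαN
  obtain ⟨C₁, hC₁⟩ := SeparatedAnnuli.exists_lintegral_fderiv_le hN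
  obtain ⟨C₂, hC₂⟩ := SeparatedAnnuli.exists_coulombEnergy_le hα0 hαN hp
  obtain ⟨c, hc0, hc⟩ := SeparatedAnnuli.exists_le_lintegral hN hq
  have hle : ∀ (B : ℝ≥0) (n : ℕ) (x : ℝ), B ≤ C₁ + C₂ + 1 → 0 ≤ x →
      (B : ℝ≥0∞) * (n * ENNReal.ofReal x) ≤ ENNReal.ofReal ((C₁ + C₂ + 1 : ℝ≥0) * (n * x)) := by
    intro B n x hB hx
    rw [ENNReal.ofReal_mul (by positivity), ENNReal.ofReal_mul (by positivity),
      ENNReal.ofReal_natCast, ENNReal.ofReal_coe_nnreal]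
    gcongr
  refine ⟨(C₁ + C₂ + 1 : ℝ≥0), c, by positivity, hc0, fun n a R w d v t hd hv h =>
    ⟨annularSum n a R w, SeparatedAnnuli.contDiff_annularSum n a R w,
      SeparatedAnnuli.radiallySymmetric_annularSum n a R w, ?_, ?_, ?_⟩⟩
  · exact (hC₁ R w h.separatedAnnuli n a d h.dirichlet).trans
      (hle _ _ _ (by rw [add_assoc]; exact le_self_add) hd)
  · refine (hC₂ R w h.separatedAnnuli n a v h.a_pos h.self_energy h.mutual_energy).trans
      (hle _ _ _ ?_ hv)
    rw [add_right_comm]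
    exact le_add_self
  · refine le_trans (le_of_eq ?_) (hc R w h.separatedAnnuli n a t h.a_pos h.mass)
    rw [mul_left_comm, ENNReal.ofReal_mul (by positivity), ENNReal.ofReal_natCast]

/-- `exists_scaling` normalizes the superposition to unit energies, so the embedding becomes the
product inequality, evaluated at the energies n d and n v and the mass n t up to constants. -/
theorem EmbedsInLq.exists_le_of_annularTest {α p q : ℝ} (hα0 : 0 < α) (hαN : α < N) (hp : 0 < p)
    (hq : 0 < q) (hΔ : N + α - p * ((N : ℝ) - 2) ≠ 0)
    (h : EmbedsInLq α p q (radialSpace N α p)) :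
    ∃ K : ℝ, 0 ≤ K ∧ ∀ n a R w d v t, 0 < n → 0 < d → 0 < v → AnnularTest N α p q n a R w d v t →
      n * t ≤ K * ((n * d) ^ (interpolationExponent N α p q / 2) *
        (n * v) ^ ((1 - interpolationExponent N α p q) / (2 * p))) ^ q := by
  obtain ⟨C, c, hC, hc, hCc⟩ := AnnularTest.exists_function hα0 hαN hp hq
  obtain ⟨B, hB⟩ := h.exists_lintegral_le (pos_of_lt_natCast hα0 hαN) hp hq
  set s := interpolationExponent N α p q / 2 with hs
  set r := (1 - interpolationExponent N α p q) / (2 * p) with hr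
  refine ⟨B * (C ^ s * C ^ r) ^ q / c, by positivity, fun n a R w d v t hn hd hv ht => ?_⟩
  have hn' : (0 : ℝ) < n := by exact_mod_cast hn
  obtain ⟨u, hu, hur, hD, hV, hm⟩ := hCc n a R w d v t hd.le hv.le ht
  obtain ⟨l, m, hl, hm0, h1, h2, h3⟩ := exists_scaling (N := N) (α := α) (p := p) (q := q) hq hp hΔ
    (show 0 < C * (n * d) by positivity) (show 0 < C * (n * v) by positivity)
  have h4 := hm.trans (hB u hu hur l m hl hm0 (by rwa [h1]) (by rwa [h2]))
  rw [h3, ← hs, ← hr, ← ENNReal.ofReal_coe_nnreal, ← ENNReal.ofReal_mul (by positivity),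
    ENNReal.ofReal_le_ofReal_iff (by positivity), Real.mul_rpow hC.le (by positivity),
    Real.mul_rpow hC.le (by positivity), mul_mul_mul_comm,
    Real.mul_rpow (by positivity) (by positivity)] at h4
  rw [div_mul_eq_mul_div, le_div_iff₀ hc]
  linarith

theorem nonneg_of_le_mul_rpow {c K s T₀ : ℝ} (hc : 0 < c)
    (h : ∀ n : ℕ, T₀ ≤ n → c ≤ K * (n : ℝ) ^ s) : 0 ≤ s := by
  by_contra! hs
  have h1 := ((tendsto_rpow_neg_atTop (neg_pos.2 hs)).comp
    tendsto_natCast_atTop_atTop).const_mul K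
  rw [mul_zero] at h1
  have h2 := ge_of_tendsto h1 (b := c) (by
    filter_upwards [Filter.eventually_ge_atTop ⌈T₀⌉₊] with n hn
    have := h n (Nat.ceil_le.1 hn)
    simpa using this)
  linarith

/-- Many annuli carrying unit energies and masses. -/
theorem EmbedsInLq.one_le_of_forall_annularTest {α p q : ℝ} (hα0 : 0 < α) (hαN : α < N)
    (hp : 0 < p) (hq : 0 < q) (hΔ : N + α - p * ((N : ℝ) - 2) ≠ 0)
    (h : EmbedsInLq α p q (radialSpace N α p)) {v : ℝ} (hv : 0 < v)
    (ht : ∀ n : ℕ, 1 ≤ n → ∃ a R w, AnnularTest N α p q n a R w 1 v 1) :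
    1 ≤ q * (interpolationExponent N α p q / 2 +
      (1 - interpolationExponent N α p q) / (2 * p)) := by
  obtain ⟨K, hK0, hK⟩ := h.exists_le_of_annularTest hα0 hαN hp hq hΔ
  set s := interpolationExponent N α p q / 2 with hs
  set r := (1 - interpolationExponent N α p q) / (2 * p) with hr
  rw [← sub_nonneg]
  refine nonneg_of_le_mul_rpow (K := K * (v ^ r) ^ q) (T₀ := 1) one_pos fun n hn => ?_
  have hn1 : 1 ≤ n := by exact_mod_cast hn
  have hn' : (0 : ℝ) < n := by linarith
  obtain ⟨a, R, w, hT⟩ := ht n hn1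
  have h1 := hK n a R w 1 v 1 hn1 one_pos hv hT
  rw [mul_one, Real.mul_rpow hn'.le hv.le, ← mul_assoc, ← Real.rpow_add hn',
    Real.mul_rpow (by positivity) (by positivity), ← Real.rpow_mul hn'.le, mul_comm _ q] at h1
  rw [Real.rpow_sub_one hn'.ne', ← mul_div_assoc, le_div_iff₀ hn', one_mul]
  linarith

/-- Dilations of a fixed function. -/
theorem EmbedsInLq.between {α p q : ℝ} (hα0 : 0 < α) (hαN : α < N) (hp : 0 < p) (hq : 0 < q)
    (h : EmbedsInLq α p q (radialSpace N α p)) :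
    min (((N : ℝ) - 2) / 2) ((N + α) / (2 * p)) ≤ N / q ∧
      N / q ≤ max (((N : ℝ) - 2) / 2) ((N + α) / (2 * p)) := by
  have hN := pos_of_lt_natCast hα0 hαN
  obtain ⟨C, c, hC, hc, hCc⟩ := AnnularTest.exists_function hα0 hαN hp hq
  obtain ⟨B, hB⟩ := h.exists_lintegral_le hN hp hq
  obtain ⟨E, hE⟩ := exists_annulus_energy_le_of_le hN hα0 hαN.le (Or.inr rfl)
  set E' : ℝ := E * (4 : ℝ) ^ ((N : ℝ) + N - 2)
  have hE' : 0 ≤ E' := by positivity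
  have ht : AnnularTest N α p q 1 (fun _ => 1) (fun k => 4 ^ (k + 1)) (fun _ => 1)
      (4 ^ ((N : ℝ) - 1)) E' (4 ^ ((N : ℝ) - 1)) := by
    refine ⟨⟨fun _ => one_pos, fun k => ?_, fun j k hjk => ?_⟩, fun _ => one_pos, fun k hk => ?_,
      fun k hk => ?_, fun j hj k hk hjk => by omega, fun k hk => ?_⟩
    · rw [pow_succ, mul_div_assoc, div_self (by norm_num), mul_one]
      exact one_le_pow₀ (by norm_num)
    · rcases lt_or_gt_of_ne hjk with h1 | h1
      · left
        rw [mul_comm, ← pow_succ]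
        exact pow_le_pow_right₀ (by norm_num) (by omega)
      · right
        rw [mul_comm, ← pow_succ]
        exact pow_le_pow_right₀ (by norm_num) (by omega)
    · obtain rfl : k = 0 := by omega
      simp
    · obtain rfl : k = 0 := by omega
      have := hE 4 (by norm_num)
      simp only [E']
      rw [ENNReal.ofReal_mul (by positivity), ENNReal.ofReal_coe_nnreal]
      simpa using this
    · obtain rfl : k = 0 := by omega
      simp
  obtain ⟨u, hu, hur, hD, hV, hm⟩ := hCc _ _ _ _ _ _ _ (by positivity) hE' ht
  set D := C * ((1 : ℕ) * (4 : ℝ) ^ ((N : ℝ) - 1)) with hDdef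
  set V := C * ((1 : ℕ) * E') with hVdef
  set t := c * ((1 : ℕ) * (4 : ℝ) ^ ((N : ℝ) - 1)) with htdef
  have hD0 : 0 ≤ D := by positivity
  have hV0 : 0 ≤ V := by positivity
  have ht0 : 0 < t := by positivity
  obtain ⟨b, hb0, hbD, hbV⟩ : ∃ b : ℝ, 0 < b ∧ D ≤ b ^ (2 : ℝ) ∧ V ≤ b ^ (2 * p) := by
    refine ⟨max 1 (max (D ^ (1 / 2 : ℝ)) (V ^ (1 / (2 * p)))), by positivity, ?_, ?_⟩
    · calc D = (D ^ (1 / 2 : ℝ)) ^ (2 : ℝ) := by rw [← Real.rpow_mul hD0]; norm_num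
        _ ≤ _ := by
          gcongr
          exact (le_max_left _ _).trans (le_max_right _ _)
    · calc V = (V ^ (1 / (2 * p))) ^ (2 * p) := by
            rw [← Real.rpow_mul hV0, one_div_mul_cancel (by positivity), Real.rpow_one]
        _ ≤ _ := by
          gcongr
          exact (le_max_right _ _).trans (le_max_right _ _)
  set x := ((N : ℝ) - 2) / 2 with hx
  set y := (N + α) / (2 * p) with hy
  -- Scaling with l = b m^(-e) multiplies the admissible energies by m^(2(x-e)) and m^(2p(y-e)), and
  -- the L^q bound by m^(N-qe). Taking e = min x y with m → ∞, and e = max x y with m → 0, gives the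
  -- two inequalities.
  have key : ∀ e m : ℝ, 0 < m → 1 ≤ m ^ (x - e) → 1 ≤ m ^ (y - e) →
      t ≤ B * b ^ q * m ^ (N - q * e) := by
    intro e m hm0 hxm hym
    have h1 := hm.trans (hB u hu hur (b * m ^ (-e)) m (by positivity) hm0 (hD.trans ?_)
      (hV.trans ?_))
    · rw [← ENNReal.ofReal_coe_nnreal, ← ENNReal.ofReal_mul (by positivity),
        ENNReal.ofReal_le_ofReal_iff (by positivity), Real.mul_rpow hb0.le (by positivity),
        ← Real.rpow_mul hm0.le] at h1
      refine h1.trans (le_of_eq ?_)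
      rw [show (N : ℝ) - q * e = -e * q + N by ring, Real.rpow_add hm0]
      ring
    · refine ENNReal.ofReal_le_ofReal ?_
      have h2 : (b * m ^ (-e)) ^ (2 : ℝ) * m ^ ((N : ℝ) - 2) = b ^ (2 : ℝ) * (m ^ (x - e)) ^ (2 : ℝ) := by
        rw [Real.mul_rpow hb0.le (by positivity), ← Real.rpow_mul hm0.le, ← Real.rpow_mul hm0.le,
          mul_assoc, ← Real.rpow_add hm0, hx]
        ring_nf
      rw [h2]
      exact hbD.trans (le_mul_of_one_le_right (by positivity) (Real.one_le_rpow hxm (by norm_num)))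
    · refine ENNReal.ofReal_le_ofReal ?_
      have h2 : (b * m ^ (-e)) ^ (2 * p) * m ^ (N + α) = b ^ (2 * p) * (m ^ (y - e)) ^ (2 * p) := by
        rw [Real.mul_rpow hb0.le (by positivity), ← Real.rpow_mul hm0.le, ← Real.rpow_mul hm0.le,
          mul_assoc, ← Real.rpow_add hm0, show (y - e) * (2 * p) = -e * (2 * p) + (N + α) by
            rw [hy]; field_simp; ring]
      rw [h2]
      exact hbV.trans (le_mul_of_one_le_right (by positivity)
        (Real.one_le_rpow hym (by positivity)))
  constructor
  · rw [le_div_iff₀ hq, mul_comm, ← sub_nonneg]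
    refine nonneg_of_le_mul_rpow (T₀ := 1) ht0 fun n hn => key _ n (by linarith) ?_ ?_
    · exact Real.one_le_rpow hn (sub_nonneg.2 (min_le_left _ _))
    · exact Real.one_le_rpow hn (sub_nonneg.2 (min_le_right _ _))
  · rw [div_le_iff₀ hq, mul_comm, ← sub_nonneg]
    refine nonneg_of_le_mul_rpow (K := B * b ^ q) (T₀ := 1) ht0 fun n hn => ?_
    have hn0 : (0 : ℝ) < n := by linarith
    have := key (max x y) (n : ℝ)⁻¹ (by positivity) ?_ ?_
    · rwa [Real.inv_rpow hn0.le, ← Real.rpow_neg hn0.le, neg_sub] at this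
    · rw [Real.inv_rpow hn0.le, ← Real.rpow_neg hn0.le, neg_sub]
      exact Real.one_le_rpow hn (sub_nonneg.2 (le_max_left _ _))
    · rw [Real.inv_rpow hn0.le, ← Real.rpow_neg hn0.le, neg_sub]
      exact Real.one_le_rpow hn (sub_nonneg.2 (le_max_right _ _))


/-- For `α ≤ 1` and `N ≥ 2`, a single annulus of unit width and large radius. -/
theorem EmbedsInLq.one_le_of_le_one_of_two_le {α p q : ℝ} (hα0 : 0 < α) (hα1 : α ≤ 1)
    (hN : 2 ≤ N) (hp : 0 < p) (hq : 0 < q) (hΔ : N + α - p * ((N : ℝ) - 2) ≠ 0)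
    (h : EmbedsInLq α p q (radialSpace N α p)) :
    1 ≤ q * (interpolationExponent N α p q / 2 +
      (1 - interpolationExponent N α p q) / (2 * p)) := by
  have hN2 : (2 : ℝ) ≤ N := by exact_mod_cast hN
  obtain ⟨K, hK0, hK⟩ := h.exists_le_of_annularTest hα0 (by linarith) hp hq hΔ
  set s := interpolationExponent N α p q / 2 with hs
  set r := (1 - interpolationExponent N α p q) / (2 * p) with hr
  -- A single annulus of unit width and radius n, whose self-energy is bounded with the kernel of
  -- order β = 1+ε. Comparing powers of n gives an inequality that, as ε → 0, becomes the claim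
  -- multiplied by N - 1.
  have key : ∀ ε : ℝ, 0 < ε → ε < 1 → 0 ≤ ((N - 1) * s + (N - 1 + ε) * r) * q - (N - 1) := by
    intro ε hε0 hε1
    obtain ⟨E, hE⟩ := exists_annulus_energy_le_of_le (N := N) (α := α) (β := 1 + ε) (by omega) hα0
      (by linarith) (Or.inl ⟨by linarith, by linarith⟩)
    refine nonneg_of_le_mul_rpow (K := K * ((E + 1 : ℝ) ^ r) ^ q) (T₀ := 4) one_pos fun n hn => ?_
    have hn0 : (0 : ℝ) < n := by linarith
    have hT : AnnularTest N α p q 1 (fun _ => 1) (fun k => n * 4 ^ k) (fun _ => 1)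
        ((n : ℝ) ^ ((N : ℝ) - 1)) ((E + 1) * (n : ℝ) ^ ((N : ℝ) - 1 + ε))
        ((n : ℝ) ^ ((N : ℝ) - 1)) := by
      refine ⟨⟨fun _ => one_pos, fun k => ?_, fun j k hjk => ?_⟩, fun _ => one_pos, fun k hk => ?_,
        fun k hk => ?_, fun j hj k hk hjk => by omega, fun k hk => ?_⟩
      · rw [le_div_iff₀ (by norm_num), one_mul]
        exact hn.trans (le_mul_of_one_le_right hn0.le (one_le_pow₀ (by norm_num)))
      · rcases lt_or_gt_of_ne hjk with h1 | h1
        · left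
          rw [mul_left_comm, mul_comm (4 : ℝ), ← pow_succ]
          exact mul_le_mul_of_nonneg_left (pow_le_pow_right₀ (by norm_num) (by omega)) hn0.le
        · right
          rw [mul_left_comm, mul_comm (4 : ℝ), ← pow_succ]
          exact mul_le_mul_of_nonneg_left (pow_le_pow_right₀ (by norm_num) (by omega)) hn0.le
      · obtain rfl : k = 0 := by omega
        simp
      · obtain rfl : k = 0 := by omega
        have h1 := hE n (by linarith)
        have h2 : (E : ℝ≥0∞) ≤ ENNReal.ofReal (E + 1) := by
          rw [← ENNReal.ofReal_coe_nnreal]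
          exact ENNReal.ofReal_le_ofReal (by linarith)
        rw [ENNReal.ofReal_mul (by positivity), show (N : ℝ) - 1 + ε = N + (1 + ε) - 2 by ring]
        simp only [Real.one_rpow, one_pow, ENNReal.ofReal_one, one_mul, pow_zero, mul_one]
        exact h1.trans (by gcongr)
      · obtain rfl : k = 0 := by omega
        simp
    have h1 := hK _ _ _ _ _ _ _ one_pos (by positivity) (by positivity) hT
    have h2 : ((n : ℝ) ^ ((N : ℝ) - 1)) ^ s * ((E + 1) * (n : ℝ) ^ ((N : ℝ) - 1 + ε)) ^ r =
        (E + 1 : ℝ) ^ r * (n : ℝ) ^ ((N - 1) * s + (N - 1 + ε) * r) := by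
      rw [Real.mul_rpow (by positivity) (by positivity), ← Real.rpow_mul hn0.le,
        ← Real.rpow_mul hn0.le, Real.rpow_add hn0]
      ring
    simp only [Nat.cast_one, one_mul] at h1
    rw [h2, Real.mul_rpow (by positivity) (by positivity), ← Real.rpow_mul hn0.le,
      ← mul_assoc] at h1
    rw [Real.rpow_sub hn0, ← mul_div_assoc, one_le_div (by positivity)]
    exact h1
  by_contra! hlt
  set δ := (N - 1) * (1 - q * (s + r)) with hδ
  have hδ0 : 0 < δ := mul_pos (by linarith) (by linarith)
  -- If the claim failed by δ, an ε with ε|rq| ≤ δ/2 would contradict `key`; the minimum with 1/2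
  -- keeps 1+ε below N.
  set ε := min (1 / 2) (δ / (2 * (|r * q| + 1))) with hε
  have hε0 : 0 < ε := by positivity
  have h1 := key ε hε0 ((min_le_left _ _).trans_lt (by norm_num))
  have h2 : ε * (r * q) ≤ δ / 2 := by
    calc ε * (r * q) ≤ ε * (|r * q| + 1) := by
          gcongr
          linarith [le_abs_self (r * q)]
      _ ≤ δ / (2 * (|r * q| + 1)) * (|r * q| + 1) := by
          gcongr
          exact min_le_right _ _
      _ = δ / 2 := by field_simp
  have h3 : ((N - 1) * s + (N - 1 + ε) * r) * q - (N - 1) = ε * (r * q) - δ := by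
    rw [hδ]; ring
  linarith

/-- Supplies the ratio of consecutive radii: depending on n, it is so large that each of the n
interactions is at most 1/n. -/
theorem exists_large_base {γ : ℝ} (hγ : 0 < γ) (b : ℝ) {n : ℕ} (hn : 1 ≤ n) :
    ∃ Λ : ℝ, 4 ≤ Λ ∧ b ≤ Λ ∧ n * Λ ^ (-γ) ≤ 1 := by
  have hn0 : (0 : ℝ) < n := by exact_mod_cast hn
  refine ⟨max (max 4 b) ((n : ℝ) ^ (1 / γ)), ?_, ?_, ?_⟩
  · exact (le_max_left _ _).trans (le_max_left _ _)
  · exact (le_max_right _ _).trans (le_max_left _ _)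
  · have h0 : (0 : ℝ) < max (max 4 b) ((n : ℝ) ^ (1 / γ)) := by positivity
    rw [Real.rpow_neg h0.le, ← div_eq_mul_inv, div_le_one (by positivity)]
    calc (n : ℝ) = ((n : ℝ) ^ (1 / γ)) ^ γ := by
          rw [← Real.rpow_mul hn0.le, one_div_mul_cancel hγ.ne', Real.rpow_one]
      _ ≤ _ := by
          gcongr
          exact le_max_right _ _

/-- For `α < 1 = N`, many intervals of unit length, far apart. -/
theorem EmbedsInLq.one_le_of_dim_eq_one {α p q : ℝ} (hα0 : 0 < α) (hα1 : α < 1) (hN : N = 1)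
    (hp : 0 < p) (hq : 0 < q) (hΔ : N + α - p * ((N : ℝ) - 2) ≠ 0)
    (h : EmbedsInLq α p q (radialSpace N α p)) :
    1 ≤ q * (interpolationExponent N α p q / 2 +
      (1 - interpolationExponent N α p q) / (2 * p)) := by
  subst hN
  obtain ⟨E, hE⟩ := exists_annulus_energy_le_of_le (N := 1) (α := α) (β := 1) one_pos hα0
    hα1.le (Or.inr (by norm_num))
  refine h.one_le_of_forall_annularTest hα0 (by simpa using hα1) hp hq hΔ
    (v := E + 1) (by positivity) fun n hn => ?_
  -- In dimension 1 with β = 1 the self-energy bound has the factor R^(N+β-2) = R^0, so radii can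
  -- grow freely. Interactions are then at most Λ^(-(1-α)) ≤ 1/n.
  obtain ⟨Λ, hΛ4, -, hΛn⟩ := exists_large_base (sub_pos.2 hα1) 0 hn
  have hΛ1 : 1 ≤ Λ := by linarith
  have hΛ0 : 0 < Λ := by linarith
  have hR : ∀ k : ℕ, Λ ≤ Λ ^ (k + 1) := fun k => le_self_pow₀ hΛ1 (by omega)
  have hsep : ∀ j k : ℕ, j < k → 4 * Λ ^ (j + 1) ≤ Λ ^ (k + 1) := by
    intro j k hjk
    calc 4 * Λ ^ (j + 1) ≤ Λ * Λ ^ (j + 1) := by gcongr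
      _ = Λ ^ (j + 2) := by ring
      _ ≤ _ := pow_le_pow_right₀ hΛ1 (by omega)
  refine ⟨fun _ => 1, fun k => Λ ^ (k + 1), fun _ => 1, ⟨fun _ => one_pos, fun k => ?_,
    fun j k hjk => ?_⟩, fun _ => one_pos, fun k _ => ?_, fun k _ => ?_, fun j _ k _ hjk => ?_,
    fun k _ => ?_⟩
  · rw [le_div_iff₀ (by norm_num), one_mul]
    exact hΛ4.trans (hR k)
  · rcases lt_or_gt_of_ne hjk with h1 | h1
    · exact Or.inl (hsep j k h1)
    · exact Or.inr (hsep k j h1)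
  · simp
  · have h1 := hE (Λ ^ (k + 1)) (by linarith [hR k])
    rw [show ((1 : ℕ) : ℝ) + 1 - 2 = 0 by norm_num, Real.rpow_zero, ENNReal.ofReal_one,
      mul_one] at h1
    simp only [Real.one_rpow, one_pow, ENNReal.ofReal_one, one_mul]
    refine h1.trans ?_
    rw [← ENNReal.ofReal_coe_nnreal]
    exact ENNReal.ofReal_le_ofReal (by linarith)
  · simp only [Nat.cast_one, sub_self, Real.rpow_zero, Real.one_rpow, mul_one, one_mul]
    have h1 : max (Λ ^ (j + 1)) (Λ ^ (k + 1)) ^ (α - 1) ≤ Λ ^ (-(1 - α)) := by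
      rw [neg_sub]
      exact Real.rpow_le_rpow_of_nonpos hΛ0 ((hR j).trans (le_max_left _ _)) (by linarith)
    calc _ ≤ (n : ℝ) * Λ ^ (-(1 - α)) := by gcongr
      _ ≤ 1 := hΛn
      _ ≤ _ := by linarith [E.coe_nonneg]
  · simp

open RadialBounds in
/-- For `α > 1`, many thin annuli with radii in geometric progression. -/
theorem EmbedsInLq.one_le_of_one_lt {α p q τ : ℝ} (hα1 : 1 < α) (hαN : α < N)
    (hp : 0 < p) (hq : 0 < q) (hΔ : N + α - p * ((N : ℝ) - 2) ≠ 0)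
    (hτ : τ = 1 ∨ τ = -1) (hω : 0 < τ * (1 - widthExponent N α p))
    (hκ : 0 ≤ τ * (((N : ℝ) - α) / 2 - decayExponent N α p * (q - p)))
    (h : EmbedsInLq α p q (radialSpace N α p)) :
    1 ≤ q * (interpolationExponent N α p q / 2 +
      (1 - interpolationExponent N α p q) / (2 * p)) := by
  have hα0 : 0 < α := by linarith
  have hN := pos_of_lt_natCast hα0 hαN
  have hp2 : p + 2 ≠ 0 := by positivity
  obtain ⟨E, hE⟩ := exists_annulus_energy_le (N := N) (β := α) hN (Or.inl ⟨hα1, hαN⟩)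
  set σ := widthExponent N α p with hωd
  set κ := decayExponent N α p with hκd
  -- With amplitude R^(-κ) and width R^σ, `e1` says that the Dirichlet energy of a bump does not
  -- depend on R, and `e2` that its p-mass is R^((N-α)/2).
  have e1 : -2 * κ + (N - 1) - σ = 0 := by
    rw [hωd, hκd, widthExponent, decayExponent]
    field_simp
    ring
  have e2 : -κ * p + (N - 1 + σ) = ((N : ℝ) - α) / 2 := by
    rw [hωd, hκd, widthExponent, decayExponent]
    field_simp
    ring
  have hNα : 0 < ((N : ℝ) - α) / 2 := by linarith
  refine h.one_le_of_forall_annularTest hα0 hαN hp hq hΔ (v := E + 1) (by positivity)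
    fun n hn => ?_
  -- The radii Λ^(τ(k+1)) tend to ∞ or to 0 according to τ. Being thin means R^(1-σ) ≥ 4, which by
  -- τ(1-σ) > 0 holds once Λ^(τ(1-σ)) ≥ 4.
  obtain ⟨Λ, hΛ4, hΛω, hΛn⟩ := exists_large_base hNα (4 ^ (1 / (τ * (1 - σ)))) hn
  have hΛ1 : 1 ≤ Λ := by linarith
  have hΛ0 : 0 < Λ := by linarith
  set R : ℕ → ℝ := fun k => Λ ^ (τ * (k + 1)) with hR
  have hR0 : ∀ k, 0 < R k := fun k => Real.rpow_pos_of_pos hΛ0 _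
  have hRpow : ∀ k x, R k ^ x = Λ ^ (τ * x * (k + 1)) := fun k x => by
    rw [hR, ← Real.rpow_mul hΛ0.le]
    ring_nf
  have hone : ∀ k x, 0 ≤ τ * x → 1 ≤ R k ^ x := fun k x hx => by
    rw [hRpow]
    exact Real.one_le_rpow hΛ1 (by positivity)
  have hratio : ∀ j k, j ≠ k → Λ * R j ≤ R k ∨ Λ * R k ≤ R j := by
    have h1 : ∀ j k : ℕ, τ * (j + 1) + 1 ≤ τ * (k + 1) → Λ * R j ≤ R k := fun j k hjk => by
      rw [mul_comm, ← Real.rpow_add_one hΛ0.ne']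
      exact Real.rpow_le_rpow_of_exponent_le hΛ1 hjk
    intro j k hjk
    have h2 : ((j : ℝ) + 1 ≤ k) ∨ ((k : ℝ) + 1 ≤ j) := by
      rcases lt_or_gt_of_ne hjk with h | h
      · left; exact_mod_cast h
      · right; exact_mod_cast h
    rcases hτ with rfl | rfl <;> rcases h2 with h2 | h2
    · exact Or.inl (h1 j k (by linarith))
    · exact Or.inr (h1 k j (by linarith))
    · exact Or.inr (h1 k j (by linarith))
    · exact Or.inl (h1 j k (by linarith))
  have hmassk : ∀ k, (R k ^ (-κ)) ^ p * (R k ^ ((N : ℝ) - 1) * R k ^ σ) =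
      R k ^ (((N : ℝ) - α) / 2) := fun k => by
    rw [← Real.rpow_mul (hR0 k).le, ← Real.rpow_add (hR0 k), ← Real.rpow_add (hR0 k), e2]
  have hwR : ∀ k, R k ^ σ ≤ R k / 4 := fun k => by
    rw [le_div_iff₀ (by norm_num), mul_comm, ← le_div_iff₀ (Real.rpow_pos_of_pos (hR0 k) _)]
    have h1 : R k / R k ^ σ = Λ ^ (τ * (1 - σ) * (k + 1)) := by
      rw [← hRpow, Real.rpow_sub (hR0 k), Real.rpow_one]
    rw [h1]
    calc (4 : ℝ) = (4 ^ (1 / (τ * (1 - σ)))) ^ (τ * (1 - σ)) := by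
          rw [← Real.rpow_mul (by norm_num), one_div_mul_cancel hω.ne', Real.rpow_one]
      _ ≤ Λ ^ (τ * (1 - σ)) := by gcongr
      _ ≤ _ := Real.rpow_le_rpow_of_exponent_le hΛ1 (le_mul_of_one_le_right hω.le (by simp))
  refine ⟨fun k => R k ^ (-κ), R, fun k => R k ^ σ, ⟨fun k => Real.rpow_pos_of_pos (hR0 k) _,
    hwR, fun j k hjk => ?_⟩, fun k => Real.rpow_pos_of_pos (hR0 k) _, fun k _ => ?_,
    fun k _ => ?_, fun j _ k _ hjk => ?_, fun k _ => ?_⟩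
  · rcases hratio j k hjk with h1 | h1
    · left
      exact le_trans (mul_le_mul_of_nonneg_right hΛ4 (hR0 j).le) h1
    · right
      exact le_trans (mul_le_mul_of_nonneg_right hΛ4 (hR0 k).le) h1
  · refine le_of_eq ?_
    rw [← Real.rpow_natCast, ← Real.rpow_mul (hR0 k).le, ← Real.rpow_sub (hR0 k),
      ← Real.rpow_add (hR0 k), show -κ * ((2 : ℕ) : ℝ) + ((N : ℝ) - 1 - σ) = 0 by
        push_cast; linarith, Real.rpow_zero]
  · have hw4 : R k ^ σ ≤ R k / 2 := (hwR k).trans (by linarith [hR0 k])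
    refine (mul_le_mul_right (hE (R k) (R k ^ σ) (Real.rpow_pos_of_pos (hR0 k) _) hw4) _).trans ?_
    -- The self-energy is of order (p-mass)² R^(α-N), and the p-mass R^((N-α)/2) makes this exactly
    -- 1.
    have h2 : ((R k ^ (-κ)) ^ p) ^ 2 * ((R k ^ σ) ^ 2 * R k ^ (N + α - 2)) = 1 := by
      have h3 : R k ^ (N + α - 2) = (R k ^ ((N : ℝ) - 1)) ^ 2 * R k ^ (α - N) := by
        rw [← Real.rpow_natCast, ← Real.rpow_mul (hR0 k).le, ← Real.rpow_add (hR0 k)]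
        congr 1
        push_cast
        ring
      calc _ = ((R k ^ (-κ)) ^ p * (R k ^ ((N : ℝ) - 1) * R k ^ σ)) ^ 2 * R k ^ (α - N) := by
            rw [h3]; ring
        _ = 1 := by
            rw [hmassk, ← Real.rpow_natCast, ← Real.rpow_mul (hR0 k).le, ← Real.rpow_add (hR0 k),
              show ((N : ℝ) - α) / 2 * ((2 : ℕ) : ℝ) + (α - N) = 0 by push_cast; ring,
              Real.rpow_zero]
    rw [mul_left_comm, ← ENNReal.ofReal_mul (by positivity), h2, ENNReal.ofReal_one, mul_one,
      ← ENNReal.ofReal_coe_nnreal]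
    exact ENNReal.ofReal_le_ofReal (by linarith)
  · rw [hmassk, hmassk]
    -- The interaction of radii a < b is (a/b)^((N-α)/2), at most Λ^(-(N-α)/2).
    have h1 : ∀ a b : ℝ, 0 < a → 0 < b → Λ * a ≤ b →
        a ^ (((N : ℝ) - α) / 2) * b ^ (((N : ℝ) - α) / 2) * b ^ (α - N) ≤
          Λ ^ (-(((N : ℝ) - α) / 2)) := by
      intro a b ha hb hab
      rw [mul_assoc, ← Real.rpow_add hb, show ((N : ℝ) - α) / 2 + (α - N) =
        -(((N : ℝ) - α) / 2) by ring, Real.rpow_neg hb.le, Real.rpow_neg hΛ0.le,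
        ← div_eq_mul_inv, div_le_iff₀ (by positivity), inv_mul_eq_div, le_div_iff₀ (by positivity),
        ← Real.mul_rpow ha.le hΛ0.le]
      exact Real.rpow_le_rpow (by positivity) (by linarith) hNα.le
    have h2 : R j ^ (((N : ℝ) - α) / 2) * R k ^ (((N : ℝ) - α) / 2) * max (R j) (R k) ^ (α - N) ≤
        Λ ^ (-(((N : ℝ) - α) / 2)) := by
      rcases hratio j k hjk with h3 | h3
      · have : R j ≤ R k := le_trans (le_mul_of_one_le_left (hR0 j).le hΛ1) h3
        rw [max_eq_right this]
        exact h1 _ _ (hR0 j) (hR0 k) h3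
      · have : R k ≤ R j := le_trans (le_mul_of_one_le_left (hR0 k).le hΛ1) h3
        rw [max_eq_left this, mul_comm (R j ^ _)]
        exact h1 _ _ (hR0 k) (hR0 j) h3
    calc _ ≤ (n : ℝ) * Λ ^ (-(((N : ℝ) - α) / 2)) := mul_le_mul_of_nonneg_left h2 (by positivity)
      _ ≤ 1 := hΛn
      _ ≤ _ := by linarith [E.coe_nonneg]
  · rw [← Real.rpow_mul (hR0 k).le, ← Real.rpow_add (hR0 k), ← Real.rpow_add (hR0 k)]
    refine hone k _ ?_
    rw [show -κ * q + (N - 1 + σ) = ((N : ℝ) - α) / 2 - κ * (q - p) by rw [← e2]; ring]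
    exact hκ


/-! ### Comparison of exponents and conclusion. -/

/-- The condition obtained from annuli says that q ≥ q₀ if Δ > 0 and q ≤ q₀ if Δ < 0, with q₀ =
`endpointExponent α p`. -/
theorem one_le_interpolation_iff {α p q : ℝ} (hp : 0 < p) (hq : 0 < q)
    (hΔ : N + α - p * ((N : ℝ) - 2) ≠ 0) :
    1 ≤ q * (interpolationExponent N α p q / 2 + (1 - interpolationExponent N α p q) / (2 * p)) ↔
      0 ≤ ((2 + α) * q - 2 * (2 * p + α)) / (2 * (N + α - p * ((N : ℝ) - 2))) := by
  have h : q * (interpolationExponent N α p q / 2 + (1 - interpolationExponent N α p q) / (2 * p))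
      - 1 = ((2 + α) * q - 2 * (2 * p + α)) / (2 * (N + α - p * ((N : ℝ) - 2))) := by
    unfold interpolationExponent
    field_simp
    ring
  rw [← h, sub_nonneg]

/-- The sign of Δ decides which of (N-2)/2 and (N+α)/(2p) is the smaller one in
`EmbedsInLq.between`. -/
theorem EmbedsInLq.sobolev_relation {α p q : ℝ} (hα0 : 0 < α) (hαN : α < N) (hp : 0 < p)
    (hq : 0 < q) (h : EmbedsInLq α p q (radialSpace N α p)) :
    (p * ((N : ℝ) - 2) ≤ N + α → ((N : ℝ) - 2) / 2 ≤ N / q) ∧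
      (N + α ≤ p * ((N : ℝ) - 2) → N / q ≤ ((N : ℝ) - 2) / 2) := by
  obtain ⟨h1, h2⟩ := h.between hα0 hαN hp hq
  constructor <;> intro h3
  · rwa [min_eq_left (by rw [div_le_div_iff₀ (by norm_num) (by positivity)]; linarith)] at h1
  · rwa [max_eq_left (by rw [div_le_div_iff₀ (by positivity) (by norm_num)]; linarith)] at h2

theorem two_lt_of_le_mul {α p : ℝ} (hα0 : 0 < α) (hp : 0 < p)
    (h : N + α ≤ p * ((N : ℝ) - 2)) : 2 < N := by
  have h1 : 0 < p * ((N : ℝ) - 2) := lt_of_lt_of_le (by positivity) h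
  have h2 : (2 : ℝ) < N := by linarith [pos_of_mul_pos_right h1 hp.le]
  exact_mod_cast h2

theorem EmbedsInLq.one_le_of_le_one {α p q : ℝ} (hα0 : 0 < α) (hαN : α < N) (hα1 : α ≤ 1)
    (hp : 0 < p) (hq : 0 < q) (hΔ : N + α - p * ((N : ℝ) - 2) ≠ 0)
    (h : EmbedsInLq α p q (radialSpace N α p)) :
    1 ≤ q * (interpolationExponent N α p q / 2 +
      (1 - interpolationExponent N α p q) / (2 * p)) := by
  rcases Nat.lt_or_ge N 2 with h2 | h2
  · have hN1 : N = 1 := by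
      have := pos_of_lt_natCast hα0 hαN
      omega
    exact h.one_le_of_dim_eq_one hα0 (by rw [hN1] at hαN; exact_mod_cast hαN) hN1 hp hq hΔ
  · exact h.one_le_of_le_one_of_two_le hα0 hα1 h2 hp hq hΔ

/-- For `α ≤ 1`, a radial embedding only holds in the range of exponents of the nonradial one. -/
theorem EmbedsInLq.normalizedBound_of_le_one {α p q : ℝ} (hα0 : 0 < α) (hαN : α < N)
    (hα1 : α ≤ 1) (hp : 1 ≤ p) (hq : 1 ≤ q) (h : EmbedsInLq α p q (radialSpace N α p))
    (P : (EuclideanSpace ℝ (Fin N) → ℝ) → Prop) : NormalizedBound α p q P := by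
  have hp0 : 0 < p := by linarith
  have hq0 : 0 < q := by linarith
  have hN := pos_of_lt_natCast hα0 hαN
  obtain ⟨h1, h2⟩ := h.sobolev_relation hα0 hαN hp0 hq0
  have hle : ∀ hN3 : 2 < N, ((N : ℝ) - 2) / 2 ≤ N / q → q ≤ 2 * N / ((N : ℝ) - 2) := by
    intro hN3 hz
    have hN3' : (2 : ℝ) < N := by exact_mod_cast hN3
    rw [div_le_div_iff₀ (by norm_num) hq0] at hz
    rw [le_div_iff₀ (by linarith)]
    linarith
  have hge : ∀ hN3 : 2 < N, N / q ≤ ((N : ℝ) - 2) / 2 → 2 * N / ((N : ℝ) - 2) ≤ q := by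
    intro hN3 hz
    have hN3' : (2 : ℝ) < N := by exact_mod_cast hN3
    rw [div_le_div_iff₀ hq0 (by norm_num)] at hz
    rw [div_le_iff₀ (by linarith)]
    linarith
  rcases lt_trichotomy (N + α - p * ((N : ℝ) - 2)) 0 with hΔ | hΔ | hΔ
  · have hN3 : 2 < N := two_lt_of_le_mul hα0 hp0 (by linarith)
    have h3 := (one_le_interpolation_iff hp0 hq0 hΔ.ne).1 (h.one_le_of_le_one hα0 hαN hα1 hp0 hq0
      hΔ.ne)
    -- Hence q lies between the Sobolev exponent and q₀; for Δ < 0 these occur in the order 2N/(N-2)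
    -- ≤ q ≤ q₀.
    have h4 : (2 + α) * q - 2 * (2 * p + α) ≤ 0 := by
      by_contra! h5
      exact absurd h3 (not_le.2 (div_neg_of_pos_of_neg h5 (by linarith)))
    refine (normalizedBound_sobolev hα0 hαN hp hN3 P).of_between
      (normalizedBound_endpoint hα0 hαN hp P) (hge hN3 (h2 (by linarith))) ?_
    rw [endpointExponent, le_div_iff₀ (by linarith)]
    linarith
  · have hN3 : 2 < N := two_lt_of_le_mul hα0 hp0 (by linarith)
    rw [le_antisymm (hle hN3 (h1 (by linarith))) (hge hN3 (h2 (by linarith)))]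
    exact normalizedBound_sobolev hα0 hαN hp hN3 P
  · have h3 := (one_le_interpolation_iff hp0 hq0 hΔ.ne').1 (h.one_le_of_le_one hα0 hαN hα1 hp0 hq0
      hΔ.ne')
    have h4 : 0 ≤ (2 + α) * q - 2 * (2 * p + α) := by
      by_contra! h5
      exact absurd h3 (not_le.2 (div_neg_of_neg_of_pos h5 (by linarith)))
    have h5 : endpointExponent α p ≤ q := by
      rw [endpointExponent, div_le_iff₀ (by linarith)]
      linarith
    rcases Nat.lt_or_ge 2 N with hN3 | hN3
    · exact (normalizedBound_endpoint hα0 hαN hp P).of_between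
        (normalizedBound_sobolev hα0 hαN hp hN3 P) h5 (hle hN3 (h1 (by linarith)))
    · exact normalizedBound_of_dim_le_two hα0 hαN hp hN3 h5 P

/-- For `α > 1`, the necessary condition for a radial embedding. -/
theorem EmbedsInLq.qRad_or {α p q : ℝ} (hα1 : 1 < α) (hαN : α < N) (hp : 1 ≤ p) (hq : 1 ≤ q)
    (h : EmbedsInLq α p q (radialSpace N α p)) :
    QRad N α p q ∨ (p * ((N : ℝ) - 2) = N + α ∧ 1 / q = 1 / 2 - 1 / (N : ℝ)) := by
  have hα0 : 0 < α := by linarith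
  have hp0 : 0 < p := by linarith
  have hq0 : 0 < q := by linarith
  have hN := pos_of_lt_natCast hα0 hαN
  have hN1 : 1 < N := by exact_mod_cast hα1.trans hαN
  have hN2 : (2 : ℝ) ≤ N := by exact_mod_cast hN1
  have hN0 : (0 : ℝ) < N := by linarith
  obtain ⟨h1, h2⟩ := h.sobolev_relation hα0 hαN hp0 hq0
  have hz : (N : ℝ) / q = N * (1 / q) := by ring
  have hx : ((N : ℝ) - 2) / 2 = N * (1 / 2 - 1 / N) := by field_simp
  rw [hz, hx, mul_le_mul_iff_right₀ hN0] at h1 h2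
  have hc : 0 < 2 * (2 * p * ((N : ℝ) - 1) + N - α) := by
    have : 0 ≤ 2 * p * ((N : ℝ) - 1) := by
      have : 0 ≤ (N : ℝ) - 1 := by linarith
      positivity
    linarith
  -- This identity places the radial threshold strictly beyond 1/q₀ when α > 1 and Δ ≠ 0. If the
  -- strict inequality of `QRad` failed, the annuli would force q to the nonradial side of q₀,
  -- contradicting the sign of the right-hand side.
  have key : (3 * N + α - 4) * (2 * (2 * p + α)) -
      (2 + α) * (2 * (2 * p * ((N : ℝ) - 1) + N - α)) =
        4 * (α - 1) * (N + α - p * ((N : ℝ) - 2)) := by ring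
  have hb : 0 < 3 * N + α - 4 := by linarith
  unfold QRad
  rw [max_eq_left (by linarith)]
  rcases lt_trichotomy (N + α - p * ((N : ℝ) - 2)) 0 with hΔ | hΔ | hΔ
  · refine Or.inl (Or.inr ⟨?_, h2 (by linarith), ?_⟩)
    · rw [div_le_div_iff₀ hp0 (by linarith)]
      linarith
    · by_contra! hX
      rw [div_le_div_iff₀ hq0 hc] at hX
      have h3 := (one_le_interpolation_iff hp0 hq0 hΔ.ne).1 (h.one_le_of_one_lt (τ := -1) hα1 hαN
        hp0 hq0 hΔ.ne (Or.inr rfl) ?_ ?_)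
      · have h4 : (2 + α) * q - 2 * (2 * p + α) ≤ 0 := by
          by_contra! h5
          exact absurd h3 (not_le.2 (div_neg_of_pos_of_neg h5 (by linarith)))
        have h5 : 4 * (α - 1) * (N + α - p * ((N : ℝ) - 2)) < 0 :=
          mul_neg_of_pos_of_neg (by linarith) hΔ
        have h6 := mul_le_mul_of_nonneg_left hX (show 0 ≤ 2 + α by linarith)
        have h7 := mul_le_mul_of_nonneg_left h4 hb.le
        linarith
      · unfold RadialBounds.widthExponent
        have : 1 < (p * ((N : ℝ) - 1) - (N - 2 + α)) / (p + 2) := by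
          rw [one_lt_div (by linarith)]
          linarith
        linarith
      · unfold RadialBounds.decayExponent
        have : ((N : ℝ) - α) / 2 ≤ (3 * N + α - 4) / (2 * (p + 2)) * (q - p) := by
          rw [div_mul_eq_mul_div, div_le_div_iff₀ (by norm_num) (by linarith)]
          linarith
        linarith
  · exact Or.inr ⟨by linarith, le_antisymm (h2 (by linarith)) (h1 (by linarith))⟩
  · refine Or.inl (Or.inl ⟨?_, h1 (by linarith), ?_⟩)
    · rw [ge_iff_le, div_le_div_iff₀ (by linarith) hp0]
      linarith
    · by_contra! hX
      rw [div_le_div_iff₀ hc hq0] at hX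
      have h3 := (one_le_interpolation_iff hp0 hq0 hΔ.ne').1 (h.one_le_of_one_lt (τ := 1) hα1 hαN
        hp0 hq0 hΔ.ne' (Or.inl rfl) ?_ ?_)
      · have h4 : 0 ≤ (2 + α) * q - 2 * (2 * p + α) := by
          by_contra! h5
          exact absurd h3 (not_le.2 (div_neg_of_neg_of_pos h5 (by linarith)))
        have h5 : 0 < 4 * (α - 1) * (N + α - p * ((N : ℝ) - 2)) := mul_pos (by linarith) hΔ
        have h6 := mul_le_mul_of_nonneg_left hX (show 0 ≤ 2 + α by linarith)
        have h7 := mul_le_mul_of_nonneg_left h4 hb.le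
        linarith
      · unfold RadialBounds.widthExponent
        have : (p * ((N : ℝ) - 1) - (N - 2 + α)) / (p + 2) < 1 := by
          rw [div_lt_one (by linarith)]
          linarith
        linarith
      · unfold RadialBounds.decayExponent
        have : (3 * N + α - 4) / (2 * (p + 2)) * (q - p) ≤ ((N : ℝ) - α) / 2 := by
          rw [div_mul_eq_mul_div, div_le_div_iff₀ (by linarith) (by norm_num)]
          linarith
        linarith

theorem EmbedsInLq.mono {α p q : ℝ} {X Y : Set (EuclideanSpace ℝ (Fin N) → ℝ)} (hXY : X ⊆ Y)
    (h : EmbedsInLq α p q Y) : EmbedsInLq α p q X := by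
  obtain ⟨C, hC⟩ := h
  exact ⟨C, fun u hu => hC u (hXY hu)⟩

theorem NormalizedBound.embedsInLq_space {α p q : ℝ} (hp : 1 ≤ p) (hq : 0 < q)
    (h : NormalizedBound (N := N) α p q fun _ => True) : EmbedsInLq α p q (space N α p) :=
  h.embedsInLq hp hq (fun _ _ _ _ => trivial) subset_rfl fun _ _ _ _ => trivial

theorem NormalizedBound.embedsInLq_radialSpace {α p q : ℝ} (hp : 1 ≤ p) (hq : 0 < q)
    (h : NormalizedBound (N := N) α p q RadiallySymmetric) :
    EmbedsInLq α p q (radialSpace N α p) :=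
  h.embedsInLq hp hq dilationInvariant_radiallySymmetric (fun _ hu => hu.1)
    fun _ hu ε _ => hu.2.radiallySymmetric_mollify ε

end CoulombSobolev

end

theorem mainTheorem4 (N : ℕ) (α p q : ℝ) (hα0 : 0 < α) (hαN : α < N)
    (hp : 1 ≤ p) (hq : 1 ≤ q) :
    (α ≤ 1 →
      (CoulombSobolev.EmbedsInLq α p q (CoulombSobolev.radialSpace N α p) ↔
        CoulombSobolev.EmbedsInLq α p q (CoulombSobolev.space N α p))) ∧
    (1 < α →
      (CoulombSobolev.EmbedsInLq α p q (CoulombSobolev.radialSpace N α p) ↔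
        CoulombSobolev.QRad N α p q ∨
          (p * ((N : ℝ) - 2) = N + α ∧ 1 / q = 1 / 2 - 1 / (N : ℝ))) ∧
      (CoulombSobolev.QRad N α p q →
        ∃ S : ℝ, 0 < S ∧ ∀ u ∈ CoulombSobolev.radialSpace N α p,
          ENNReal.ofReal S * (∫⁻ x, ‖u x‖ₑ ^ q) ^ (1 / q) ≤
            CoulombSobolev.dirichletEnergy u ^
                (CoulombSobolev.interpolationExponent N α p q / 2) *
              CoulombSobolev.coulombEnergy α p u ^
                ((1 - CoulombSobolev.interpolationExponent N α p q) / (2 * p)))) := by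
  have hp0 : 0 < p := by linarith
  have hq0 : 0 < q := by linarith
  refine ⟨fun hα1 => ⟨fun h => ?_, fun h => h.mono fun _ hu => hu.1⟩,
    fun hα1 => ⟨⟨fun h => h.qRad_or hα1 hαN hp hq, ?_⟩, fun h => ?_⟩⟩
  · exact (h.normalizedBound_of_le_one hα0 hαN hα1 hp hq _).embedsInLq_space hp hq0
  · rintro (h | ⟨h1, h2⟩)
    · exact (CoulombSobolev.normalizedBound_radial hα1 hαN hp hq h).embedsInLq_radialSpace hp hq0
    -- When Δ = 0 the Sobolev exponent is reached without symmetry, although the strict inequality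
    -- of `QRad` cannot hold.
    · have hN3 : 2 < N := CoulombSobolev.two_lt_of_le_mul hα0 hp0 h1.ge
      have hN3' : (2 : ℝ) < N := by exact_mod_cast hN3
      have hqN : q = 2 * N / ((N : ℝ) - 2) := by
        rw [eq_div_iff (by linarith)]
        field_simp at h2
        linarith
      rw [hqN]
      exact (CoulombSobolev.normalizedBound_sobolev hα0 hαN hp hN3 _).embedsInLq_radialSpace hp
        (by rw [← hqN]; exact hq0)
  · obtain ⟨hΔ, hθ0, hθ1⟩ := h.interpolationExponent_mem hα1 hαN hp hq
    obtain ⟨S, hS0, hS⟩ := (CoulombSobolev.normalizedBound_radial hα1 hαN hp hq h).exists_mul_le hp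
      hq0 CoulombSobolev.dilationInvariant_radiallySymmetric hΔ hθ0 hθ1
    exact ⟨S, hS0, fun u hu => hS u hu.1 fun ε _ => hu.2.radiallySymmetric_mollify ε⟩
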